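/- Let $X$ be a (nonempty) compact complex manifold of dimension $n\ge 1$ with a Kähler form $\omega$. Let $H^{1,1}(X,\mathbb{R})$ be the real vector space of smooth closed real $(1,1)$-forms modulo the forms $\sqrt{-1}\,\partial\bar\partial\phi$, $\phi\in C^\infty(X,\mathbb{R})$. For a closed real $(1,1)$-form $\alpha$ let $\lambda_1,\dots,\lambda_n$ be the eigenvalues of $\omega^{-1}\alpha$ (in local coordinates, of the matrix $\omega^{i\bar k}\alpha_{\bar k j}$), put $\Theta_\omega(\alpha)=\sum_{i=1}^n\arctan\lambda_i$, and for $c_0\in\mathbb{R}$ let $$\mathrm{Sol}_\omega(\Theta,\Gamma_{c_0})=\{a\in H^{1,1}(X,\mathbb{R}) : \text{there are } \alpha\in a \text{ and a constant } c\ge c_0 \text{ with } \Theta_\omega(\alpha)=c \text{ on } X\}.$$ For closed real $(1,1)$-forms $\alpha,\eta$ put $Z(\alpha,\eta)=-\int_X e^{-\sqrt{-1}\,\eta+\alpha}$ (the integral of the component of degree $2n$). A function $f$ on a subset $S$ of a real vector space is called concave if $f(sx+ty)\ge s f(x)+t f(y)$ whenever $x,y\in S$, $s,t\ge 0$, $s+t=1$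 and $sx+ty\in S$ ($S$ need not be convex). $\mathrm{Arg}_{p.v.}$ is the principal value of the argument, in $(-\pi,\pi]$. (1) $Z(\alpha,\eta)$ depends only on the classes of $\alpha$ and $\eta$, so that $Z([\alpha],[\omega])$ is defined; and $[\alpha]\mapsto\mathrm{Arg}_{p.v.}\,Z([\alpha],[\omega])$ is a concave map from $\mathrm{Sol}_\omega(\Theta,\Gamma_{(n-1)\frac{\pi}{2}})$ into $[\frac{\pi}{2},\pi)$. (2) For every $\delta\in(0,\frac{\pi}{2})$ there is a constant $C=C(\delta)>0$, independent of $n$, $X$ and $\omega$, such that $[\alpha]\mapsto-\exp\left(-C\,\mathrm{Arg}_{p.v.}\,Z([\alpha],[\omega])\right)$ is concave on $\mathrm{Sol}_\omega(\Theta,\Gamma_{(n-2)\frac{\pi}{2}+\delta})$. -/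

import Mathlib

open scoped Manifold ContDiff

namespace DHYM

noncomputable section

/- `X` is a complex manifold of complex dimension `n`, charted on `Fin n → ℂ` with holomorphic
transition maps (`IsManifold 𝓘(ℂ, Fin n → ℂ) ω X`; here `ω` is Mathlib's symbol for "analytic"). -/

/-- The underlying smooth real manifold of a complex manifold. -/
theorem isManifold_real (n : ℕ) (X : Type*) [TopologicalSpace X] [ChartedSpace (Fin n → ℂ) X]
    [IsManifold 𝓘(ℂ, Fin n → ℂ) ω X] : IsManifold 𝓘(ℝ, Fin n → ℂ) ∞ X := by
  apply isManifold_of_contDiffOn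
  intro e e' he he'
  have h := (contDiffGroupoid ω 𝓘(ℂ, Fin n → ℂ)).compatible he he'
  rw [contDiffGroupoid, mem_groupoid_of_pregroupoid] at h
  have h1 : ContDiffOn ℂ ω (𝓘(ℂ, Fin n → ℂ) ∘ (e.symm ≫ₕ e') ∘ 𝓘(ℂ, Fin n → ℂ).symm)
    (𝓘(ℂ, Fin n → ℂ).symm ⁻¹' (e.symm ≫ₕ e').source ∩ Set.range 𝓘(ℂ, Fin n → ℂ)) := h.1
  exact (h1.of_le le_top).restrict_scalars ℝ

/-- Real differential `2`-forms on `X` (no regularity imposed): a real alternating form on each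
tangent space. The tangent space `TangentSpace _ x` is, by its definition in Mathlib, `Fin n → ℂ`,
by means of the preferred chart at `x`; its complex structure is multiplication by `i`. -/
abbrev TwoForm (n : ℕ) (X : Type*) : Type _ := X → (Fin n → ℂ) [⋀^Fin 2]→L[ℝ] ℝ

/-- The expression of a `2`-form in a chart `e`: the pull-back of the form by `e.symm`. It is
meaningful on `e.target`. -/
def localForm {n : ℕ} {X : Type*} [TopologicalSpace X] [ChartedSpace (Fin n → ℂ) X]
    (α : TwoForm n X) (e : OpenPartialHomeomorph X (Fin n → ℂ)) (z : Fin n → ℂ) :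
    (Fin n → ℂ) [⋀^Fin 2]→L[ℝ] ℝ :=
  (α (e.symm z)).compContinuousLinearMap
    (mfderiv 𝓘(ℝ, Fin n → ℂ) 𝓘(ℝ, Fin n → ℂ) e.symm z)

/-- The real vector space of smooth closed real `(1,1)`-forms on `X`: `2`-forms which are of type
`(1,1)` (that is, `α(iu, iv) = α(u, v)`), smooth, and satisfy `dα = 0`. -/
def closedForms (n : ℕ) (X : Type*) [TopologicalSpace X] [ChartedSpace (Fin n → ℂ) X] :
    Submodule ℝ (TwoForm n X) where
  carrier := {α |
    (∀ (x : X) (u v : Fin n → ℂ), α x ![Complex.I • u, Complex.I • v] = α x ![u, v]) ∧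
    ∀ e ∈ atlas (Fin n → ℂ) X, ContDiffOn ℝ ∞ (localForm α e) e.target ∧
      ∀ z ∈ e.target, extDeriv (localForm α e) z = 0}
  add_mem' := by
    intro α β hα hβ
    refine ⟨fun x u v => ?_, fun e he => ⟨?_, fun z hz => ?_⟩⟩
    · simp [hα.1, hβ.1]
    · exact (hα.2 e he).1.add (hβ.2 e he).1
    · have h : localForm (α + β) e = localForm α e + localForm β e := rfl
      have hd : ∀ {γ : TwoForm n X}, ContDiffOn ℝ ∞ (localForm γ e) e.target →
          DifferentiableAt ℝ (localForm γ e) z := fun hγ =>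
        (hγ.contDiffAt (e.open_target.mem_nhds hz)).differentiableAt (by simp)
      rw [h, extDeriv_add (hd (hα.2 e he).1) (hd (hβ.2 e he).1), (hα.2 e he).2 z hz,
        (hβ.2 e he).2 z hz, add_zero]
  zero_mem' := by
    refine ⟨fun x u v => rfl, fun e he => ⟨?_, fun z hz => ?_⟩⟩
    · exact contDiffOn_const (c := (0 : (Fin n → ℂ) [⋀^Fin 2]→L[ℝ] ℝ))
    · have h : localForm (0 : TwoForm n X) e =
        (0 : ℝ) • (0 : (Fin n → ℂ) → (Fin n → ℂ) [⋀^Fin 2]→L[ℝ] ℝ) := by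
        rw [zero_smul]; rfl
      rw [h, extDeriv_smul, zero_smul]
  smul_mem' := by
    intro c α hα
    refine ⟨fun x u v => ?_, fun e he => ⟨?_, fun z hz => ?_⟩⟩
    · simp [hα.1]
    · exact (hα.2 e he).1.const_smul c
    · have h : localForm (c • α) e = c • localForm α e := rfl
      rw [h, extDeriv_smul, (hα.2 e he).2 z hz, smul_zero]

/-- The type of smooth closed real `(1,1)`-forms on `X`. -/
def ClosedForm (n : ℕ) (X : Type*) [TopologicalSpace X] [ChartedSpace (Fin n → ℂ) X] : Type _ :=
  closedForms n X

instance (n : ℕ) (X : Type*) [TopologicalSpace X] [ChartedSpace (Fin n → ℂ) X] :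
    AddCommGroup (ClosedForm n X) :=
  inferInstanceAs (AddCommGroup (closedForms n X))

instance (n : ℕ) (X : Type*) [TopologicalSpace X] [ChartedSpace (Fin n → ℂ) X] :
    Module ℝ (ClosedForm n X) :=
  inferInstanceAs (Module ℝ (closedForms n X))

/-- The real `(1,1)`-form `i∂∂̄f = i ∑ ∂²f/∂z_j∂z̄_k dz_j ∧ dz̄_k` of a real function `f` on an open
subset of `ℂⁿ`, at `z`, evaluated on `(u, v)`. In terms of the real Hessian `D²f` this is
`(D²f(iu, v) - D²f(u, iv)) / 2`. -/
def ddbar {n : ℕ} (f : (Fin n → ℂ) → ℝ) (z u v : Fin n → ℂ) : ℝ :=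
  (iteratedFDeriv ℝ 2 f z ![Complex.I • u, v] - iteratedFDeriv ℝ 2 f z ![u, Complex.I • v]) / 2

/-- The closed real `(1,1)`-forms `i∂∂̄φ`, for smooth functions `φ : X → ℝ`. -/
def ddbarExact (n : ℕ) (X : Type*) [TopologicalSpace X] [ChartedSpace (Fin n → ℂ) X]
    [IsManifold 𝓘(ℂ, Fin n → ℂ) ω X] : Submodule ℝ (ClosedForm n X) where
  carrier := {α | ∃ φ : X → ℝ, ContMDiff 𝓘(ℝ, Fin n → ℂ) 𝓘(ℝ, ℝ) ∞ φ ∧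
    ∀ e ∈ atlas (Fin n → ℂ) X, ∀ z ∈ e.target, ∀ u v : Fin n → ℂ,
      localForm α.1 e z ![u, v] = ddbar (φ ∘ e.symm) z u v}
  add_mem' := by
    rintro α β ⟨φ, hφ, h⟩ ⟨ψ, hψ, h'⟩
    refine ⟨φ + ψ, hφ.add hψ, fun e he z hz u v => ?_⟩
    have hs : ∀ {χ : X → ℝ}, ContMDiff 𝓘(ℝ, Fin n → ℂ) 𝓘(ℝ, ℝ) ∞ χ →
        ContDiffAt ℝ 2 (χ ∘ e.symm) z := by
      intro χ hχ
      have := isManifold_real n X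
      have h1 : ContMDiffOn 𝓘(ℝ, Fin n → ℂ) 𝓘(ℝ, Fin n → ℂ) ∞ e.symm e.target :=
        contMDiffOn_symm_of_mem_maximalAtlas (IsManifold.subset_maximalAtlas he)
      have h2 := (hχ.comp_contMDiffOn h1).contMDiffAt (e.open_target.mem_nhds hz)
      exact (contMDiffAt_iff_contDiffAt.1 h2).of_le (mod_cast ENat.LEInfty.out)
    have e1 : localForm (α + β : ClosedForm n X).1 e z ![u, v] =
      localForm α.1 e z ![u, v] + localForm β.1 e z ![u, v] := rfl
    have e2 : (φ + ψ) ∘ e.symm = φ ∘ e.symm + ψ ∘ e.symm := rfl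
    rw [e1, h e he z hz, h' e he z hz, e2]
    unfold ddbar
    rw [iteratedFDeriv_add_apply (hs hφ) (hs hψ)]
    simp only [add_apply]
    ring
  zero_mem' := by
    refine ⟨0, contMDiff_const, fun e he z hz u v => ?_⟩
    have e2 : (0 : X → ℝ) ∘ e.symm = fun _ => (0 : ℝ) := rfl
    rw [e2]
    unfold ddbar
    rw [iteratedFDeriv_fun_zero]
    simp
    rfl
  smul_mem' := by
    rintro c α ⟨φ, hφ, h⟩
    refine ⟨c • φ, (contDiff_const_smul (F := ℝ) c).contMDiff.comp hφ, fun e he z hz u v => ?_⟩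
    have hs : ∀ {χ : X → ℝ}, ContMDiff 𝓘(ℝ, Fin n → ℂ) 𝓘(ℝ, ℝ) ∞ χ →
        ContDiffAt ℝ 2 (χ ∘ e.symm) z := by
      intro χ hχ
      have := isManifold_real n X
      have h1 : ContMDiffOn 𝓘(ℝ, Fin n → ℂ) 𝓘(ℝ, Fin n → ℂ) ∞ e.symm e.target :=
        contMDiffOn_symm_of_mem_maximalAtlas (IsManifold.subset_maximalAtlas he)
      have h2 := (hχ.comp_contMDiffOn h1).contMDiffAt (e.open_target.mem_nhds hz)
      exact (contMDiffAt_iff_contDiffAt.1 h2).of_le (mod_cast ENat.LEInfty.out)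
    have e1 : localForm (c • α : ClosedForm n X).1 e z ![u, v] =
      c • localForm α.1 e z ![u, v] := rfl
    have e2 : (c • φ) ∘ e.symm = c • (φ ∘ e.symm) := rfl
    rw [e1, h e he z hz, e2]
    unfold ddbar
    rw [iteratedFDeriv_const_smul_apply (hs hφ)]
    simp only [smul_apply, smul_eq_mul]
    ring

/-- `H^{1,1}(X, ℝ)`: closed real `(1,1)`-forms modulo `i∂∂̄ C^∞(X, ℝ)` (real Bott-Chern
cohomology). -/
abbrev H11 (n : ℕ) (X : Type*) [TopologicalSpace X] [ChartedSpace (Fin n → ℂ) X]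
    [IsManifold 𝓘(ℂ, Fin n → ℂ) ω X] : Type _ :=
  ClosedForm n X ⧸ ddbarExact n X

/-- The class `[α]` of a closed real `(1,1)`-form. -/
def cls {n : ℕ} {X : Type*} [TopologicalSpace X] [ChartedSpace (Fin n → ℂ) X]
    [IsManifold 𝓘(ℂ, Fin n → ℂ) ω X] (α : ClosedForm n X) : H11 n X :=
  (ddbarExact n X).mkQ α

/-- A Kähler form: a closed real `(1,1)`-form `κ` with `κ(u, iu) > 0` for `u ≠ 0`. -/
def IsKahler {n : ℕ} {X : Type*} [TopologicalSpace X] [ChartedSpace (Fin n → ℂ) X]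
    (κ : ClosedForm n X) : Prop :=
  ∀ (x : X) (u : Fin n → ℂ), u ≠ 0 → 0 < κ.1 x ![u, Complex.I • u]

/-- The Hermitian matrix `(a_{jk̄})` of a real `(1,1)`-form `α = i ∑ a_{jk̄} dz_j ∧ dz̄_k` at `x`:
`a_{jk̄} = (α(e_j, i e_k) - i α(e_j, e_k)) / 2`, with `e_j` the standard basis of the tangent space. -/
def hermMatrix {n : ℕ} {X : Type*} (α : TwoForm n X) (x : X) : Matrix (Fin n) (Fin n) ℂ :=
  Matrix.of fun j k =>
    ((α x ![Pi.single j 1, Complex.I • Pi.single k 1] : ℂ) -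
      Complex.I * (α x ![Pi.single j 1, Pi.single k 1] : ℂ)) / 2

/-- The Lagrangian phase `Θ_κ(α)(x) = ∑ arctan λ_i`, where `λ_1, …, λ_n` are the eigenvalues,
with multiplicity, of the endomorphism `κ⁻¹α` of the holomorphic tangent space at `x`. -/
def phase {n : ℕ} {X : Type*} [TopologicalSpace X] [ChartedSpace (Fin n → ℂ) X]
    (κ α : ClosedForm n X) (x : X) : ℝ :=
  ((((hermMatrix κ.1 x)⁻¹ * hermMatrix α.1 x).charpoly.roots).map
    fun μ => Real.arctan μ.re).sum

/-- The set `Sol_κ(Θ, Γ_{c₀})` of classes containing a form `α` with `Θ_κ(α) = c` on `X` for some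
constant `c ≥ c₀`. -/
def Sol {n : ℕ} {X : Type*} [TopologicalSpace X] [ChartedSpace (Fin n → ℂ) X]
    [IsManifold 𝓘(ℂ, Fin n → ℂ) ω X]
    (κ : ClosedForm n X) (c₀ : ℝ) : Set (H11 n X) :=
  {a | ∃ α : ClosedForm n X, cls α = a ∧ ∃ c : ℝ, c₀ ≤ c ∧ ∀ x : X, phase κ α x = c}

/-- The `n`-th exterior power `β ∧ ⋯ ∧ β` of a complex-valued `2`-form `β` on a real vector space,
evaluated on `2n` vectors `v (k, s)`, ordered as `v (0,0), v (0,1), v (1,0), v (1,1), …`. -/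
def wedgePow {n : ℕ} {V : Type*} (β : V → V → ℂ) (v : Fin n × Fin 2 → V) : ℂ :=
  (1 / 2 ^ n : ℂ) * ∑ s : Equiv.Perm (Fin n × Fin 2),
    ((Equiv.Perm.sign s : ℤ) : ℂ) * ∏ k : Fin n, β (v (s (k, 0))) (v (s (k, 1)))

/-- The component of degree `2n` of the form `exp β = ∑ β^m / m!`, for the complex-valued form
`β = α - i κ`. -/
def expTop {n : ℕ} {X : Type*} [TopologicalSpace X] [ChartedSpace (Fin n → ℂ) X]
    (α κ : ClosedForm n X) (x : X)
    (v : Fin n × Fin 2 → Fin n → ℂ) : ℂ :=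
  (1 / (n.factorial : ℂ)) * wedgePow (fun u w =>
    ((α.1 x ![u, w] : ℝ) : ℂ) -
      Complex.I * ((κ.1 x ![u, w] : ℝ) : ℂ)) v

/-- The standard oriented real basis `∂/∂x_1, ∂/∂y_1, …, ∂/∂x_n, ∂/∂y_n` of `ℂⁿ`. -/
def realBasis (n : ℕ) (p : Fin n × Fin 2) : Fin n → ℂ :=
  Pi.single p.1 (![1, Complex.I] p.2)

/-- A smooth partition of unity subordinate to the domains of the preferred charts of `X`. -/
def chartPartition (n : ℕ) (X : Type*) [TopologicalSpace X] [T2Space X] [CompactSpace X]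
    [ChartedSpace (Fin n → ℂ) X] [IsManifold 𝓘(ℂ, Fin n → ℂ) ω X] :
    SmoothPartitionOfUnity X 𝓘(ℝ, Fin n → ℂ) X Set.univ :=
  haveI := isManifold_real n X
  (SmoothPartitionOfUnity.exists_isSubordinate_chartAt_source 𝓘(ℝ, Fin n → ℂ) X).choose

/-- The integral over the compact complex manifold `X`, with its complex orientation, of a
complex-valued form `τ` of degree `2n`: the sum over the charts of the Lebesgue integrals of the
coefficients of the forms `ρ τ`, `ρ` running over a partition of unity subordinate to the charts. -/
def integral {n : ℕ} {X : Type*} [TopologicalSpace X] [T2Space X] [CompactSpace X]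
    [ChartedSpace (Fin n → ℂ) X] [IsManifold 𝓘(ℂ, Fin n → ℂ) ω X]
    (τ : X → (Fin n × Fin 2 → Fin n → ℂ) → ℂ) : ℂ :=
  ∑ᶠ p : X, ∫ z in (chartAt (Fin n → ℂ) p).target,
    (chartPartition n X p ((chartAt (Fin n → ℂ) p).symm z) : ℂ) *
      τ ((chartAt (Fin n → ℂ) p).symm z) (fun q =>
        mfderiv 𝓘(ℝ, Fin n → ℂ) 𝓘(ℝ, Fin n → ℂ) (chartAt (Fin n → ℂ) p).symm z (realBasis n q))

/-- `Z(α, κ) = -∫_X exp(-iκ + α)`, for forms. -/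
def Z {n : ℕ} {X : Type*} [TopologicalSpace X] [T2Space X] [CompactSpace X]
    [ChartedSpace (Fin n → ℂ) X] [IsManifold 𝓘(ℂ, Fin n → ℂ) ω X] (α κ : ClosedForm n X) : ℂ :=
  -integral (expTop α κ)

/-- `Z([α], [κ])`, for classes: `Z` of some representatives. -/
def ZClass {n : ℕ} {X : Type*} [TopologicalSpace X] [T2Space X] [CompactSpace X]
    [ChartedSpace (Fin n → ℂ) X] [IsManifold 𝓘(ℂ, Fin n → ℂ) ω X] (a k : H11 n X) : ℂ :=
  Z (Quotient.out a) (Quotient.out k)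

/-- Concavity of a real function on a subset `S`, not assumed convex, of a real vector space:
Jensen's inequality holds at every convex combination of two points of `S` that lies in `S`. If `S`
is convex this is `ConcaveOn ℝ S f`. -/
def IsConcave {H : Type*} [AddCommGroup H] [Module ℝ H] (S : Set H) (f : H → ℝ) : Prop :=
  ∀ x ∈ S, ∀ y ∈ S, ∀ s t : ℝ, 0 ≤ s → 0 ≤ t → s + t = 1 → s • x + t • y ∈ S →
    s * f x + t * f y ≤ f (s • x + t • y)

end

end DHYM

/-!
A form `α` of constant phase `c` has `det (α - i κ) = r exp (i (c - n π / 2))` with `r > 0` at every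
point (`det_sub_I_smul_polar`), so that `-∫ exp (α - i κ)` has argument `π / 2 + (c - (n - 1) π /
2)` (`exists_Z_polar`, `arg_ZClass`). The number `c - (n - 1) π / 2`, the *reduced phase*, lies in
`(-π / 2, π / 2)` under the hypotheses; write `τ` for its tangent.

*The central charge descends to classes.* The top degree coefficient of `exp (α - i η)` in a chart
is `2ⁿ` times the determinant of the matrix `B` of `α - i η` (`wedgePow_realBasis`). The columns of
`B` are `∂`-closed because `α` and `η` are closed, and so are those of a complex Hessian. Replacing
one column of a matrix with `∂`-closed columns by `∂g`, with `g` of compact support, gives a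
divergence, since cofactors are divergence free; hence adding a complex Hessian of compact support
changes no integral of determinants (`integral_det_add_complexHessian`). A partition of unity cuts a
potential on `X` into pieces supported in charts (`densityIntegral_add_complexHessian`).

*The tangent `τ` is concave.* On eigenvalues, `tan (∑ arctan λ_i - (n - 1) π / 2)` is concave where
the reduced phase exceeds `-π / 2`: one eigenvalue is added at a time by means of the concave
function `(XY - 1) / (X + Y)` (`concaveOn_tan_reducedPhase`). Being symmetric, it does not decrease
from the eigenvalues of a Hermitian matrix to its diagonal, by Birkhoff's theorem, and is therefore
concave and increasing on matrices (`tan_matrixPhase_concave`). If `γ` represents `s [α] + t [β]`,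
then `γ - (s α + t β) = i∂∂̄φ` is nonnegative at a minimum of `φ`, and the comparison of the
matrices there gives `s τ(α) + t τ(β) ≤ τ(γ)` (`tan_phase_concave`).

*One variable.* It remains that `arctan` is concave on `[0, ∞)`, and that `τ ↦ -exp (-C (π / 2 +
arctan τ))` is concave on `[-C / 2, ∞)`; for `c ≥ (n - 2) π / 2 + δ` one has `τ ≥ tan (δ - π / 2)`,
and `C = -2 tan (δ - π / 2)` depends only on `δ`.
-/

namespace DHYM

/-! ### Wedge powers and determinants -/

/-- Passing from the alternating form `γ(u, v) - γ(v, u)` to `γ` itself in an alternating sum: each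
of the factors indexed by `T` contributes a factor `2`, because exchanging the two arguments of one
factor is absorbed in the sum over the permutations. -/
lemma sum_perm_prod_antisymm {n : ℕ} (g : Fin n × Fin 2 → Fin n × Fin 2 → ℂ) (T : Finset (Fin n)) :
    ∑ s : Equiv.Perm (Fin n × Fin 2), ((Equiv.Perm.sign s : ℤ) : ℂ) *
      ((∏ k ∈ T, (g (s (k, 0)) (s (k, 1)) - g (s (k, 1)) (s (k, 0)))) *
        ∏ k ∈ Tᶜ, g (s (k, 0)) (s (k, 1))) =
    2 ^ T.card * ∑ s : Equiv.Perm (Fin n × Fin 2), ((Equiv.Perm.sign s : ℤ) : ℂ) *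
      ∏ k : Fin n, g (s (k, 0)) (s (k, 1)) := by
  classical
  induction T using Finset.induction_on with
  | empty => simp
  | insert a T ha ih =>
    rw [Finset.card_insert_of_notMem ha, pow_succ', mul_assoc, ← ih, two_mul]
    have hsplit : ∀ s : Equiv.Perm (Fin n × Fin 2),
        ((Equiv.Perm.sign s : ℤ) : ℂ) *
          ((∏ k ∈ insert a T, (g (s (k, 0)) (s (k, 1)) - g (s (k, 1)) (s (k, 0)))) *
            ∏ k ∈ (insert a T)ᶜ, g (s (k, 0)) (s (k, 1))) =
        ((Equiv.Perm.sign s : ℤ) : ℂ) *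
          ((∏ k ∈ T, (g (s (k, 0)) (s (k, 1)) - g (s (k, 1)) (s (k, 0)))) *
            (g (s (a, 0)) (s (a, 1)) * ∏ k ∈ (insert a T)ᶜ, g (s (k, 0)) (s (k, 1)))) -
        ((Equiv.Perm.sign s : ℤ) : ℂ) *
          ((∏ k ∈ T, (g (s (k, 0)) (s (k, 1)) - g (s (k, 1)) (s (k, 0)))) *
            (g (s (a, 1)) (s (a, 0)) * ∏ k ∈ (insert a T)ᶜ, g (s (k, 0)) (s (k, 1)))) := by
      intro s
      rw [Finset.prod_insert ha]
      ring
    have hc : Tᶜ = insert a (insert a T)ᶜ := by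
      ext k
      simp only [Finset.mem_compl, Finset.mem_insert]
      by_cases hk : k = a
      · simp [hk, ha]
      · simp [hk]
    have h1 : ∀ s : Equiv.Perm (Fin n × Fin 2), ∏ k ∈ Tᶜ, g (s (k, 0)) (s (k, 1)) =
        g (s (a, 0)) (s (a, 1)) * ∏ k ∈ (insert a T)ᶜ, g (s (k, 0)) (s (k, 1)) := by
      intro s
      rw [hc, Finset.prod_insert (by simp)]
    simp only [hsplit, h1, Finset.sum_sub_distrib]
    rw [sub_eq_add_neg]
    congr 1
    rw [← Finset.sum_neg_distrib]
    let w : Equiv.Perm (Fin n × Fin 2) := Equiv.swap (a, 0) (a, 1)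
    refine Fintype.sum_equiv (Equiv.mulRight w) _ _ fun s => ?_
    have hsw : ∀ k : Fin n, k ≠ a → ∀ i : Fin 2,
        (s * w) (k, i) = s (k, i) := by
      intro k hk i
      rw [Equiv.Perm.mul_apply]
      congr 1
      exact Equiv.swap_apply_of_ne_of_ne (by simp [hk]) (by simp [hk])
    have hw : Equiv.Perm.sign w = -1 := Equiv.Perm.sign_swap (by simp)
    rw [Equiv.coe_mulRight, Equiv.Perm.sign_mul, hw]
    have e1 : ∏ k ∈ T, (g ((s * w) (k, 0))
        ((s * w) (k, 1)) - g ((s * w) (k, 1))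
        ((s * w) (k, 0))) =
        ∏ k ∈ T, (g (s (k, 0)) (s (k, 1)) - g (s (k, 1)) (s (k, 0))) :=
      Finset.prod_congr rfl fun k hk => by
        have hka : k ≠ a := fun h => ha (h ▸ hk)
        rw [hsw k hka, hsw k hka]
    have e2 : ∏ k ∈ (insert a T)ᶜ, g ((s * w) (k, 0))
        ((s * w) (k, 1)) =
        ∏ k ∈ (insert a T)ᶜ, g (s (k, 0)) (s (k, 1)) :=
      Finset.prod_congr rfl fun k hk => by
        have hka : k ≠ a := fun h => by simp [h] at hk
        rw [hsw k hka, hsw k hka]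
    rw [e1, e2]
    simp [w]

/-- The determinant of the real basis `e_j, i e_j` against the coordinates `z_{J k}` and
`z̄_{L k}`. -/
lemma det_realBasis {n : ℕ} (J L : Fin n → Fin n) :
    (Matrix.of fun p q : Fin n × Fin 2 => if q.2 = 0 then realBasis n p (J q.1)
      else (starRingEnd ℂ) (realBasis n p (L q.1))).det =
    (-2 * Complex.I) ^ n *
      ((1 : Matrix (Fin n) (Fin n) ℂ).submatrix id J).det *
      ((1 : Matrix (Fin n) (Fin n) ℂ).submatrix id L).det := by
  classical
  let e : Fin n ⊕ Fin n ≃ Fin n × Fin 2 :=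
    { toFun := Sum.elim (fun k => (k, 0)) (fun k => (k, 1))
      invFun := fun p => if p.2 = 0 then Sum.inl p.1 else Sum.inr p.1
      left_inv := by rintro (k | k) <;> simp
      right_inv := by
        rintro ⟨k, i⟩
        fin_cases i <;> simp }
  rw [← Matrix.det_submatrix_equiv_self e]
  have hM : (Matrix.of fun p q : Fin n × Fin 2 => if q.2 = 0 then realBasis n p (J q.1)
      else (starRingEnd ℂ) (realBasis n p (L q.1))).submatrix e e =
      Matrix.fromBlocks 1 1 (Complex.I • 1) (-Complex.I • 1) *
      Matrix.fromBlocks ((1 : Matrix (Fin n) (Fin n) ℂ).submatrix id J) 0 0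
        ((1 : Matrix (Fin n) (Fin n) ℂ).submatrix id L) := by
    have hs : ∀ (i x : Fin n) (c : ℂ),
        (Pi.single i c : Fin n → ℂ) x = c * (1 : Matrix (Fin n) (Fin n) ℂ) i x := by
      intro i x c
      by_cases hx : x = i
      · rw [hx, Pi.single_eq_same, Matrix.one_apply_eq, mul_one]
      · rw [Pi.single_eq_of_ne hx, Matrix.one_apply_ne (Ne.symm hx), mul_zero]
    have hc : ∀ i x : Fin n, (starRingEnd ℂ) ((1 : Matrix (Fin n) (Fin n) ℂ) i x) =
        (1 : Matrix (Fin n) (Fin n) ℂ) i x := by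
      intro i x
      by_cases hx : i = x
      · rw [hx, Matrix.one_apply_eq, map_one]
      · rw [Matrix.one_apply_ne hx, map_zero]
    rw [Matrix.fromBlocks_multiply]
    ext (i | i) (j | j) <;> simp [e, realBasis, hs, hc] <;> rfl
  rw [hM, Matrix.det_mul, Matrix.det_fromBlocks_zero₂₁, Matrix.det_fromBlocks_one₁₁]
  have h2 : (-Complex.I • (1 : Matrix (Fin n) (Fin n) ℂ) - Complex.I • 1 * 1) =
      (-2 * Complex.I) • 1 := by
    rw [mul_one, ← sub_smul]
    congr 1
    ring
  rw [h2, Matrix.det_smul]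
  simp [mul_assoc]

/-- The `n`-th power of the `(1,1)`-form `i ∑ B_{jk} dz_j ∧ dz̄_k` is `n! det B` times that of the
standard form, whose value on the real basis is `2ⁿ`. -/
theorem wedgePow_realBasis {n : ℕ} (β : (Fin n → ℂ) → (Fin n → ℂ) → ℂ)
    (B : Matrix (Fin n) (Fin n) ℂ)
    (h : ∀ u v, β u v = Complex.I * ∑ j, ∑ k,
      B j k * (u j * (starRingEnd ℂ) (v k) - v j * (starRingEnd ℂ) (u k))) :
    wedgePow β (realBasis n) = 2 ^ n * n.factorial * B.det := by
  classical
  set v := realBasis n with hv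
  let g : Fin n × Fin 2 → Fin n × Fin 2 → ℂ := fun p q =>
    ∑ x : Fin n × Fin n, B x.1 x.2 * (v p x.1 * (starRingEnd ℂ) (v q x.2))
  have hβ : ∀ p q, β (v p) (v q) = Complex.I * (g p q - g q p) := by
    intro p q
    rw [h]
    congr 1
    rw [← Finset.sum_sub_distrib, Fintype.sum_prod_type]
    refine Finset.sum_congr rfl fun j _ => Finset.sum_congr rfl fun k _ => by ring
  have h1 := sum_perm_prod_antisymm g Finset.univ
  simp only [Finset.compl_univ, Finset.prod_empty, mul_one, Finset.card_univ,
    Fintype.card_fin] at h1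
  have h3 : ∀ s : Equiv.Perm (Fin n × Fin 2), ∏ k : Fin n, g (s (k, 0)) (s (k, 1)) =
      ∑ x : Fin n → Fin n × Fin n, (∏ k, B (x k).1 (x k).2) *
        ∏ q : Fin n × Fin 2, (Matrix.of fun p q : Fin n × Fin 2 =>
          if q.2 = 0 then realBasis n p (x q.1).1
          else (starRingEnd ℂ) (realBasis n p (x q.1).2)) (s q) q := by
    intro s
    simp only [g]
    rw [Finset.prod_univ_sum, Fintype.piFinset_univ]
    refine Finset.sum_congr rfl fun x _ => ?_
    rw [Finset.prod_mul_distrib, Fintype.prod_prod_type]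
    simp [hv]
  have h4 : ∑ s : Equiv.Perm (Fin n × Fin 2), ((Equiv.Perm.sign s : ℤ) : ℂ) *
      ∏ k : Fin n, g (s (k, 0)) (s (k, 1)) =
      (-2 * Complex.I) ^ n * (n.factorial * B.det) := by
    simp only [h3, Finset.mul_sum]
    rw [Finset.sum_comm]
    have h5 : ∀ x : Fin n → Fin n × Fin n, ∑ s : Equiv.Perm (Fin n × Fin 2),
        ((Equiv.Perm.sign s : ℤ) : ℂ) * ((∏ k, B (x k).1 (x k).2) *
        ∏ q : Fin n × Fin 2, (Matrix.of fun p q : Fin n × Fin 2 =>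
          if q.2 = 0 then realBasis n p (x q.1).1
          else (starRingEnd ℂ) (realBasis n p (x q.1).2)) (s q) q) =
        ∑ σ : Equiv.Perm (Fin n), ∑ τ : Equiv.Perm (Fin n), (-2 * Complex.I) ^ n *
          (((Equiv.Perm.sign σ : ℤ) : ℂ) * ((Equiv.Perm.sign τ : ℤ) : ℂ) *
          ∏ k, (B (x k).1 (x k).2 * ((1 : Matrix (Fin n) (Fin n) ℂ) (σ k) (x k).1 *
            (1 : Matrix (Fin n) (Fin n) ℂ) (τ k) (x k).2))) := by
      intro x
      have hd := det_realBasis (fun k => (x k).1) (fun k => (x k).2)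
      rw [Matrix.det_apply', Matrix.det_apply', Matrix.det_apply'] at hd
      simp only [mul_left_comm _ (∏ k, B (x k).1 (x k).2)]
      rw [← Finset.mul_sum, hd, mul_assoc, Finset.sum_mul_sum, mul_left_comm, Finset.mul_sum,
        Finset.mul_sum]
      refine Finset.sum_congr rfl fun σ _ => ?_
      rw [Finset.mul_sum, Finset.mul_sum]
      refine Finset.sum_congr rfl fun τ _ => ?_
      have hsub : ∀ (J : Fin n → Fin n) (i j : Fin n),
          (1 : Matrix (Fin n) (Fin n) ℂ).submatrix id J i j =
            (1 : Matrix (Fin n) (Fin n) ℂ) i (J j) := fun _ _ _ => rfl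
      simp only [hsub, Finset.prod_mul_distrib]
      ring
    rw [Finset.sum_congr rfl fun x _ => h5 x, Finset.sum_comm]
    have h6 : ∀ σ : Equiv.Perm (Fin n), ∑ x : Fin n → Fin n × Fin n, ∑ τ : Equiv.Perm (Fin n),
        (-2 * Complex.I) ^ n *
          (((Equiv.Perm.sign σ : ℤ) : ℂ) * ((Equiv.Perm.sign τ : ℤ) : ℂ) *
          ∏ k, (B (x k).1 (x k).2 * ((1 : Matrix (Fin n) (Fin n) ℂ) (σ k) (x k).1 *
            (1 : Matrix (Fin n) (Fin n) ℂ) (τ k) (x k).2))) =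
        (-2 * Complex.I) ^ n * B.det := by
      intro σ
      rw [Finset.sum_comm]
      have h7 : ∀ τ : Equiv.Perm (Fin n), ∑ x : Fin n → Fin n × Fin n,
          ∏ k, (B (x k).1 (x k).2 * ((1 : Matrix (Fin n) (Fin n) ℂ) (σ k) (x k).1 *
            (1 : Matrix (Fin n) (Fin n) ℂ) (τ k) (x k).2)) = ∏ k, B (σ k) (τ k) := by
        intro τ
        rw [← Fintype.piFinset_univ, ← Finset.prod_univ_sum (fun _ => Finset.univ)
          (fun k (x : Fin n × Fin n) => B x.1 x.2 * ((1 : Matrix (Fin n) (Fin n) ℂ) (σ k) x.1 *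
            (1 : Matrix (Fin n) (Fin n) ℂ) (τ k) x.2))]
        refine Finset.prod_congr rfl fun k _ => ?_
        rw [Fintype.sum_prod_type]
        simp [Matrix.one_apply]
      simp only [← Finset.mul_sum, h7]
      congr 1
      have h8 := Matrix.det_permute σ B
      rw [← Matrix.det_transpose, Matrix.det_apply'] at h8
      simp only [Matrix.transpose_apply, Matrix.submatrix_apply, id_eq] at h8
      simp only [mul_assoc]
      rw [← Finset.mul_sum, h8, ← mul_assoc]
      have : ((Equiv.Perm.sign σ : ℤ) : ℂ) * ((Equiv.Perm.sign σ : ℤ) : ℂ) = 1 := by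
        rcases Int.units_eq_one_or (Equiv.Perm.sign σ) with h | h <;> simp [h]
      rw [this, one_mul]
    simp only [h6, Finset.sum_const, Finset.card_univ, Fintype.card_perm, Fintype.card_fin,
      nsmul_eq_mul]
    ring
  unfold wedgePow
  simp only [hβ, Finset.prod_mul_distrib, Finset.prod_const, Finset.card_univ, Fintype.card_fin,
    mul_left_comm _ (Complex.I ^ n)]
  rw [← Finset.mul_sum, h1, h4]
  have h9 : Complex.I ^ n * (-2 * Complex.I) ^ n = 2 ^ n := by
    rw [← mul_pow]
    congr 1
    rw [mul_left_comm, Complex.I_mul_I]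
    ring
  calc _ = (1 / 2 ^ n * 2 ^ n : ℂ) * (Complex.I ^ n * (-2 * Complex.I) ^ n) *
        (n.factorial * B.det) := by ring
    _ = _ := by rw [h9]; field_simp

/-! ### Concavity of the tangent of the reduced phase on `ℝⁿ⁺¹` -/

/-- The function `(X, Y) ↦ (XY - 1) / (X + Y) = tan (arctan X + arctan Y - π / 2)` is concave on
`X + Y > 0` and increasing in `X`. It equals `Y - (Y² + 1) / (X + Y)`, and a square over a
positive linear function is convex. -/
lemma mul_sub_one_div_add_concave {X₁ X₂ X Y₁ Y₂ s t : ℝ} (h₁ : 0 < X₁ + Y₁) (h₂ : 0 < X₂ + Y₂)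
    (hs : 0 ≤ s) (ht : 0 ≤ t) (hst : s + t = 1) (hX : s * X₁ + t * X₂ ≤ X) :
    s * ((X₁ * Y₁ - 1) / (X₁ + Y₁)) + t * ((X₂ * Y₂ - 1) / (X₂ + Y₂)) ≤
      (X * (s * Y₁ + t * Y₂) - 1) / (X + (s * Y₁ + t * Y₂)) := by
  have hform : ∀ {x y : ℝ}, 0 < x + y → (x * y - 1) / (x + y) = y - (y ^ 2 + 1) / (x + y) := by
    intro x y h
    field_simp
    ring
  have hP : 0 < s * (X₁ + Y₁) + t * (X₂ + Y₂) := by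
    rcases hs.eq_or_lt with h | h
    · have : t = 1 := by linarith
      subst this
      simpa [← h] using h₂
    · have := mul_pos h h₁
      have := mul_nonneg ht h₂.le
      linarith
  have hXY : 0 < X + (s * Y₁ + t * Y₂) := by linarith
  rw [hform h₁, hform h₂, hform hXY]
  have key : ((s * Y₁ + t * Y₂) ^ 2 + 1) / (X + (s * Y₁ + t * Y₂)) ≤
      s * ((Y₁ ^ 2 + 1) / (X₁ + Y₁)) + t * ((Y₂ ^ 2 + 1) / (X₂ + Y₂)) := by
    calc ((s * Y₁ + t * Y₂) ^ 2 + 1) / (X + (s * Y₁ + t * Y₂)) ≤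
        ((s * Y₁ + t * Y₂) ^ 2 + 1) / (s * (X₁ + Y₁) + t * (X₂ + Y₂)) := by
          apply div_le_div_of_nonneg_left (by positivity) hP
          linarith
      _ ≤ _ := by
          set P₁ := X₁ + Y₁
          set P₂ := X₂ + Y₂
          rw [div_le_iff₀ hP]
          have e : (s * ((Y₁ ^ 2 + 1) / P₁) + t * ((Y₂ ^ 2 + 1) / P₂)) * (s * P₁ + t * P₂) -
              ((s * Y₁ + t * Y₂) ^ 2 + (s + t) ^ 2) =
              s * t * ((Y₁ * P₂ - Y₂ * P₁) ^ 2 + (P₂ - P₁) ^ 2) / (P₁ * P₂) := by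
            field_simp
            ring
          have : 0 ≤ s * t * ((Y₁ * P₂ - Y₂ * P₁) ^ 2 + (P₂ - P₁) ^ 2) / (P₁ * P₂) := by
            positivity
          rw [hst] at e
          linarith
  linarith

/-- The addition formula for `tan (p + q - π / 2) = -cot (p + q)`. -/
lemma tan_arctan_add_arctan_sub {X Y : ℝ} (h : 0 < X + Y) :
    Real.tan (Real.arctan X + Real.arctan Y - Real.pi / 2) = (X * Y - 1) / (X + Y) := by
  have hX : Real.cos (Real.arctan X) ≠ 0 := (Real.cos_arctan_pos X).ne'
  have hY : Real.cos (Real.arctan Y) ≠ 0 := (Real.cos_arctan_pos Y).ne'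
  rw [Real.tan_eq_sin_div_cos, Real.sin_sub_pi_div_two, Real.cos_sub_pi_div_two, Real.cos_add,
    Real.sin_add]
  have e1 : Real.sin (Real.arctan X) = X * Real.cos (Real.arctan X) := by
    conv_rhs => rw [← Real.tan_arctan X, Real.arctan_tan (Real.neg_pi_div_two_lt_arctan X)
      (Real.arctan_lt_pi_div_two X)]
    rw [Real.tan_mul_cos hX]
  have e2 : Real.sin (Real.arctan Y) = Y * Real.cos (Real.arctan Y) := by
    conv_rhs => rw [← Real.tan_arctan Y, Real.arctan_tan (Real.neg_pi_div_two_lt_arctan Y)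
      (Real.arctan_lt_pi_div_two Y)]
    rw [Real.tan_mul_cos hY]
  rw [e1, e2]
  have e3 : X * Real.cos (Real.arctan X) * Real.cos (Real.arctan Y) +
      Real.cos (Real.arctan X) * (Y * Real.cos (Real.arctan Y)) =
      (X + Y) * (Real.cos (Real.arctan X) * Real.cos (Real.arctan Y)) := by ring
  rw [e3, div_eq_div_iff (by positivity) h.ne']
  ring

lemma arctan_add_arctan_pos {X Y : ℝ} : 0 < Real.arctan X + Real.arctan Y ↔ 0 < X + Y := by
  rw [← neg_lt_iff_pos_add', ← Real.arctan_neg, Real.arctan_strictMono.lt_iff_lt,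
    neg_lt_iff_pos_add']

/-- The reduced phase `∑ arctan x_i - n π / 2` of a point of `ℝⁿ⁺¹`; it is less than `π / 2`. -/
noncomputable def reducedPhase {n : ℕ} (x : Fin (n + 1) → ℝ) : ℝ :=
  ∑ i, Real.arctan (x i) - n * (Real.pi / 2)

lemma reducedPhase_lt {n : ℕ} (x : Fin (n + 1) → ℝ) : reducedPhase x < Real.pi / 2 := by
  have h : ∑ i, Real.arctan (x i) < ∑ _i : Fin (n + 1), Real.pi / 2 :=
    Finset.sum_lt_sum_of_nonempty Finset.univ_nonempty fun i _ => Real.arctan_lt_pi_div_two _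
  simp only [Finset.sum_const, Finset.card_univ, Fintype.card_fin, nsmul_eq_mul, Nat.cast_add,
    Nat.cast_one] at h
  unfold reducedPhase
  linarith

lemma reducedPhase_succ {n : ℕ} (x : Fin (n + 2) → ℝ) :
    reducedPhase x = reducedPhase (fun i : Fin (n + 1) => x i.castSucc) +
      Real.arctan (x (Fin.last _)) - Real.pi / 2 := by
  unfold reducedPhase
  rw [Fin.sum_univ_castSucc]
  push_cast
  ring

/-- The tangent of the reduced phase is concave where the phase exceeds `(n - 1) π / 2`, which is a
convex set. One variable is added at a time, by means of the concave function
`(XY - 1) / (X + Y)`. -/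
theorem concaveOn_tan_reducedPhase (n : ℕ) :
    ConcaveOn ℝ {x : Fin (n + 1) → ℝ | -(Real.pi / 2) < reducedPhase x}
      (fun x => Real.tan (reducedPhase x)) := by
  suffices H : ∀ x y : Fin (n + 1) → ℝ, -(Real.pi / 2) < reducedPhase x →
      -(Real.pi / 2) < reducedPhase y → ∀ s t : ℝ, 0 ≤ s → 0 ≤ t → s + t = 1 →
      -(Real.pi / 2) < reducedPhase (s • x + t • y) ∧
      s * Real.tan (reducedPhase x) + t * Real.tan (reducedPhase y) ≤
        Real.tan (reducedPhase (s • x + t • y)) from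
    ⟨fun x hx y hy s t hs ht hst => (H x y hx hy s t hs ht hst).1,
      fun x hx y hy s t hs ht hst => (H x y hx hy s t hs ht hst).2⟩
  induction n with
  | zero =>
    intro x y _ _ s t _ _ _
    have h0 : ∀ z : Fin (0 + 1) → ℝ, reducedPhase z = Real.arctan (z 0) := by
      intro z
      simp [reducedPhase]
    simp only [h0, Real.tan_arctan]
    exact ⟨Real.neg_pi_div_two_lt_arctan _, le_rfl⟩
  | succ n ih =>
    intro x y hx hy s t hs ht hst
    have aux : ∀ z : Fin (n + 2) → ℝ, -(Real.pi / 2) < reducedPhase z →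
        -(Real.pi / 2) < reducedPhase (fun i : Fin (n + 1) => z i.castSucc) := by
      intro z hz
      rw [reducedPhase_succ] at hz
      have := Real.arctan_lt_pi_div_two (z (Fin.last _))
      linarith
    have aux2 : ∀ z : Fin (n + 2) → ℝ,
        -(Real.pi / 2) < reducedPhase (fun i : Fin (n + 1) => z i.castSucc) →
        reducedPhase z = Real.arctan (Real.tan (reducedPhase fun i : Fin (n + 1) => z i.castSucc)) +
          Real.arctan (z (Fin.last _)) - Real.pi / 2 := by
      intro z hz
      rw [reducedPhase_succ, Real.arctan_tan hz (reducedPhase_lt _)]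
    have aux3 : ∀ z : Fin (n + 2) → ℝ, -(Real.pi / 2) < reducedPhase z →
        0 < Real.tan (reducedPhase fun i : Fin (n + 1) => z i.castSucc) + z (Fin.last _) := by
      intro z hz
      rw [← arctan_add_arctan_pos]
      rw [aux2 z (aux z hz)] at hz
      linarith
    obtain ⟨h1, h2⟩ := ih _ _ (aux x hx) (aux y hy) s t hs ht hst
    have hz1 : (fun i : Fin (n + 1) => (s • x + t • y) i.castSucc) =
      s • (fun i : Fin (n + 1) => x i.castSucc) + t • fun i : Fin (n + 1) => y i.castSucc := rfl
    have hz2 : (s • x + t • y) (Fin.last _) = s * x (Fin.last _) + t * y (Fin.last _) := rfl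
    have key := mul_sub_one_div_add_concave (aux3 x hx) (aux3 y hy) hs ht hst h2
    have hpos : 0 < Real.tan (reducedPhase (s • (fun i : Fin (n + 1) => x i.castSucc) +
        t • fun i : Fin (n + 1) => y i.castSucc)) + (s * x (Fin.last _) + t * y (Fin.last _)) := by
      rcases hs.eq_or_lt with h | h
      · have ht1 : t = 1 := by linarith
        have := aux3 y hy
        rw [← h, ht1] at h2 ⊢
        linarith
      · have := mul_pos h (aux3 x hx)
        have := mul_nonneg ht (aux3 y hy).le
        linarith
    constructor
    · rw [aux2 (s • x + t • y) (by rw [hz1]; exact h1), hz1, hz2]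
      have := arctan_add_arctan_pos.2 hpos
      linarith
    · rw [aux2 x (aux x hx), aux2 y (aux y hy), aux2 (s • x + t • y) (by rw [hz1]; exact h1), hz1,
        hz2, tan_arctan_add_arctan_sub (aux3 x hx), tan_arctan_add_arctan_sub (aux3 y hy),
        tan_arctan_add_arctan_sub hpos]
      exact key

/-- The tangent of the reduced phase is increasing. -/
lemma tan_reducedPhase_mono {n : ℕ} {x y : Fin (n + 1) → ℝ} (h : ∀ i, x i ≤ y i)
    (hx : -(Real.pi / 2) < reducedPhase x) :
    -(Real.pi / 2) < reducedPhase y ∧ Real.tan (reducedPhase x) ≤ Real.tan (reducedPhase y) := by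
  have h1 : reducedPhase x ≤ reducedPhase y :=
    sub_le_sub_right (Finset.sum_le_sum fun i _ => Real.arctan_strictMono.monotone (h i)) _
  exact ⟨hx.trans_le h1, Real.strictMonoOn_tan.monotoneOn ⟨hx, reducedPhase_lt x⟩
    ⟨hx.trans_le h1, reducedPhase_lt y⟩ h1⟩

/-! ### The phase of a pair of Hermitian matrices -/

open Matrix ComplexOrder in
/-- The sum of the arctangents of the eigenvalues of `K⁻¹ A`. -/
noncomputable def matrixPhase {n : ℕ} (K A : Matrix (Fin n) (Fin n) ℂ) : ℝ :=
  ((K⁻¹ * A).charpoly.roots.map fun μ => Real.arctan μ.re).sum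

open Matrix ComplexOrder in
lemma exists_unitary_diagonalization {n : ℕ} {A : Matrix (Fin n) (Fin n) ℂ} (hA : A.IsHermitian) :
    ∃ U : Matrix (Fin n) (Fin n) ℂ, Uᴴ * U = 1 ∧
      Uᴴ * A * U = diagonal fun i => (hA.eigenvalues i : ℂ) := by
  refine ⟨hA.eigenvectorUnitary, ?_, ?_⟩
  · exact Unitary.coe_star_mul_self hA.eigenvectorUnitary
  · have h := hA.conjStarAlgAut_star_eigenvectorUnitary
    rw [Unitary.conjStarAlgAut_star_apply] at h
    exact h

open Matrix ComplexOrder in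
/-- A positive definite and a Hermitian matrix are simultaneously diagonalized by a congruence. -/
theorem exists_simultaneous_diagonalization {n : ℕ} {K A : Matrix (Fin n) (Fin n) ℂ}
    (hK : K.PosDef) (hA : A.IsHermitian) :
    ∃ P : Matrix (Fin n) (Fin n) ℂ, ∃ a : Fin n → ℝ, Pᴴ * K * P = 1 ∧
      Pᴴ * A * P = diagonal fun i => (a i : ℂ) := by
  obtain ⟨U, -, hUK⟩ := exists_unitary_diagonalization hK.1
  set S : Matrix (Fin n) (Fin n) ℂ := diagonal fun i => ((√(hK.1.eigenvalues i))⁻¹ : ℂ) with hS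
  have hSS : Sᴴ = S := by
    rw [hS, diagonal_conjTranspose]
    congr 1
    ext i
    simp
  have h1 : (U * S)ᴴ * K * (U * S) = 1 := by
    have : (U * S)ᴴ * K * (U * S) = S * (Uᴴ * K * U) * S := by
      rw [conjTranspose_mul, hSS]
      simp only [Matrix.mul_assoc]
    rw [this, hUK, hS, diagonal_mul_diagonal, diagonal_mul_diagonal, ← diagonal_one]
    congr 1
    ext i
    have hpos := hK.eigenvalues_pos i
    have h2 : ((√(hK.1.eigenvalues i) : ℝ) : ℂ) * (√(hK.1.eigenvalues i) : ℝ) =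
      (hK.1.eigenvalues i : ℂ) := by
      rw [← Complex.ofReal_mul, Real.mul_self_sqrt hpos.le]
    have h3 : ((√(hK.1.eigenvalues i) : ℝ) : ℂ) ≠ 0 := by
      exact_mod_cast (Real.sqrt_pos.2 hpos).ne'
    rw [← h2]
    field_simp
  have hA' : ((U * S)ᴴ * A * (U * S)).IsHermitian := by
    unfold IsHermitian
    simp only [conjTranspose_mul, conjTranspose_conjTranspose, hA.eq, Matrix.mul_assoc]
  obtain ⟨W, hW, hWA⟩ := exists_unitary_diagonalization hA'
  refine ⟨U * S * W, hA'.eigenvalues, ?_, ?_⟩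
  · calc (U * S * W)ᴴ * K * (U * S * W) = Wᴴ * ((U * S)ᴴ * K * (U * S)) * W := by
          rw [conjTranspose_mul (U * S)]
          simp only [Matrix.mul_assoc]
      _ = 1 := by rw [h1, Matrix.mul_one, hW]
  · rw [← hWA, conjTranspose_mul (U * S)]
    simp only [Matrix.mul_assoc]

open Matrix ComplexOrder in
lemma mul_mul_conjTranspose_eq_one {n : ℕ} {K P : Matrix (Fin n) (Fin n) ℂ}
    (hP : Pᴴ * K * P = 1) : P * (Pᴴ * K) = 1 ∧ K * P * Pᴴ = 1 := by
  refine ⟨mul_eq_one_comm.1 hP, ?_⟩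
  rw [Matrix.mul_assoc] at hP
  exact mul_eq_one_comm.1 hP

open Matrix ComplexOrder in
lemma matrixPhase_eq {n : ℕ} {K A P : Matrix (Fin n) (Fin n) ℂ} {a : Fin n → ℝ}
    (hK : Pᴴ * K * P = 1) (hA : Pᴴ * A * P = diagonal fun i => (a i : ℂ)) :
    matrixPhase K A = ∑ i, Real.arctan (a i) := by
  obtain ⟨h1, h2⟩ := mul_mul_conjTranspose_eq_one hK
  have hinv : K⁻¹ = P * Pᴴ := inv_eq_right_inv (by rw [← Matrix.mul_assoc]; exact h2)
  have hc : (K⁻¹ * A).charpoly = ∏ i, (Polynomial.X - Polynomial.C (a i : ℂ)) := by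
    rw [hinv, ← charpoly_diagonal, ← hA, Matrix.mul_assoc, charpoly_mul_comm]
  unfold matrixPhase
  rw [hc, Polynomial.roots_prod _ _ (Finset.prod_ne_zero_iff.2
    fun i _ => Polynomial.X_sub_C_ne_zero _)]
  simp only [Polynomial.roots_X_sub_C, Multiset.bind_singleton, Multiset.map_map,
    Function.comp_apply, Complex.ofReal_re]
  rfl

/-- A jointly concave symmetric function does not decrease under doubly stochastic averaging;
by Birkhoff's theorem such an average is a convex combination of permutations. -/
lemma tan_reducedPhase_le_of_doublyStochastic {n : ℕ} {M : Matrix (Fin (n + 1)) (Fin (n + 1)) ℝ}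
    (hM : M ∈ doublyStochastic ℝ (Fin (n + 1))) {a : Fin (n + 1) → ℝ}
    (ha : -(Real.pi / 2) < reducedPhase a) :
    -(Real.pi / 2) < reducedPhase (M.mulVec a) ∧
      Real.tan (reducedPhase a) ≤ Real.tan (reducedPhase (M.mulVec a)) := by
  obtain ⟨w, hw0, hw1, hwM⟩ := exists_eq_sum_perm_of_mem_doublyStochastic hM
  have hperm : ∀ σ : Equiv.Perm (Fin (n + 1)), reducedPhase (a ∘ σ) = reducedPhase a := by
    intro σ
    unfold reducedPhase
    rw [← Equiv.sum_comp σ (fun i => Real.arctan (a i))]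
    rfl
  have hMa : M.mulVec a = ∑ σ, w σ • (a ∘ σ) := by
    rw [← hwM, Matrix.sum_mulVec]
    refine Finset.sum_congr rfl fun σ _ => ?_
    rw [Matrix.smul_mulVec, Matrix.permMatrix_mulVec]
  have hc := concaveOn_tan_reducedPhase n
  have hmem : ∀ σ ∈ (Finset.univ : Finset (Equiv.Perm (Fin (n + 1)))),
      (a ∘ σ) ∈ {x : Fin (n + 1) → ℝ | -(Real.pi / 2) < reducedPhase x} := by
    intro σ _
    rw [Set.mem_ofPred_eq, hperm]
    exact ha
  constructor
  · rw [hMa]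
    exact hc.1.sum_mem (fun σ _ => hw0 σ) hw1 hmem
  · have := hc.le_map_sum (fun σ _ => hw0 σ) hw1 hmem
    rw [← hMa] at this
    simpa only [hperm, smul_eq_mul, ← Finset.sum_mul, hw1, one_mul] using this

open Matrix ComplexOrder in
/-- The diagonal of a Hermitian matrix in any `K`-orthonormal basis has at least the tangent of
the reduced phase of its `K`-eigenvalues. -/
lemma tan_reducedPhase_le_diag {n : ℕ} {K A P Q : Matrix (Fin (n + 1)) (Fin (n + 1)) ℂ}
    {a : Fin (n + 1) → ℝ} (hP : Pᴴ * K * P = 1) (hQ : Qᴴ * K * Q = 1)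
    (hA : Qᴴ * A * Q = diagonal fun i => (a i : ℂ)) (ha : -(Real.pi / 2) < reducedPhase a) :
    -(Real.pi / 2) < reducedPhase (fun i => ((Pᴴ * A * P) i i).re) ∧
      Real.tan (reducedPhase a) ≤ Real.tan (reducedPhase fun i => ((Pᴴ * A * P) i i).re) := by
  obtain ⟨hP1, hP2⟩ := mul_mul_conjTranspose_eq_one hP
  obtain ⟨hQ1, hQ2⟩ := mul_mul_conjTranspose_eq_one hQ
  -- the unitary matrix relating the two orthonormal bases
  set W := Pᴴ * K * Q with hW
  have hKh : Kᴴ = K := by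
    have h1 : Pᴴ * Kᴴ * P = 1 := by
      have := congrArg conjTranspose hP
      simpa only [conjTranspose_mul, conjTranspose_conjTranspose, conjTranspose_one,
        ← Matrix.mul_assoc] using this
    calc Kᴴ = (K * P * Pᴴ) * Kᴴ * (P * (Pᴴ * K)) := by rw [hP1, hP2, Matrix.one_mul, Matrix.mul_one]
      _ = K * P * (Pᴴ * Kᴴ * P) * (Pᴴ * K) := by simp only [Matrix.mul_assoc]
      _ = K * (P * (Pᴴ * K)) := by rw [h1, Matrix.mul_one, Matrix.mul_assoc]
      _ = K := by rw [hP1, Matrix.mul_one]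
  have hWh : Wᴴ = Qᴴ * K * P := by
    simp only [hW, conjTranspose_mul, conjTranspose_conjTranspose, hKh, Matrix.mul_assoc]
  have hWW : W * Wᴴ = 1 := by
    calc W * Wᴴ = Pᴴ * (K * Q * Qᴴ) * K * P := by rw [hWh, hW]; simp only [Matrix.mul_assoc]
      _ = 1 := by rw [hQ2, Matrix.mul_one, hP]
  have hWW' : Wᴴ * W = 1 := mul_eq_one_comm.1 hWW
  have hPA : Pᴴ * A * P = W * (diagonal fun i => (a i : ℂ)) * Wᴴ := by
    rw [← hA, hWh, hW]
    calc Pᴴ * A * P = Pᴴ * ((K * Q * Qᴴ) * A * (Q * (Qᴴ * K))) * P := by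
          rw [hQ1, hQ2, Matrix.one_mul, Matrix.mul_one]
      _ = _ := by simp only [Matrix.mul_assoc]
  let M : Matrix (Fin (n + 1)) (Fin (n + 1)) ℝ := Matrix.of fun i j => Complex.normSq (W i j)
  have hM : M ∈ doublyStochastic ℝ (Fin (n + 1)) := by
    rw [mem_doublyStochastic_iff_sum]
    refine ⟨fun i j => Complex.normSq_nonneg _, fun i => ?_, fun j => ?_⟩
    · have := congrFun (congrFun hWW i) i
      rw [Matrix.mul_apply, Matrix.one_apply_eq] at this
      have h2 : ((∑ j, M i j : ℝ) : ℂ) = 1 := by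
        rw [← this]
        push_cast
        refine Finset.sum_congr rfl fun j _ => ?_
        rw [conjTranspose_apply]
        exact (Complex.mul_conj _).symm
      exact_mod_cast h2
    · have := congrFun (congrFun hWW' j) j
      rw [Matrix.mul_apply, Matrix.one_apply_eq] at this
      have h2 : ((∑ i, M i j : ℝ) : ℂ) = 1 := by
        rw [← this]
        push_cast
        refine Finset.sum_congr rfl fun i _ => ?_
        rw [conjTranspose_apply, mul_comm]
        exact (Complex.mul_conj _).symm
      exact_mod_cast h2
  have hd : (fun i => ((Pᴴ * A * P) i i).re) = M.mulVec a := by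
    ext i
    have h2 : (Pᴴ * A * P) i i = ((M.mulVec a i : ℝ) : ℂ) := by
      rw [hPA, Matrix.mul_apply]
      simp only [Matrix.mulVec, dotProduct]
      push_cast
      refine Finset.sum_congr rfl fun j _ => ?_
      rw [mul_diagonal, conjTranspose_apply]
      have : (M i j : ℂ) = W i j * star (W i j) := (Complex.mul_conj _).symm
      rw [this]
      ring
    rw [h2, Complex.ofReal_re]
  rw [hd]
  exact tan_reducedPhase_le_of_doublyStochastic hM ha

open Matrix ComplexOrder in
/-- If `C ≥ s A + t B`, the tangents of the reduced phases satisfy Jensen's inequality. The matrix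
`C` is diagonalized; then only the diagonals of `A` and `B` matter. -/
theorem tan_matrixPhase_concave {n : ℕ} {K A B C : Matrix (Fin (n + 1)) (Fin (n + 1)) ℂ}
    (hK : K.PosDef) (hA : A.IsHermitian) (hB : B.IsHermitian) (hC : C.IsHermitian) {s t : ℝ}
    (hs : 0 ≤ s) (ht : 0 ≤ t) (hst : s + t = 1)
    (h : (C - ((s : ℂ) • A + (t : ℂ) • B)).PosSemidef)
    (hθA : -(Real.pi / 2) < matrixPhase K A - n * (Real.pi / 2))
    (hθB : -(Real.pi / 2) < matrixPhase K B - n * (Real.pi / 2)) :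
    s * Real.tan (matrixPhase K A - n * (Real.pi / 2)) +
      t * Real.tan (matrixPhase K B - n * (Real.pi / 2)) ≤
      Real.tan (matrixPhase K C - n * (Real.pi / 2)) := by
  obtain ⟨P, c, hP, hPC⟩ := exists_simultaneous_diagonalization hK hC
  obtain ⟨Q, a, hQ, hQA⟩ := exists_simultaneous_diagonalization hK hA
  obtain ⟨R, b, hR, hRB⟩ := exists_simultaneous_diagonalization hK hB
  rw [matrixPhase_eq hP hPC, matrixPhase_eq hQ hQA, matrixPhase_eq hR hRB]
  rw [matrixPhase_eq hQ hQA] at hθA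
  rw [matrixPhase_eq hR hRB] at hθB
  obtain ⟨ha1, ha2⟩ := tan_reducedPhase_le_diag hP hQ hQA hθA
  obtain ⟨hb1, hb2⟩ := tan_reducedPhase_le_diag hP hR hRB hθB
  set a' : Fin (n + 1) → ℝ := fun i => ((Pᴴ * A * P) i i).re
  set b' : Fin (n + 1) → ℝ := fun i => ((Pᴴ * B * P) i i).re
  have hconc := concaveOn_tan_reducedPhase n
  have hz := hconc.1 ha1 hb1 hs ht hst
  have hz2 := hconc.2 ha1 hb1 hs ht hst
  have hcz : ∀ i, (s • a' + t • b') i ≤ c i := by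
    intro i
    have hd := (h.conjTranspose_mul_mul_same P).diag_nonneg (i := i)
    have e : (Pᴴ * (C - ((s : ℂ) • A + (t : ℂ) • B)) * P) i i =
        (c i : ℂ) - ((s : ℂ) * (Pᴴ * A * P) i i + (t : ℂ) * (Pᴴ * B * P) i i) := by
      have : Pᴴ * (C - ((s : ℂ) • A + (t : ℂ) • B)) * P =
          Pᴴ * C * P - ((s : ℂ) • (Pᴴ * A * P) + (t : ℂ) • (Pᴴ * B * P)) := by
        simp only [Matrix.mul_sub, Matrix.mul_add, Matrix.sub_mul, Matrix.add_mul,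
          Matrix.mul_smul, Matrix.smul_mul]
      rw [this, hPC]
      simp [Matrix.sub_apply, Matrix.add_apply, Matrix.smul_apply]
    rw [e] at hd
    have hre := (Complex.le_def.1 hd).1
    simp only [Complex.zero_re, Complex.sub_re, Complex.add_re, Complex.ofReal_re,
      Complex.re_ofReal_mul] at hre
    simp only [Pi.add_apply, Pi.smul_apply, smul_eq_mul, a', b']
    linarith
  have hm := (tan_reducedPhase_mono hcz hz).2
  have h1 := mul_le_mul_of_nonneg_left ha2 hs
  have h2 := mul_le_mul_of_nonneg_left hb2 ht
  simp only [smul_eq_mul] at hz2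
  change s * Real.tan (reducedPhase a) + t * Real.tan (reducedPhase b) ≤ Real.tan (reducedPhase c)
  linarith

open Matrix ComplexOrder in
lemma matrixPhase_lt {n : ℕ} {K A : Matrix (Fin (n + 1)) (Fin (n + 1)) ℂ}
    (hK : K.PosDef) (hA : A.IsHermitian) :
    matrixPhase K A - n * (Real.pi / 2) < Real.pi / 2 := by
  obtain ⟨Q, a, hQ, hQA⟩ := exists_simultaneous_diagonalization hK hA
  rw [matrixPhase_eq hQ hQA]
  exact reducedPhase_lt a

/-- The polar form of `a - i`. -/
lemma ofReal_sub_I_polar (a : ℝ) : (a : ℂ) - Complex.I =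
    (√(1 + a ^ 2) : ℝ) * Complex.exp (Complex.I * (Real.arctan a - Real.pi / 2 : ℝ)) := by
  have h : √(1 + a ^ 2) ≠ 0 := (Real.sqrt_pos.2 (by positivity)).ne'
  rw [mul_comm Complex.I, Complex.exp_mul_I, ← Complex.ofReal_cos, ← Complex.ofReal_sin,
    Real.cos_sub_pi_div_two, Real.sin_sub_pi_div_two, Real.cos_arctan, Real.sin_arctan]
  apply Complex.ext
  · simp
    field_simp
  · simp
    field_simp

open Matrix ComplexOrder in
/-- The phase is, up to the constant `n π / 2`, an argument of `det (A - i K)`. -/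
theorem det_sub_I_smul_polar {n : ℕ} {K A : Matrix (Fin n) (Fin n) ℂ}
    (hK : K.PosDef) (hA : A.IsHermitian) :
    ∃ r : ℝ, 0 < r ∧ (A - Complex.I • K).det =
      r * Complex.exp (Complex.I * (matrixPhase K A - n * (Real.pi / 2) : ℝ)) := by
  obtain ⟨P, a, hP, hPA⟩ := exists_simultaneous_diagonalization hK hA
  have hdet : Pᴴ * (A - Complex.I • K) * P = diagonal fun i => ((a i : ℂ) - Complex.I) := by
    simp only [Matrix.mul_sub, Matrix.sub_mul, Matrix.mul_smul, Matrix.smul_mul, hP, hPA]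
    ext i j
    by_cases hij : i = j
    · subst hij
      simp
    · simp [hij]
  have hd := congrArg Matrix.det hdet
  rw [det_mul, det_mul, det_conjTranspose, det_diagonal] at hd
  have hP0 : P.det ≠ 0 := by
    intro h0
    have := congrArg Matrix.det hP
    rw [det_mul, h0] at this
    simp at this
  have hns : 0 < Complex.normSq P.det := Complex.normSq_pos.2 hP0
  have hr : 0 < ∏ i, √(1 + a i ^ 2) :=
    Finset.prod_pos fun i _ => Real.sqrt_pos.2 (by positivity)
  refine ⟨(∏ i, √(1 + a i ^ 2)) / Complex.normSq P.det, by positivity, ?_⟩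
  have hprod : ∏ i, ((a i : ℂ) - Complex.I) = ((∏ i, √(1 + a i ^ 2) : ℝ) : ℂ) *
      Complex.exp (Complex.I * (matrixPhase K A - n * (Real.pi / 2) : ℝ)) := by
    simp only [ofReal_sub_I_polar, Finset.prod_mul_distrib]
    rw [← Complex.exp_sum, ← Finset.mul_sum, ← Complex.ofReal_sum, Finset.sum_sub_distrib,
      matrixPhase_eq hP hPA]
    simp
  have e2 : (star P.det) * P.det = (Complex.normSq P.det : ℂ) := by
    rw [mul_comm]
    exact Complex.mul_conj _
  have e3 : (Complex.normSq P.det : ℂ) ≠ 0 := by exact_mod_cast hns.ne'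
  have e4 : (Complex.normSq P.det : ℂ) * (A - Complex.I • K).det =
      ((∏ i, √(1 + a i ^ 2) : ℝ) : ℂ) *
      Complex.exp (Complex.I * (matrixPhase K A - n * (Real.pi / 2) : ℝ)) := by
    rw [← hprod, ← hd, ← e2]
    ring
  rw [Complex.ofReal_div, div_mul_eq_mul_div, ← e4, mul_div_cancel_left₀ _ e3]

/-! ### Wirtinger derivatives -/

/-- The Wirtinger derivative `∂G/∂z_j` of a complex function on `ℂⁿ`. -/
noncomputable def dz {n : ℕ} (j : Fin n) (G : (Fin n → ℂ) → ℂ) (z : Fin n → ℂ) : ℂ :=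
  (fderiv ℝ G z (Pi.single j 1) - Complex.I * fderiv ℝ G z (Complex.I • Pi.single j 1)) / 2

/-- The Wirtinger derivative `∂G/∂z̄_j` of a complex function on `ℂⁿ`. -/
noncomputable def dzbar {n : ℕ} (j : Fin n) (G : (Fin n → ℂ) → ℂ) (z : Fin n → ℂ) : ℂ :=
  (fderiv ℝ G z (Pi.single j 1) + Complex.I * fderiv ℝ G z (Complex.I • Pi.single j 1)) / 2

/-- The complex Hessian `∂²f/∂z_j∂z̄_k`. -/
noncomputable def complexHessian {n : ℕ} (f : (Fin n → ℂ) → ℂ) (z : Fin n → ℂ) :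
    Matrix (Fin n) (Fin n) ℂ :=
  Matrix.of fun j k => dz j (dzbar k f) z

section Wirtinger

variable {n : ℕ} {G H : (Fin n → ℂ) → ℂ} {z : Fin n → ℂ}

lemma dz_congr (h : G =ᶠ[nhds z] H) (j : Fin n) : dz j G z = dz j H z := by
  unfold dz
  rw [h.fderiv_eq]

lemma dzbar_congr (h : G =ᶠ[nhds z] H) (j : Fin n) : dzbar j G z = dzbar j H z := by
  unfold dzbar
  rw [h.fderiv_eq]

lemma complexHessian_congr (h : G =ᶠ[nhds z] H) : complexHessian G z = complexHessian H z := by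
  ext j k
  exact dz_congr (h.eventuallyEq_nhds.mono fun y hy => dzbar_congr hy k) j

lemma dz_add (hG : DifferentiableAt ℝ G z) (hH : DifferentiableAt ℝ H z) (j : Fin n) :
    dz j (fun y => G y + H y) z = dz j G z + dz j H z := by
  unfold dz
  rw [fderiv_fun_add hG hH]
  simp only [add_apply]
  ring

lemma dzbar_add (hG : DifferentiableAt ℝ G z) (hH : DifferentiableAt ℝ H z) (j : Fin n) :
    dzbar j (fun y => G y + H y) z = dzbar j G z + dzbar j H z := by
  unfold dzbar
  rw [fderiv_fun_add hG hH]
  simp only [add_apply]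
  ring

lemma dz_mul (hG : DifferentiableAt ℝ G z) (hH : DifferentiableAt ℝ H z) (j : Fin n) :
    dz j (fun y => G y * H y) z = dz j G z * H z + G z * dz j H z := by
  unfold dz
  rw [fderiv_fun_mul hG hH]
  simp only [add_apply, smul_apply, smul_eq_mul]
  ring

lemma dz_const (c : ℂ) (j : Fin n) : dz j (fun _ => c) z = 0 := by
  unfold dz
  rw [fderiv_fun_const]
  simp

lemma dzbar_const (c : ℂ) (j : Fin n) : dzbar j (fun _ => c) z = 0 := by
  unfold dzbar
  rw [fderiv_fun_const]
  simp

lemma dz_const_mul (hG : DifferentiableAt ℝ G z) (c : ℂ) (j : Fin n) :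
    dz j (fun y => c * G y) z = c * dz j G z := by
  rw [dz_mul (differentiableAt_const c) hG, dz_const]
  ring

lemma dzbar_const_mul (hG : DifferentiableAt ℝ G z) (c : ℂ) (j : Fin n) :
    dzbar j (fun y => c * G y) z = c * dzbar j G z := by
  unfold dzbar
  rw [fderiv_const_mul hG]
  simp only [smul_apply, smul_eq_mul]
  ring

lemma dz_sum {ι : Type*} (s : Finset ι) {F : ι → (Fin n → ℂ) → ℂ}
    (hF : ∀ i ∈ s, DifferentiableAt ℝ (F i) z) (j : Fin n) :
    dz j (fun y => ∑ i ∈ s, F i y) z = ∑ i ∈ s, dz j (F i) z := by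
  classical
  induction s using Finset.induction_on with
  | empty => simp [dz_const]
  | insert a s ha ih =>
    simp only [Finset.sum_insert ha]
    rw [dz_add (hF a (by simp)) (DifferentiableAt.fun_sum fun i hi => hF i (by simp [hi])),
      ih fun i hi => hF i (by simp [hi])]

lemma differentiableAt_prod {ι : Type*} (s : Finset ι) {F : ι → (Fin n → ℂ) → ℂ}
    (hF : ∀ i ∈ s, DifferentiableAt ℝ (F i) z) :
    DifferentiableAt ℝ (fun y => ∏ i ∈ s, F i y) z := by
  classical
  exact (HasFDerivAt.finsetProd fun i hi => (hF i hi).hasFDerivAt).differentiableAt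

lemma dz_prod {ι : Type*} [DecidableEq ι] (s : Finset ι) {F : ι → (Fin n → ℂ) → ℂ}
    (hF : ∀ i ∈ s, DifferentiableAt ℝ (F i) z) (j : Fin n) :
    dz j (fun y => ∏ i ∈ s, F i y) z = ∑ i ∈ s, dz j (F i) z * ∏ k ∈ s.erase i, F k z := by
  induction s using Finset.induction_on with
  | empty => simp [dz_const]
  | insert a s ha ih =>
    simp only [Finset.prod_insert ha, Finset.sum_insert ha]
    rw [dz_mul (hF a (by simp)) (differentiableAt_prod s fun i hi => hF i (by simp [hi])),
      ih fun i hi => hF i (by simp [hi]), Finset.erase_insert ha, Finset.mul_sum]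
    congr 1
    refine Finset.sum_congr rfl fun i hi => ?_
    have hia : i ≠ a := fun h => ha (h ▸ hi)
    rw [Finset.erase_insert_of_ne hia.symm, Finset.prod_insert (by simp [ha])]
    ring

/-- The derivative of a determinant is the sum over the columns of the determinants in which the
column is differentiated. -/
lemma dz_det {M : (Fin n → ℂ) → Matrix (Fin n) (Fin n) ℂ}
    (hM : ∀ i k, DifferentiableAt ℝ (fun y => M y i k) z) (j : Fin n) :
    dz j (fun y => (M y).det) z =
      ∑ m, ((M z).updateCol m fun i => dz j (fun y => M y i m) z).det := by
  classical
  simp only [Matrix.det_apply']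
  rw [dz_sum]
  · rw [Finset.sum_comm]
    refine Finset.sum_congr rfl fun σ _ => ?_
    rw [dz_const_mul (differentiableAt_prod _ fun i _ => hM _ _),
      dz_prod _ (fun i _ => hM _ _), Finset.mul_sum]
    refine Finset.sum_congr rfl fun m _ => ?_
    rw [← Finset.mul_prod_erase Finset.univ _ (Finset.mem_univ m)]
    congr 2
    · simp
    · refine Finset.prod_congr rfl fun k hk => ?_
      rw [Matrix.updateCol_ne (Finset.ne_of_mem_erase hk)]
  · intro σ _
    exact (differentiableAt_const _).mul (differentiableAt_prod _ fun i _ => hM _ _)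

lemma contDiff_dz {N : ℕ∞} (hG : ContDiff ℝ ∞ G) (j : Fin n) : ContDiff ℝ N (dz j G) := by
  have h : ContDiff ℝ N (fderiv ℝ G) := hG.fderiv_right (by exact_mod_cast le_top)
  unfold dz
  exact ((h.clm_apply contDiff_const).sub
    (contDiff_const.mul (h.clm_apply contDiff_const))).div_const 2

lemma contDiff_dzbar {N : ℕ∞} (hG : ContDiff ℝ ∞ G) (j : Fin n) : ContDiff ℝ N (dzbar j G) := by
  have h : ContDiff ℝ N (fderiv ℝ G) := hG.fderiv_right (by exact_mod_cast le_top)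
  unfold dzbar
  exact ((h.clm_apply contDiff_const).add
    (contDiff_const.mul (h.clm_apply contDiff_const))).div_const 2

lemma ContDiffAt.dzbar_differentiableAt (hG : ContDiffAt ℝ 2 G z) (j : Fin n) :
    DifferentiableAt ℝ (dzbar j G) z := by
  have h : DifferentiableAt ℝ (fderiv ℝ G) z :=
    (hG.fderiv_right (m := 1) (by norm_num)).differentiableAt (by norm_num)
  unfold dzbar
  have h1 : ∀ w : Fin n → ℂ, DifferentiableAt ℝ (fun y => fderiv ℝ G y w) z := fun w =>
    h.clm_apply (differentiableAt_const w)
  have h2 := ((h1 (Pi.single j 1)).fun_add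
    ((h1 (Complex.I • Pi.single j 1)).const_mul Complex.I)).mul_const (2⁻¹ : ℂ)
  simpa only [div_eq_mul_inv] using h2

lemma ContDiffAt.eventually_differentiableAt_of_two {E F : Type*} [NormedAddCommGroup E]
    [NormedSpace ℝ E] [NormedAddCommGroup F] [NormedSpace ℝ F] {f : E → F} {x : E}
    (hf : ContDiffAt ℝ 2 f x) : ∀ᶠ y in nhds x, DifferentiableAt ℝ f y :=
  (hf.eventually (by simp)).mono fun _ hy => hy.differentiableAt (by norm_num)

lemma complexHessian_add (hG : ContDiffAt ℝ 2 G z) (hH : ContDiffAt ℝ 2 H z) :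
    complexHessian (fun y => G y + H y) z = complexHessian G z + complexHessian H z := by
  ext j k
  change dz j (dzbar k fun y => G y + H y) z = dz j (dzbar k G) z + dz j (dzbar k H) z
  rw [← dz_add (ContDiffAt.dzbar_differentiableAt hG k) (ContDiffAt.dzbar_differentiableAt hH k)]
  refine dz_congr ?_ j
  filter_upwards [ContDiffAt.eventually_differentiableAt_of_two hG,
    ContDiffAt.eventually_differentiableAt_of_two hH] with y h1 h2
  exact dzbar_add h1 h2 k

lemma complexHessian_const_mul (hG : ContDiffAt ℝ 2 G z) (c : ℂ) :
    complexHessian (fun y => c * G y) z = c • complexHessian G z := by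
  ext j k
  change dz j (dzbar k fun y => c * G y) z = c * dz j (dzbar k G) z
  rw [← dz_const_mul (ContDiffAt.dzbar_differentiableAt hG k)]
  refine dz_congr ?_ j
  filter_upwards [ContDiffAt.eventually_differentiableAt_of_two hG] with y h1
  exact dzbar_const_mul h1 c k

lemma dz_eq_zero_of_notMem_tsupport (hz : z ∉ tsupport G) (j : Fin n) : dz j G z = 0 := by
  have h : G =ᶠ[nhds z] fun _ => 0 := notMem_tsupport_iff_eventuallyEq.1 hz
  rw [dz_congr h, dz_const]

lemma dzbar_eq_zero_of_notMem_tsupport (hz : z ∉ tsupport G) (j : Fin n) : dzbar j G z = 0 := by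
  have h : G =ᶠ[nhds z] fun _ => 0 := notMem_tsupport_iff_eventuallyEq.1 hz
  rw [dzbar_congr h, dzbar_const]

lemma tsupport_dzbar_subset (j : Fin n) : tsupport (dzbar j G) ⊆ tsupport G := by
  refine closure_minimal (fun y hy => ?_) (isClosed_tsupport G)
  by_contra h
  exact hy (dzbar_eq_zero_of_notMem_tsupport h j)

lemma complexHessian_eq_zero_of_notMem_tsupport (hz : z ∉ tsupport G) :
    complexHessian G z = 0 := by
  ext j k
  exact dz_eq_zero_of_notMem_tsupport (fun h => hz (tsupport_dzbar_subset k h)) j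

/-- Wirtinger derivatives commute. -/
lemma dz_dz_comm (hG : ContDiffAt ℝ 2 G z) (j l : Fin n) :
    dz l (dz j G) z = dz j (dz l G) z := by
  have h : DifferentiableAt ℝ (fderiv ℝ G) z :=
    (hG.fderiv_right (m := 1) (by norm_num)).differentiableAt (by norm_num)
  have hD : ∀ (v w : Fin n → ℂ), fderiv ℝ (fderiv ℝ G) z v w = fderiv ℝ (fderiv ℝ G) z w v :=
    fun v w => (hG.isSymmSndFDerivAt (by simp)).eq v w
  have key : ∀ (j : Fin n) (v : Fin n → ℂ), fderiv ℝ (dz j G) z v =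
      (fderiv ℝ (fderiv ℝ G) z v (Pi.single j 1) -
        Complex.I * fderiv ℝ (fderiv ℝ G) z v (Complex.I • Pi.single j 1)) / 2 := by
    intro j v
    have h1 : ∀ w : Fin n → ℂ, HasFDerivAt (fun y => fderiv ℝ G y w)
        ((fderiv ℝ (fderiv ℝ G) z).flip w) z := fun w => by
      simpa using h.hasFDerivAt.clm_apply (hasFDerivAt_const w z)
    have h2 := ((h1 (Pi.single j 1)).sub ((h1 (Complex.I • Pi.single j 1)).const_mul
      Complex.I)).mul_const (2⁻¹ : ℂ)
    have h3 : HasFDerivAt (dz j G) _ z := h2.congr_of_eventuallyEq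
      (Filter.Eventually.of_forall fun y => by simp only [dz, Pi.sub_apply, div_eq_mul_inv])
    rw [h3.fderiv]
    simp
    ring
  rw [dz, dz, key, key, key, key]
  simp only [hD (Pi.single l 1), hD (Complex.I • Pi.single l 1)]
  ring

/-- The chain rule for `∂/∂z_j` and a holomorphic inner function. -/
lemma dz_comp {h : (Fin n → ℂ) → Fin n → ℂ} {A : (Fin n → ℂ) →L[ℂ] Fin n → ℂ}
    (hh : HasFDerivAt h A z) (hG : DifferentiableAt ℝ G (h z)) (j : Fin n) :
    dz j (fun y => G (h y)) z = ∑ m, dz m G (h z) * A (Pi.single j 1) m := by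
  have h1 : HasFDerivAt (fun y => G (h y)) ((fderiv ℝ G (h z)).comp (A.restrictScalars ℝ)) z :=
    hG.hasFDerivAt.comp z (hh.restrictScalars ℝ)
  let P : (Fin n → ℂ) →ₗ[ℂ] ℂ :=
    { toFun := fun w => (fderiv ℝ G (h z) w - Complex.I * fderiv ℝ G (h z) (Complex.I • w)) / 2
      map_add' := fun v w => by
        simp only [smul_add, map_add]
        ring
      map_smul' := fun c w => by
        have hc : ∀ x : Fin n → ℂ, fderiv ℝ G (h z) (c • x) = c.re * fderiv ℝ G (h z) x +
            c.im * fderiv ℝ G (h z) (Complex.I • x) := by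
          intro x
          have : c • x = c.re • x + c.im • (Complex.I • x) := by
            ext i
            simp only [Pi.smul_apply, Pi.add_apply, smul_eq_mul, Complex.real_smul]
            conv_lhs => rw [← Complex.re_add_im c]
            ring
          rw [this, map_add, map_smul, map_smul, Complex.real_smul, Complex.real_smul]
        rw [smul_comm Complex.I c w, hc, hc, smul_smul, Complex.I_mul_I, neg_one_smul, map_neg]
        simp only [RingHom.id_apply, smul_eq_mul]
        conv_rhs => rw [← Complex.re_add_im c]
        linear_combination ((c.im : ℂ) * fderiv ℝ G (h z) (Complex.I • w) / 2) * Complex.I_sq }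
  have h2 : dz j (fun y => G (h y)) z = P (A (Pi.single j 1)) := by
    unfold dz
    rw [h1.fderiv]
    simp [P]
  rw [h2, P.pi_apply_eq_sum_univ]
  refine Finset.sum_congr rfl fun m _ => ?_
  rw [smul_eq_mul, mul_comm]
  congr 1
  simp only [P, LinearMap.coe_mk, AddHom.coe_mk, dz]
  have : (fun j => if m = j then (1 : ℂ) else 0) = Pi.single m 1 := by
    ext i
    simp [Pi.single_apply, eq_comm]
  rw [this]

lemma conj_dz {n : ℕ} {G : (Fin n → ℂ) → ℂ} {z : Fin n → ℂ} (hG : DifferentiableAt ℝ G z)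
    (j : Fin n) :
    (starRingEnd ℂ) (dz j G z) = dzbar j (fun y => (starRingEnd ℂ) (G y)) z := by
  have h1 : HasFDerivAt (fun y => (starRingEnd ℂ) (G y))
      ((Complex.conjCLE : ℂ →L[ℝ] ℂ).comp (fderiv ℝ G z)) z :=
    (Complex.conjCLE : ℂ →L[ℝ] ℂ).hasFDerivAt.comp z hG.hasFDerivAt
  unfold dzbar dz
  rw [h1.fderiv, map_div₀, Complex.conj_ofNat]
  simp

/-- The chain rule for `∂/∂z̄_j` and a holomorphic inner function. -/
lemma dzbar_comp {h : (Fin n → ℂ) → Fin n → ℂ} {A : (Fin n → ℂ) →L[ℂ] Fin n → ℂ}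
    (hh : HasFDerivAt h A z) (hG : DifferentiableAt ℝ G (h z)) (j : Fin n) :
    dzbar j (fun y => G (h y)) z =
      ∑ m, dzbar m G (h z) * (starRingEnd ℂ) (A (Pi.single j 1) m) := by
  have hG' : DifferentiableAt ℝ (fun y => (starRingEnd ℂ) (G y)) (h z) :=
    (Complex.conjCLE : ℂ →L[ℝ] ℂ).differentiableAt.comp (h z) hG
  have hGh : DifferentiableAt ℝ (fun y => (starRingEnd ℂ) (G (h y))) z :=
    hG'.comp z (hh.restrictScalars ℝ).differentiableAt
  have e := dz_comp hh hG' j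
  have e2 := conj_dz hGh j
  have e3 : ∀ m, (starRingEnd ℂ) (dz m (fun y => (starRingEnd ℂ) (G y)) (h z)) =
      dzbar m G (h z) := by
    intro m
    rw [conj_dz hG']
    simp
  simp only [Complex.conj_conj] at e2
  rw [← e2, e, map_sum]
  refine Finset.sum_congr rfl fun m _ => ?_
  rw [map_mul, e3]

/-- The conjugate of a holomorphic function is killed by `∂/∂z_j`. -/
lemma dz_conj_holomorphic {F : (Fin n → ℂ) → ℂ} (hF : DifferentiableAt ℂ F z) (j : Fin n) :
    dz j (fun y => (starRingEnd ℂ) (F y)) z = 0 := by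
  have h1 : HasFDerivAt (fun y => (starRingEnd ℂ) (F y))
      ((Complex.conjCLE : ℂ →L[ℝ] ℂ).comp ((fderiv ℂ F z).restrictScalars ℝ)) z :=
    (Complex.conjCLE : ℂ →L[ℝ] ℂ).hasFDerivAt.comp z (hF.hasFDerivAt.restrictScalars ℝ)
  unfold dz
  rw [h1.fderiv]
  simp only [ContinuousLinearMap.comp_apply, ContinuousLinearMap.coe_restrictScalars', map_smul,
    smul_eq_mul, ContinuousLinearEquiv.coe_coe, Complex.conjCLE_apply, map_mul, Complex.conj_I]
  linear_combination ((starRingEnd ℂ) (fderiv ℂ F z (Pi.single j 1)) / 2) * Complex.I_sq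

/-- The complex Jacobian matrix of a holomorphic map, `J m j = ∂h_m/∂z_j`. -/
noncomputable def jacobian (h : (Fin n → ℂ) → Fin n → ℂ) (z : Fin n → ℂ) :
    Matrix (Fin n) (Fin n) ℂ :=
  Matrix.of fun m j => fderiv ℂ h z (Pi.single j 1) m

/-- The complex Hessian transforms as the matrix of a `(1,1)`-form under holomorphic maps. -/
theorem complexHessian_comp {h : (Fin n → ℂ) → Fin n → ℂ} (hh : ContDiffAt ℂ 2 h z)
    (hG : ContDiffAt ℝ 2 G (h z)) :
    complexHessian (fun y => G (h y)) z =
      (jacobian h z).transpose * complexHessian G (h z) *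
        (jacobian h z).map (starRingEnd ℂ) := by
  have hd : ∀ᶠ y in nhds z, DifferentiableAt ℂ h y :=
    (hh.eventually (by simp)).mono fun _ hy => hy.differentiableAt (by norm_num)
  have hGd : ∀ᶠ y in nhds z, DifferentiableAt ℝ G (h y) :=
    hh.continuousAt.eventually (ContDiffAt.eventually_differentiableAt_of_two hG)
  have hh0 : HasFDerivAt h (fderiv ℂ h z) z := hd.self_of_nhds.hasFDerivAt
  have hJ : ∀ k l, DifferentiableAt ℂ (fun y => fderiv ℂ h y (Pi.single k 1) l) z := by
    intro k l
    have h1 : DifferentiableAt ℂ (fderiv ℂ h) z :=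
      (hh.fderiv_right (m := 1) (by norm_num)).differentiableAt (by norm_num)
    exact differentiableAt_pi.1
      (h1.clm_apply (differentiableAt_const (Pi.single k 1 : Fin n → ℂ))) l
  have hJr : ∀ k l, DifferentiableAt ℝ
      (fun y => (starRingEnd ℂ) (fderiv ℂ h y (Pi.single k 1) l)) z := fun k l =>
    (Complex.conjCLE : ℂ →L[ℝ] ℂ).differentiableAt.comp z ((hJ k l).restrictScalars ℝ)
  have hGl : ∀ l, DifferentiableAt ℝ (fun y => dzbar l G (h y)) z := fun l =>
    (ContDiffAt.dzbar_differentiableAt hG l).comp z (hh0.restrictScalars ℝ).differentiableAt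
  ext j k
  have e1 : dzbar k (fun y => G (h y)) =ᶠ[nhds z] fun y =>
      ∑ l, dzbar l G (h y) * (starRingEnd ℂ) (fderiv ℂ h y (Pi.single k 1) l) := by
    filter_upwards [hd, hGd] with y h1 h2
    exact dzbar_comp h1.hasFDerivAt h2 k
  change dz j (dzbar k fun y => G (h y)) z = _
  rw [dz_congr e1]
  refine (dz_sum _ (fun l _ => (hGl l).fun_mul (hJr k l)) j).trans ?_
  simp only [Matrix.mul_apply, Finset.sum_mul]
  refine Finset.sum_congr rfl fun l _ => ?_
  rw [dz_mul (hGl l) (hJr k l), dz_conj_holomorphic (hJ k l), mul_zero, add_zero,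
    dz_comp hh0 (ContDiffAt.dzbar_differentiableAt hG l), Finset.sum_mul]
  refine Finset.sum_congr rfl fun m _ => ?_
  simp only [complexHessian, jacobian, Matrix.of_apply, Matrix.transpose_apply, Matrix.map_apply]
  ring

end Wirtinger

/-! ### Invariance of the integral of a determinant under complex Hessians -/

section Flat

open MeasureTheory

variable {n : ℕ}

lemma contDiffOn_det {N : ℕ∞} {U : Set (Fin n → ℂ)} {M : (Fin n → ℂ) → Matrix (Fin n) (Fin n) ℂ}
    (hM : ∀ i k, ContDiffOn ℝ N (fun z => M z i k) U) :
    ContDiffOn ℝ N (fun z => (M z).det) U := by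
  simp only [Matrix.det_apply']
  exact ContDiffOn.sum fun σ _ => contDiffOn_const.mul (contDiffOn_prod fun i _ => hM _ _)

lemma integral_fderiv_eq_zero {u : (Fin n → ℂ) → ℂ} (hu : ContDiff ℝ 1 u)
    (hc : HasCompactSupport u) (v : Fin n → ℂ) :
    Integrable (fun z => fderiv ℝ u z v) ∧ ∫ z, fderiv ℝ u z v = 0 := by
  have hcont : Continuous fun z => fderiv ℝ u z v :=
    (hu.continuous_fderiv (by norm_num)).clm_apply continuous_const
  have hint : Integrable fun z => fderiv ℝ u z v :=
    hcont.integrable_of_hasCompactSupport (hc.fderiv_apply (𝕜 := ℝ) v)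
  refine ⟨hint, ?_⟩
  have h := integral_mul_fderiv_eq_neg_fderiv_mul_of_integrable (μ := volume)
    (f := fun _ : Fin n → ℂ => (1 : ℂ)) (g := u) (v := v) (by simp) (by simpa using hint)
    (by simpa using hu.continuous.integrable_of_hasCompactSupport hc)
    (fun _ _ => differentiableAt_const _)
    (fun _ _ => (hu.differentiable (by norm_num)).differentiableAt)
  simpa using h

lemma integral_dz_eq_zero {u : (Fin n → ℂ) → ℂ} (hu : ContDiff ℝ 1 u)
    (hc : HasCompactSupport u) (j : Fin n) :
    Integrable (fun z => dz j u z) ∧ ∫ z, dz j u z = 0 := by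
  obtain ⟨h1, h1'⟩ := integral_fderiv_eq_zero hu hc (Pi.single j 1)
  obtain ⟨h2, h2'⟩ := integral_fderiv_eq_zero hu hc (Complex.I • Pi.single j 1)
  unfold dz
  refine ⟨(h1.sub (h2.const_mul _)).div_const _, ?_⟩
  rw [integral_div, integral_sub h1 (h2.const_mul _), integral_const_mul, h1', h2']
  simp

/-- The cofactors of a column are divergence free if the other columns are `∂`-closed:
differentiating the column `m` pairs a symmetric with an antisymmetric expression. -/
lemma sum_dz_cofactor_eq_zero {z : Fin n → ℂ} {M : (Fin n → ℂ) → Matrix (Fin n) (Fin n) ℂ}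
    (hM : ∀ i k, DifferentiableAt ℝ (fun y => M y i k) z)
    (hclosed : ∀ j l k, dz l (fun y => M y j k) z = dz j (fun y => M y l k) z) (k₀ : Fin n) :
    ∑ j, dz j (fun y => ((M y).updateCol k₀ (Pi.single j 1)).det) z = 0 := by
  have hd : ∀ j i k, DifferentiableAt ℝ
      (fun y => (M y).updateCol k₀ (Pi.single j 1) i k) z := by
    intro j i k
    by_cases hk : k = k₀
    · subst hk
      simp only [Matrix.updateCol_self]
      exact differentiableAt_const _
    · simp only [Matrix.updateCol_ne hk]
      exact hM i k
  simp only [fun j => dz_det (hd j) j]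
  rw [Finset.sum_comm]
  refine Finset.sum_eq_zero fun m _ => ?_
  by_cases hm : m = k₀
  · subst hm
    refine Finset.sum_eq_zero fun j _ => ?_
    refine Matrix.det_eq_zero_of_column_eq_zero m fun i => ?_
    simp only [Matrix.updateCol_self]
    exact dz_const _ _
  · let D : Fin n → Fin n → ℂ := fun j l =>
      (((M z).updateCol k₀ (Pi.single j 1)).updateCol m (Pi.single l 1)).det
    let S : Fin n → Fin n → ℂ := fun j l => dz j (fun y => M y l m) z
    have hexp : ∀ j, (((M z).updateCol k₀ (Pi.single j 1)).updateCol m fun i =>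
        dz j (fun y => (M y).updateCol k₀ (Pi.single j 1) i m) z).det = ∑ l, S j l * D j l := by
      intro j
      simp only [Matrix.updateCol_ne hm]
      rw [← Matrix.cramer_apply, (Matrix.cramer _).pi_apply_eq_sum_univ, Finset.sum_apply]
      refine Finset.sum_congr rfl fun l _ => ?_
      rw [Pi.smul_apply, smul_eq_mul, Matrix.cramer_apply]
      congr 3
      ext i
      simp [Pi.single_apply, eq_comm]
    simp only [hexp]
    have hanti : ∀ j l, D l j = -D j l := by
      intro j l
      have h := Matrix.det_permute' (Equiv.swap k₀ m)
        (((M z).updateCol k₀ (Pi.single j 1)).updateCol m (Pi.single l 1))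
      have hne : k₀ ≠ m := Ne.symm hm
      rw [Equiv.Perm.sign_swap hne] at h
      have e : (((M z).updateCol k₀ (Pi.single j 1)).updateCol m (Pi.single l 1)).submatrix id
          (Equiv.swap k₀ m) =
          ((M z).updateCol k₀ (Pi.single l 1)).updateCol m (Pi.single j 1) := by
        ext a b
        rw [Matrix.submatrix_apply]
        by_cases hb : b = k₀
        · subst hb
          simp [hne]
        · by_cases hb' : b = m
          · subst hb'
            simp [hne]
          · rw [Equiv.swap_apply_of_ne_of_ne hb hb']
            simp [hb, hb']
      rw [e] at h
      simpa [D] using h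
    have hsym : ∀ j l, S l j = S j l := fun j l => hclosed j l m
    have h2 : ∑ j, ∑ l, S j l * D j l = -∑ j, ∑ l, S j l * D j l := by
      conv_lhs => rw [Finset.sum_comm]
      rw [← Finset.sum_neg_distrib]
      refine Finset.sum_congr rfl fun j _ => ?_
      rw [← Finset.sum_neg_distrib]
      refine Finset.sum_congr rfl fun l _ => ?_
      rw [hanti j l, hsym j l]
      ring
    exact self_eq_neg.1 h2

/-- If one column is the gradient `∂g` of a compactly supported function and the others are
`∂`-closed, then the determinant is a divergence and has integral zero. -/
lemma integral_det_updateCol_dz {U : Set (Fin n → ℂ)} (hU : IsOpen U)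
    {M : (Fin n → ℂ) → Matrix (Fin n) (Fin n) ℂ}
    (hM : ∀ i k, ContDiffOn ℝ ∞ (fun z => M z i k) U)
    (hclosed : ∀ z ∈ U, ∀ j l k, dz l (fun y => M y j k) z = dz j (fun y => M y l k) z)
    {g : (Fin n → ℂ) → ℂ} (hg : ContDiff ℝ ∞ g) (hgc : HasCompactSupport g)
    (hgU : tsupport g ⊆ U) (k₀ : Fin n) :
    Integrable (fun z => ((M z).updateCol k₀ fun j => dz j g z).det) ∧
      ∫ z, ((M z).updateCol k₀ fun j => dz j g z).det = 0 := by
  let C : Fin n → (Fin n → ℂ) → ℂ := fun j z => ((M z).updateCol k₀ (Pi.single j 1)).det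
  have hC : ∀ j, ContDiffOn ℝ ∞ (C j) U := by
    intro j
    refine contDiffOn_det fun i k => ?_
    by_cases hk : k = k₀
    · subst hk
      simp only [Matrix.updateCol_self]
      exact contDiffOn_const
    · simp only [Matrix.updateCol_ne hk]
      exact hM i k
  have hCd : ∀ j, ∀ z ∈ U, DifferentiableAt ℝ (C j) z := fun j z hz =>
    ((hC j).contDiffAt (hU.mem_nhds hz)).differentiableAt (by simp)
  have hu : ∀ j, ContDiff ℝ 1 fun z => g z * C j z := by
    intro j
    rw [contDiff_iff_contDiffAt]
    intro z
    by_cases hz : z ∈ tsupport g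
    · exact (hg.contDiffAt.of_le (by exact_mod_cast le_top)).mul
        (((hC j).contDiffAt (hU.mem_nhds (hgU hz))).of_le (by exact_mod_cast le_top))
    · have h0 : (fun z => g z * C j z) =ᶠ[nhds z] fun _ => 0 := by
        filter_upwards [notMem_tsupport_iff_eventuallyEq.1 hz] with y hy
        simp [hy]
      exact contDiffAt_const.congr_of_eventuallyEq h0
  have huc : ∀ j, HasCompactSupport fun z => g z * C j z := fun j => hgc.mul_right
  have hdet : (fun z => ((M z).updateCol k₀ fun j => dz j g z).det) =
      fun z => ∑ j, dz j (fun y => g y * C j y) z := by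
    ext z
    have hexp : ((M z).updateCol k₀ fun j => dz j g z).det = ∑ j, dz j g z * C j z := by
      rw [← Matrix.cramer_apply, (Matrix.cramer _).pi_apply_eq_sum_univ, Finset.sum_apply]
      refine Finset.sum_congr rfl fun l _ => ?_
      rw [Pi.smul_apply, smul_eq_mul, Matrix.cramer_apply]
      congr 3
      ext i
      simp [Pi.single_apply, eq_comm]
    rw [hexp]
    by_cases hz : z ∈ tsupport g
    · have h1 : ∀ j, dz j (fun y => g y * C j y) z = dz j g z * C j z + g z * dz j (C j) z :=
        fun j => dz_mul (hg.differentiable (by simp)).differentiableAt (hCd j z (hgU hz)) j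
      simp only [h1, Finset.sum_add_distrib, ← Finset.mul_sum]
      rw [sum_dz_cofactor_eq_zero (fun i k => ((hM i k).contDiffAt
        (hU.mem_nhds (hgU hz))).differentiableAt (by simp)) (hclosed z (hgU hz)) k₀]
      simp
    · have h0 : ∀ j, z ∉ tsupport fun y => g y * C j y := fun j h =>
        hz (closure_mono (Function.support_mul_subset_left _ _) h)
      simp only [fun j => dz_eq_zero_of_notMem_tsupport (h0 j) j,
        fun j => dz_eq_zero_of_notMem_tsupport hz j, zero_mul]
  rw [hdet]
  refine ⟨integrable_finsetSum _ fun j _ => (integral_dz_eq_zero (hu j) (huc j) j).1, ?_⟩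
  rw [integral_finsetSum _ fun j _ => (integral_dz_eq_zero (hu j) (huc j) j).1]
  exact Finset.sum_eq_zero fun j _ => (integral_dz_eq_zero (hu j) (huc j) j).2

/-- Adding a compactly supported complex Hessian to a `∂`-closed matrix does not change the
integral of the determinant. The columns are changed one at a time. -/
theorem integral_det_add_complexHessian {U : Set (Fin n → ℂ)} (hU : IsOpen U)
    {B : (Fin n → ℂ) → Matrix (Fin n) (Fin n) ℂ}
    (hB : ∀ i k, ContDiffOn ℝ ∞ (fun z => B z i k) U)
    (hclosed : ∀ z ∈ U, ∀ j l k, dz l (fun y => B y j k) z = dz j (fun y => B y l k) z)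
    {f : (Fin n → ℂ) → ℂ} (hf : ContDiff ℝ ∞ f) (hfc : HasCompactSupport f)
    (hfU : tsupport f ⊆ U) :
    Integrable (fun z => (B z + complexHessian f z).det - (B z).det) ∧
      ∫ z, ((B z + complexHessian f z).det - (B z).det) = 0 := by
  classical
  have hfb : ∀ k, ContDiff ℝ ∞ (dzbar k f) := fun k => contDiff_dzbar hf k
  have hH : ∀ i k, ContDiff ℝ ∞ fun z => complexHessian f z i k := fun i k =>
    contDiff_dz (hfb k) i
  let M : Finset (Fin n) → (Fin n → ℂ) → Matrix (Fin n) (Fin n) ℂ := fun S z =>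
    Matrix.of fun i k => B z i k + if k ∈ S then complexHessian f z i k else 0
  suffices H : ∀ S, Integrable (fun z => (M S z).det - (B z).det) ∧
      ∫ z, ((M S z).det - (B z).det) = 0 by
    have hu : ∀ z, M Finset.univ z = B z + complexHessian f z := by
      intro z
      ext i k
      simp [M]
    simpa only [hu] using H Finset.univ
  intro S
  induction S using Finset.induction_on with
  | empty =>
    have h0 : ∀ z, M ∅ z = B z := by
      intro z
      ext i k
      simp [M]
    simp [h0]
  | insert a S ha ih =>
    have hMd : ∀ i k, ContDiffOn ℝ ∞ (fun z => M S z i k) U := by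
      intro i k
      by_cases hk : k ∈ S
      · simpa [M, hk] using (hB i k).add (hH i k).contDiffOn
      · simpa [M, hk] using hB i k
    have hMc : ∀ z ∈ U, ∀ j l k,
        dz l (fun y => M S y j k) z = dz j (fun y => M S y l k) z := by
      intro z hz j l k
      by_cases hk : k ∈ S
      · have e : ∀ j l, dz l (fun y => M S y j k) z =
            dz l (fun y => B y j k) z + dz l (dz j (dzbar k f)) z := by
          intro j l
          simp only [M, Matrix.of_apply, hk, if_true]
          exact dz_add (((hB j k).contDiffAt (hU.mem_nhds hz)).differentiableAt (by simp))
            ((hH j k).differentiable (by simp)).differentiableAt l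
        rw [e, e, hclosed z hz, dz_dz_comm ((hfb k).contDiffAt.of_le (mod_cast ENat.LEInfty.out))]
      · simp only [M, Matrix.of_apply, hk, if_false, add_zero]
        exact hclosed z hz j l k
    obtain ⟨h1, h2⟩ := integral_det_updateCol_dz hU hMd hMc (hfb a)
      (hfc.mono' ((subset_tsupport _).trans (tsupport_dzbar_subset a)))
      ((tsupport_dzbar_subset a).trans hfU) a
    have hsplit : (fun z => (M (insert a S) z).det - (B z).det) = fun z =>
        ((M S z).updateCol a fun j => dz j (dzbar a f) z).det + ((M S z).det - (B z).det) := by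
      ext z
      have e1 : M (insert a S) z = (M S z).updateCol a
          ((fun j => M S z j a) + fun j => dz j (dzbar a f) z) := by
        ext i k
        by_cases hk : k = a
        · subst hk
          simp [M, ha, complexHessian]
        · simp [M, hk, Matrix.updateCol_ne]
      rw [e1, Matrix.det_updateCol_add]
      have e2 : (M S z).updateCol a (fun j => M S z j a) = M S z := by
        ext i k
        by_cases hk : k = a
        · subst hk
          simp
        · simp [hk, Matrix.updateCol_ne]
      rw [e2]
      ring
    rw [hsplit]
    refine ⟨h1.add ih.1, ?_⟩
    rw [integral_add h1 ih.1, h2, ih.2, add_zero]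

end Flat

/-! ### Real forms of type `(1,1)` and Hermitian matrices -/

section Forms

variable {n : ℕ}

/-- The Hermitian matrix of a real `2`-form `w` on `ℂⁿ`: `w = i ∑ a_{jk} dz_j ∧ dz̄_k` if `w` is of
type `(1,1)`. -/
noncomputable def formMatrix (w : (Fin n → ℂ) [⋀^Fin 2]→L[ℝ] ℝ) : Matrix (Fin n) (Fin n) ℂ :=
  Matrix.of fun j k => ((w ![Pi.single j 1, Complex.I • Pi.single k 1] : ℂ) -
    Complex.I * (w ![Pi.single j 1, Pi.single k 1] : ℂ)) / 2

/-- Forms of type `(1,1)`. -/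
def IsOneOne (w : (Fin n → ℂ) [⋀^Fin 2]→L[ℝ] ℝ) : Prop :=
  ∀ u v : Fin n → ℂ, w ![Complex.I • u, Complex.I • v] = w ![u, v]

/-- The sesquilinear form attached to a real `2`-form. -/
noncomputable def sesq (w : (Fin n → ℂ) [⋀^Fin 2]→L[ℝ] ℝ) (u v : Fin n → ℂ) : ℂ :=
  ((w ![u, Complex.I • v] : ℂ) - Complex.I * (w ![u, v] : ℂ)) / 2

lemma form_swap (w : (Fin n → ℂ) [⋀^Fin 2]→L[ℝ] ℝ) (u v : Fin n → ℂ) :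
    w ![v, u] = -w ![u, v] := by
  have h := w.toAlternatingMap.map_swap ![u, v] (show (0 : Fin 2) ≠ 1 by decide)
  have e : ![u, v] ∘ Equiv.swap (0 : Fin 2) 1 = ![v, u] := by
    ext i
    fin_cases i <;> simp
  rw [e] at h
  exact h

lemma update_pair_zero (u v x : Fin n → ℂ) : Function.update ![u, v] 0 x = ![x, v] := by
  ext i
  fin_cases i <;> simp

lemma form_add_left (w : (Fin n → ℂ) [⋀^Fin 2]→L[ℝ] ℝ) (u u' v : Fin n → ℂ) :
    w ![u + u', v] = w ![u, v] + w ![u', v] := by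
  have h := w.map_update_add ![u, v] 0 u u'
  rwa [update_pair_zero, update_pair_zero, update_pair_zero] at h

lemma form_smul_left (w : (Fin n → ℂ) [⋀^Fin 2]→L[ℝ] ℝ) (c : ℝ) (u v : Fin n → ℂ) :
    w ![c • u, v] = c * w ![u, v] := by
  have h := w.map_update_smul ![u, v] 0 c u
  rwa [update_pair_zero, update_pair_zero] at h

lemma form_neg_left (w : (Fin n → ℂ) [⋀^Fin 2]→L[ℝ] ℝ) (u v : Fin n → ℂ) :
    w ![-u, v] = -w ![u, v] := by
  have h := form_smul_left w (-1) u v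
  simpa using h

lemma IsOneOne.apply_I_left {w : (Fin n → ℂ) [⋀^Fin 2]→L[ℝ] ℝ} (hw : IsOneOne w)
    (u v : Fin n → ℂ) : w ![Complex.I • u, v] = -w ![u, Complex.I • v] := by
  have h := hw (Complex.I • u) v
  rw [smul_smul, Complex.I_mul_I, neg_one_smul, form_neg_left] at h
  exact h.symm

lemma IsOneOne.conj_sesq {w : (Fin n → ℂ) [⋀^Fin 2]→L[ℝ] ℝ} (hw : IsOneOne w) (u v : Fin n → ℂ) :
    (starRingEnd ℂ) (sesq w u v) = sesq w v u := by
  unfold sesq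
  rw [form_swap w u v, form_swap w (Complex.I • u) v, hw.apply_I_left, map_div₀, Complex.conj_ofNat]
  simp

lemma IsOneOne.sesq_eq_sum_left {w : (Fin n → ℂ) [⋀^Fin 2]→L[ℝ] ℝ} (hw : IsOneOne w)
    (u v : Fin n → ℂ) : sesq w u v = ∑ j, u j * sesq w (Pi.single j 1) v := by
  let P : (Fin n → ℂ) →ₗ[ℂ] ℂ :=
    { toFun := fun u => sesq w u v
      map_add' := fun u u' => by
        simp only [sesq, form_add_left]
        push_cast
        ring
      map_smul' := fun c u => by
        have hc : c • u = c.re • u + c.im • (Complex.I • u) := by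
          ext i
          simp only [Pi.smul_apply, Pi.add_apply, smul_eq_mul, Complex.real_smul]
          conv_lhs => rw [← Complex.re_add_im c]
          ring
        simp only [sesq, hc, form_add_left, form_smul_left, hw u v, hw.apply_I_left,
          RingHom.id_apply, smul_eq_mul]
        conv_rhs => rw [← Complex.re_add_im c]
        push_cast
        linear_combination ((c.im : ℂ) * (w ![u, v] : ℂ) / 2) * Complex.I_sq }
  have h := P.pi_apply_eq_sum_univ u
  refine h.trans (Finset.sum_congr rfl fun j _ => ?_)
  have e : (fun i => if j = i then (1 : ℂ) else 0) = Pi.single j 1 := by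
    ext i
    simp [Pi.single_apply, eq_comm]
  rw [e]
  rfl

lemma IsOneOne.sesq_eq_sum {w : (Fin n → ℂ) [⋀^Fin 2]→L[ℝ] ℝ} (hw : IsOneOne w)
    (u v : Fin n → ℂ) :
    sesq w u v = ∑ j, ∑ k, u j * formMatrix w j k * (starRingEnd ℂ) (v k) := by
  rw [hw.sesq_eq_sum_left]
  refine Finset.sum_congr rfl fun j _ => ?_
  rw [← hw.conj_sesq v, hw.sesq_eq_sum_left v, map_sum, Finset.mul_sum]
  refine Finset.sum_congr rfl fun k _ => ?_
  rw [map_mul, hw.conj_sesq]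
  change u j * ((starRingEnd ℂ) (v k) * formMatrix w j k) = _
  ring

/-- A form of type `(1,1)` is recovered from its Hermitian matrix. -/
lemma IsOneOne.apply_eq {w : (Fin n → ℂ) [⋀^Fin 2]→L[ℝ] ℝ} (hw : IsOneOne w) (u v : Fin n → ℂ) :
    (w ![u, v] : ℂ) = Complex.I * ∑ j, ∑ k, formMatrix w j k *
      (u j * (starRingEnd ℂ) (v k) - v j * (starRingEnd ℂ) (u k)) := by
  have h1 : ∑ j, ∑ k, formMatrix w j k *
      (u j * (starRingEnd ℂ) (v k) - v j * (starRingEnd ℂ) (u k)) =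
      sesq w u v - sesq w v u := by
    rw [hw.sesq_eq_sum, hw.sesq_eq_sum, ← Finset.sum_sub_distrib]
    refine Finset.sum_congr rfl fun j _ => ?_
    rw [← Finset.sum_sub_distrib]
    refine Finset.sum_congr rfl fun k _ => ?_
    ring
  rw [h1]
  unfold sesq
  rw [form_swap w u v, form_swap w (Complex.I • u) v, hw.apply_I_left]
  push_cast
  linear_combination (w ![u, v] : ℂ) * Complex.I_sq

lemma IsOneOne.isHermitian {w : (Fin n → ℂ) [⋀^Fin 2]→L[ℝ] ℝ} (hw : IsOneOne w) :
    (formMatrix w).IsHermitian := by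
  ext j k
  exact hw.conj_sesq _ _

lemma sesq_self (w : (Fin n → ℂ) [⋀^Fin 2]→L[ℝ] ℝ) (u : Fin n → ℂ) :
    sesq w u u = ((w ![u, Complex.I • u] / 2 : ℝ) : ℂ) := by
  have h : w ![u, u] = 0 := by
    have := form_swap w u u
    linarith
  simp [sesq, h]

lemma IsOneOne.star_dotProduct_mulVec {w : (Fin n → ℂ) [⋀^Fin 2]→L[ℝ] ℝ} (hw : IsOneOne w)
    (x : Fin n → ℂ) :
    star x ⬝ᵥ ((formMatrix w).mulVec x) =
      ((w ![star x, Complex.I • star x] / 2 : ℝ) : ℂ) := by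
  rw [← sesq_self, hw.sesq_eq_sum]
  simp only [dotProduct, Matrix.mulVec, Finset.mul_sum, Pi.star_apply, RCLike.star_def,
    Complex.conj_conj, mul_assoc]

open ComplexOrder in
lemma IsOneOne.posDef {w : (Fin n → ℂ) [⋀^Fin 2]→L[ℝ] ℝ} (hw : IsOneOne w)
    (hpos : ∀ u : Fin n → ℂ, u ≠ 0 → 0 < w ![u, Complex.I • u]) : (formMatrix w).PosDef := by
  refine Matrix.PosDef.of_dotProduct_mulVec_pos hw.isHermitian fun x hx => ?_
  rw [hw.star_dotProduct_mulVec]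
  have := hpos (star x) (star_ne_zero.2 hx)
  exact_mod_cast half_pos this

open ComplexOrder in
lemma IsOneOne.posSemidef {w : (Fin n → ℂ) [⋀^Fin 2]→L[ℝ] ℝ} (hw : IsOneOne w)
    (hpos : ∀ u : Fin n → ℂ, 0 ≤ w ![u, Complex.I • u]) : (formMatrix w).PosSemidef := by
  refine Matrix.PosSemidef.of_dotProduct_mulVec_nonneg hw.isHermitian fun x => ?_
  rw [hw.star_dotProduct_mulVec]
  have := hpos (star x)
  exact_mod_cast div_nonneg this (by norm_num : (0 : ℝ) ≤ 2)

lemma comp_apply_pair (w : (Fin n → ℂ) [⋀^Fin 2]→L[ℝ] ℝ) (A : (Fin n → ℂ) →L[ℝ] Fin n → ℂ)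
    (u v : Fin n → ℂ) : w.compContinuousLinearMap A ![u, v] = w ![A u, A v] := by
  rw [ContinuousAlternatingMap.compContinuousLinearMap_apply]
  congr 1
  ext i
  fin_cases i <;> rfl

lemma IsOneOne.comp {w : (Fin n → ℂ) [⋀^Fin 2]→L[ℝ] ℝ} (hw : IsOneOne w)
    (A : (Fin n → ℂ) →L[ℂ] Fin n → ℂ) :
    IsOneOne (w.compContinuousLinearMap (A.restrictScalars ℝ)) := by
  intro u v
  rw [comp_apply_pair, comp_apply_pair]
  simp only [ContinuousLinearMap.coe_restrictScalars', map_smul]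
  exact hw _ _

/-- The Hermitian matrix of a pull-back by a complex linear map. -/
lemma IsOneOne.formMatrix_comp {w : (Fin n → ℂ) [⋀^Fin 2]→L[ℝ] ℝ} (hw : IsOneOne w)
    (A : (Fin n → ℂ) →L[ℂ] Fin n → ℂ) :
    formMatrix (w.compContinuousLinearMap (A.restrictScalars ℝ)) =
      (Matrix.of fun m j => A (Pi.single j 1) m).transpose * formMatrix w *
        (Matrix.of fun m j => A (Pi.single j 1) m).map (starRingEnd ℂ) := by
  ext j k
  have h : formMatrix (w.compContinuousLinearMap (A.restrictScalars ℝ)) j k =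
      sesq w (A (Pi.single j 1)) (A (Pi.single k 1)) := by
    simp only [formMatrix, sesq, Matrix.of_apply, comp_apply_pair,
      ContinuousLinearMap.coe_restrictScalars', map_smul]
  rw [h, hw.sesq_eq_sum, Finset.sum_comm]
  simp only [Matrix.mul_apply, Matrix.transpose_apply, Matrix.of_apply, Matrix.map_apply,
    Finset.sum_mul]

lemma formMatrix_add (w w' : (Fin n → ℂ) [⋀^Fin 2]→L[ℝ] ℝ) :
    formMatrix (w + w') = formMatrix w + formMatrix w' := by
  ext j k
  simp only [formMatrix, Matrix.of_apply, Matrix.add_apply, ContinuousAlternatingMap.add_apply]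
  push_cast
  ring

lemma formMatrix_smul (c : ℝ) (w : (Fin n → ℂ) [⋀^Fin 2]→L[ℝ] ℝ) :
    formMatrix (c • w) = (c : ℂ) • formMatrix w := by
  ext j k
  simp only [formMatrix, Matrix.of_apply, Matrix.smul_apply, ContinuousAlternatingMap.smul_apply,
    smul_eq_mul]
  push_cast
  ring

/-- The matrix of `i∂∂̄φ` is the complex Hessian of `φ`. -/
lemma formMatrix_eq_complexHessian {w : (Fin n → ℂ) [⋀^Fin 2]→L[ℝ] ℝ} {φ : (Fin n → ℂ) → ℝ}
    {z : Fin n → ℂ} (hφ : ContDiffAt ℝ 2 φ z) (hw : ∀ u v, w ![u, v] = ddbar φ z u v) :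
    formMatrix w = complexHessian (fun y => (φ y : ℂ)) z := by
  have h : DifferentiableAt ℝ (fderiv ℝ φ) z :=
    (hφ.fderiv_right (m := 1) (by norm_num)).differentiableAt (by norm_num)
  have h1 : ∀ v : Fin n → ℂ, HasFDerivAt (fun y => (fderiv ℝ φ y v : ℂ))
      (Complex.ofRealCLM.comp ((fderiv ℝ (fderiv ℝ φ) z).flip v)) z := fun v => by
    have h2 : HasFDerivAt (fun y => fderiv ℝ φ y v) ((fderiv ℝ (fderiv ℝ φ) z).flip v) z := by
      simpa using h.hasFDerivAt.clm_apply (hasFDerivAt_const v z)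
    exact Complex.ofRealCLM.hasFDerivAt.comp z h2
  have h3 : ∀ k, dzbar k (fun y => (φ y : ℂ)) =ᶠ[nhds z] fun y =>
      ((fderiv ℝ φ y (Pi.single k 1) : ℂ) +
        Complex.I * (fderiv ℝ φ y (Complex.I • Pi.single k 1) : ℂ)) * 2⁻¹ := by
    intro k
    filter_upwards [ContDiffAt.eventually_differentiableAt_of_two hφ] with y hy
    have h4 : HasFDerivAt (fun y => (φ y : ℂ)) (Complex.ofRealCLM.comp (fderiv ℝ φ y)) y :=
      Complex.ofRealCLM.hasFDerivAt.comp y hy.hasFDerivAt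
    rw [dzbar, h4.fderiv, div_eq_mul_inv]
    simp
  ext j k
  change _ = dz j (dzbar k fun y => (φ y : ℂ)) z
  have h5 := ((h1 (Pi.single k 1)).fun_add ((h1 (Complex.I • Pi.single k 1)).const_mul
    Complex.I)).mul_const (2⁻¹ : ℂ)
  have hD : ∀ u v : Fin n → ℂ, iteratedFDeriv ℝ 2 φ z ![u, v] = fderiv ℝ (fderiv ℝ φ) z u v := by
    intro u v
    rw [iteratedFDeriv_two_apply]
    rfl
  rw [dz_congr (h3 k), dz, h5.fderiv]
  simp only [formMatrix, Matrix.of_apply, hw, ddbar, hD, smul_smul, Complex.I_mul_I, neg_one_smul,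
    map_neg, smul_apply, add_apply, smul_eq_mul, ContinuousLinearMap.comp_apply,
    ContinuousLinearMap.flip_apply, Complex.ofRealCLM_apply]
  push_cast
  linear_combination ((fderiv ℝ (fderiv ℝ φ) z (Complex.I • Pi.single j 1)
    (Complex.I • Pi.single k 1) : ℂ) / 4) * Complex.I_sq

end Forms

/-! ### Families of Hermitian matrices in charts -/

section Charts

variable {n : ℕ} {X : Type*} [TopologicalSpace X] [ChartedSpace (Fin n → ℂ) X]

section Transition

variable [IsManifold 𝓘(ℂ, Fin n → ℂ) ω X]

/-- Transition maps are holomorphic. -/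
lemma contDiffAt_transition {e e' : OpenPartialHomeomorph X (Fin n → ℂ)}
    (he : e ∈ atlas (Fin n → ℂ) X) (he' : e' ∈ atlas (Fin n → ℂ) X) {z : Fin n → ℂ}
    (hz : z ∈ e.target) (hz' : e.symm z ∈ e'.source) :
    ContDiffAt ℂ 2 (fun y => e' (e.symm y)) z := by
  have h := (contDiffGroupoid ω 𝓘(ℂ, Fin n → ℂ)).compatible he he'
  rw [contDiffGroupoid, mem_groupoid_of_pregroupoid] at h
  have h1 : ContDiffOn ℂ ω (𝓘(ℂ, Fin n → ℂ) ∘ (e.symm ≫ₕ e') ∘ 𝓘(ℂ, Fin n → ℂ).symm)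
    (𝓘(ℂ, Fin n → ℂ).symm ⁻¹' (e.symm ≫ₕ e').source ∩ Set.range 𝓘(ℂ, Fin n → ℂ)) := h.1
  have hmem : z ∈ (e.symm ≫ₕ e').source := by
    rw [OpenPartialHomeomorph.trans_source]
    exact ⟨hz, hz'⟩
  have h2 : ContDiffOn ℂ ω (fun y => e' (e.symm y)) (e.symm ≫ₕ e').source := by
    simpa [Function.comp_def] using h1
  exact (h2.contDiffAt ((e.symm ≫ₕ e').open_source.mem_nhds hmem)).of_le le_top

lemma mdifferentiableAt_symm {e : OpenPartialHomeomorph X (Fin n → ℂ)}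
    (he : e ∈ atlas (Fin n → ℂ) X) {z : Fin n → ℂ} (hz : z ∈ e.target) :
    MDifferentiableAt 𝓘(ℝ, Fin n → ℂ) 𝓘(ℝ, Fin n → ℂ) e.symm z := by
  have := isManifold_real n X
  have h1 : ContMDiffOn 𝓘(ℝ, Fin n → ℂ) 𝓘(ℝ, Fin n → ℂ) ∞ e.symm e.target :=
    contMDiffOn_symm_of_mem_maximalAtlas (IsManifold.subset_maximalAtlas he)
  exact (h1.contMDiffAt (e.open_target.mem_nhds hz)).mdifferentiableAt (by simp)

/-- The differential of the inverse of a chart, in terms of the preferred chart which identifies the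
tangent space with `ℂⁿ`; it is complex linear. -/
lemma mfderiv_symm_eq {e : OpenPartialHomeomorph X (Fin n → ℂ)}
    (he : e ∈ atlas (Fin n → ℂ) X) {z : Fin n → ℂ} (hz : z ∈ e.target) :
    (mfderiv 𝓘(ℝ, Fin n → ℂ) 𝓘(ℝ, Fin n → ℂ) e.symm z : (Fin n → ℂ) →L[ℝ] Fin n → ℂ) =
      (fderiv ℂ (fun y => chartAt (Fin n → ℂ) (e.symm z) (e.symm y)) z).restrictScalars ℝ := by
  have hd := (contDiffAt_transition he (chart_mem_atlas (Fin n → ℂ) (e.symm z)) hz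
    (mem_chart_source _ _)).differentiableAt (by norm_num)
  refine (mdifferentiableAt_symm he hz).mfderiv.trans ?_
  simp only [writtenInExtChartAt, mfld_simps, fderivWithin_univ]
  exact (hd.hasFDerivAt.restrictScalars ℝ).fderiv

lemma localForm_eq (α : TwoForm n X) {e : OpenPartialHomeomorph X (Fin n → ℂ)}
    (he : e ∈ atlas (Fin n → ℂ) X) {z : Fin n → ℂ} (hz : z ∈ e.target) {x : X}
    (hx : e.symm z = x) :
    localForm α e z = (α x).compContinuousLinearMap
      ((fderiv ℂ (fun y => chartAt (Fin n → ℂ) x (e.symm y)) z).restrictScalars ℝ) := by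
  subst hx
  rw [← mfderiv_symm_eq he hz]
  rfl

/-- Change of charts for the local expressions of a form. -/
lemma localForm_transition (α : TwoForm n X) {e e' : OpenPartialHomeomorph X (Fin n → ℂ)}
    (he : e ∈ atlas (Fin n → ℂ) X) (he' : e' ∈ atlas (Fin n → ℂ) X) {z : Fin n → ℂ}
    (hz : z ∈ e.target) (hz' : e.symm z ∈ e'.source) :
    localForm α e z = (localForm α e' (e' (e.symm z))).compContinuousLinearMap
      ((fderiv ℂ (fun y => e' (e.symm y)) z).restrictScalars ℝ) := by
  set x := e.symm z with hx
  have hx' : e'.symm (e' x) = x := e'.left_inv hz'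
  have hw : e' x ∈ e'.target := e'.map_source hz'
  rw [localForm_eq α he hz hx.symm, localForm_eq α he' hw hx']
  have hd1 := (contDiffAt_transition he he' hz hz').differentiableAt (by norm_num)
  have hd2 := (contDiffAt_transition he' (chart_mem_atlas (Fin n → ℂ) x) hw
    (by rw [hx']; exact mem_chart_source _ _)).differentiableAt (by norm_num)
  have heq : (fun y => chartAt (Fin n → ℂ) x (e.symm y)) =ᶠ[nhds z]
      (fun w => chartAt (Fin n → ℂ) x (e'.symm w)) ∘ fun y => e' (e.symm y) := by
    have hc : ∀ᶠ y in nhds z, e.symm y ∈ e'.source :=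
      (e.continuousAt_symm hz).eventually (e'.open_source.mem_nhds hz')
    filter_upwards [hc] with y hy
    simp only [Function.comp_apply, e'.left_inv hy]
  have hcomp : fderiv ℂ (fun y => chartAt (Fin n → ℂ) x (e.symm y)) z =
      (fderiv ℂ (fun w => chartAt (Fin n → ℂ) x (e'.symm w)) (e' x)).comp
        (fderiv ℂ (fun y => e' (e.symm y)) z) := by
    rw [heq.fderiv_eq]
    exact fderiv_comp z hd2 hd1
  rw [hcomp]
  rfl

/-- At the base point of a preferred chart the local expression is the form itself. -/
lemma localForm_chartAt (α : TwoForm n X) (x : X) :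
    localForm α (chartAt (Fin n → ℂ) x) (chartAt (Fin n → ℂ) x x) = α x := by
  have hz := mem_chart_target (Fin n → ℂ) x
  rw [localForm_eq α (chart_mem_atlas (Fin n → ℂ) x) hz
    ((chartAt (Fin n → ℂ) x).left_inv (mem_chart_source _ x))]
  have heq : (fun y => chartAt (Fin n → ℂ) x ((chartAt (Fin n → ℂ) x).symm y)) =ᶠ[nhds
      (chartAt (Fin n → ℂ) x x)] id := by
    filter_upwards [(chartAt (Fin n → ℂ) x).open_target.mem_nhds hz] with y hy
    exact (chartAt (Fin n → ℂ) x).right_inv hy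
  rw [heq.fderiv_eq, fderiv_id]
  ext v
  rfl

lemma isOneOne_localForm {α : TwoForm n X} (hα : ∀ x, IsOneOne (α x))
    {e : OpenPartialHomeomorph X (Fin n → ℂ)} (he : e ∈ atlas (Fin n → ℂ) X) {z : Fin n → ℂ}
    (hz : z ∈ e.target) : IsOneOne (localForm α e z) := by
  rw [localForm_eq α he hz rfl]
  exact (hα _).comp _

/-- The Jacobian of a transition map is invertible. -/
lemma det_jacobian_transition_ne_zero {e e' : OpenPartialHomeomorph X (Fin n → ℂ)}
    (he : e ∈ atlas (Fin n → ℂ) X) (he' : e' ∈ atlas (Fin n → ℂ) X) {z : Fin n → ℂ}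
    (hz : z ∈ e.target) (hz' : e.symm z ∈ e'.source) :
    (jacobian (fun y => e' (e.symm y)) z).det ≠ 0 := by
  have hw : e' (e.symm z) ∈ e'.target := e'.map_source hz'
  have hx' : e'.symm (e' (e.symm z)) = e.symm z := e'.left_inv hz'
  have hd1 := (contDiffAt_transition he he' hz hz').differentiableAt (by norm_num)
  have hd2 := (contDiffAt_transition he' he hw
    (by rw [hx']; exact e.map_target hz)).differentiableAt (by norm_num)
  have heq : (fun w => e (e'.symm w)) ∘ (fun y => e' (e.symm y)) =ᶠ[nhds z] id := by
    have hc : ∀ᶠ y in nhds z, e.symm y ∈ e'.source :=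
      (e.continuousAt_symm hz).eventually (e'.open_source.mem_nhds hz')
    filter_upwards [hc, e.open_target.mem_nhds hz] with y hy hy'
    simp only [Function.comp_apply, e'.left_inv hy, e.right_inv hy', id]
  have hcomp : (fderiv ℂ (fun w => e (e'.symm w)) (e' (e.symm z))).comp
      (fderiv ℂ (fun y => e' (e.symm y)) z) = ContinuousLinearMap.id ℂ (Fin n → ℂ) := by
    rw [← fderiv_id (x := z), ← heq.fderiv_eq]
    exact (fderiv_comp z hd2 hd1).symm
  have hJ : jacobian (fun y => e' (e.symm y)) z =
      LinearMap.toMatrix' (fderiv ℂ (fun y => e' (e.symm y)) z : (Fin n → ℂ) →ₗ[ℂ] Fin n → ℂ) := by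
    ext i j
    rw [LinearMap.toMatrix'_apply]
    rfl
  have h1 := congrArg (fun L : (Fin n → ℂ) →L[ℂ] Fin n → ℂ =>
    LinearMap.det (L : (Fin n → ℂ) →ₗ[ℂ] Fin n → ℂ)) hcomp
  simp only [ContinuousLinearMap.toLinearMap_comp, LinearMap.det_comp,
    ContinuousLinearMap.coe_id, LinearMap.det_id] at h1
  rw [hJ, LinearMap.det_toMatrix']
  exact right_ne_zero_of_mul_eq_one h1

end Transition

/-- A rule that attaches to every chart a matrix-valued function, like the coefficients of a smooth
`∂`-closed complex `(1,1)`-form on `X`: it changes as the coefficients of a `(1,1)`-form under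
change of charts, is smooth, and has `∂`-closed columns. -/
structure IsClosedFamily
    (B : OpenPartialHomeomorph X (Fin n → ℂ) → (Fin n → ℂ) → Matrix (Fin n) (Fin n) ℂ) :
    Prop where
  transform : ∀ e ∈ atlas (Fin n → ℂ) X, ∀ e' ∈ atlas (Fin n → ℂ) X, ∀ z ∈ e.target,
    e.symm z ∈ e'.source → B e z = (jacobian (fun y => e' (e.symm y)) z).transpose *
      B e' (e' (e.symm z)) * (jacobian (fun y => e' (e.symm y)) z).map (starRingEnd ℂ)
  smooth : ∀ e ∈ atlas (Fin n → ℂ) X, ∀ i k, ContDiffOn ℝ ∞ (fun z => B e z i k) e.target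
  closed : ∀ e ∈ atlas (Fin n → ℂ) X, ∀ z ∈ e.target, ∀ j l k,
    dz l (fun y => B e y j k) z = dz j (fun y => B e y l k) z

lemma IsClosedFamily.add {B B' : OpenPartialHomeomorph X (Fin n → ℂ) → (Fin n → ℂ) →
    Matrix (Fin n) (Fin n) ℂ} (hB : IsClosedFamily B) (hB' : IsClosedFamily B') :
    IsClosedFamily (fun e z => B e z + B' e z) where
  transform e he e' he' z hz hz' := by
    rw [hB.transform e he e' he' z hz hz', hB'.transform e he e' he' z hz hz', Matrix.mul_add,
      Matrix.add_mul]
  smooth e he i k := (hB.smooth e he i k).add (hB'.smooth e he i k)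
  closed e he z hz j l k := by
    have hd : ∀ {B : OpenPartialHomeomorph X (Fin n → ℂ) → (Fin n → ℂ) →
        Matrix (Fin n) (Fin n) ℂ}, IsClosedFamily B → ∀ i k,
        DifferentiableAt ℝ (fun z => B e z i k) z := fun hB i k =>
      ((hB.smooth e he i k).contDiffAt (e.open_target.mem_nhds hz)).differentiableAt (by simp)
    simp only [Matrix.add_apply]
    rw [dz_add (hd hB _ _) (hd hB' _ _), dz_add (hd hB _ _) (hd hB' _ _), hB.closed e he z hz,
      hB'.closed e he z hz]

lemma IsClosedFamily.smul {B : OpenPartialHomeomorph X (Fin n → ℂ) → (Fin n → ℂ) →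
    Matrix (Fin n) (Fin n) ℂ} (hB : IsClosedFamily B) (c : ℂ) :
    IsClosedFamily (fun e z => c • B e z) where
  transform e he e' he' z hz hz' := by
    rw [hB.transform e he e' he' z hz hz', Matrix.mul_smul, Matrix.smul_mul]
  smooth e he i k := contDiffOn_const.mul (hB.smooth e he i k)
  closed e he z hz j l k := by
    have hd : ∀ i k, DifferentiableAt ℝ (fun z => B e z i k) z := fun i k =>
      ((hB.smooth e he i k).contDiffAt (e.open_target.mem_nhds hz)).differentiableAt (by simp)
    simp only [Matrix.smul_apply, smul_eq_mul]
    rw [dz_const_mul (hd _ _), dz_const_mul (hd _ _), hB.closed e he z hz]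

/-- Applying a form to fixed vectors is a continuous linear operation. -/
lemma hasFDerivAt_apply {w : (Fin n → ℂ) → (Fin n → ℂ) [⋀^Fin 2]→L[ℝ] ℝ} {z : Fin n → ℂ}
    (hw : DifferentiableAt ℝ w z) (u v : Fin n → ℂ) :
    DifferentiableAt ℝ (fun y => w y ![u, v]) z ∧
      ∀ x, fderiv ℝ (fun y => w y ![u, v]) z x = fderiv ℝ w z x ![u, v] := by
  have h : HasFDerivAt (fun y => w y ![u, v])
      ((ContinuousAlternatingMap.apply ℝ (Fin n → ℂ) ℝ ![u, v]).comp (fderiv ℝ w z)) z :=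
    (ContinuousAlternatingMap.apply ℝ (Fin n → ℂ) ℝ ![u, v]).hasFDerivAt.comp z hw.hasFDerivAt
  exact ⟨h.differentiableAt, fun x => by rw [h.fderiv]; rfl⟩

/-- For a closed `2`-form the derivatives satisfy the cocycle identity. -/
lemma fderiv_cocycle {w : (Fin n → ℂ) → (Fin n → ℂ) [⋀^Fin 2]→L[ℝ] ℝ} {z : Fin n → ℂ}
    (hw : DifferentiableAt ℝ w z) (hd : extDeriv w z = 0) (a b c : Fin n → ℂ) :
    fderiv ℝ w z a ![b, c] - fderiv ℝ w z b ![a, c] + fderiv ℝ w z c ![a, b] = 0 := by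
  have h := extDeriv_apply hw ![a, b, c]
  rw [hd, Fin.sum_univ_three] at h
  have e0 : (0 : Fin 3).removeNth ![a, b, c] = ![b, c] := by
    ext i; fin_cases i <;> rfl
  have e1 : (1 : Fin 3).removeNth ![a, b, c] = ![a, c] := by
    ext i; fin_cases i <;> rfl
  have e2 : (2 : Fin 3).removeNth ![a, b, c] = ![a, b] := by
    ext i; fin_cases i <;> rfl
  rw [e0, e1, e2, (hasFDerivAt_apply hw _ _).2, (hasFDerivAt_apply hw _ _).2,
    (hasFDerivAt_apply hw _ _).2] at h
  simp at h
  linarith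

/-- The coefficients of a closed form of type `(1,1)` are `∂`-closed. -/
lemma dz_formMatrix_comm {w : (Fin n → ℂ) → (Fin n → ℂ) [⋀^Fin 2]→L[ℝ] ℝ} {z : Fin n → ℂ}
    (hw : DifferentiableAt ℝ w z) (hd : extDeriv w z = 0) (h11 : ∀ᶠ y in nhds z, IsOneOne (w y))
    (j l k : Fin n) :
    dz l (fun y => formMatrix (w y) j k) z = dz j (fun y => formMatrix (w y) l k) z := by
  have h11' : ∀ x, IsOneOne (fderiv ℝ w z x) := by
    intro x u v
    rw [← (hasFDerivAt_apply hw _ _).2, ← (hasFDerivAt_apply hw _ _).2]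
    have heq : (fun y => w y ![Complex.I • u, Complex.I • v]) =ᶠ[nhds z] fun y => w y ![u, v] :=
      h11.mono fun y hy => hy u v
    rw [heq.fderiv_eq]
  have hfd : ∀ j x, fderiv ℝ (fun y => formMatrix (w y) j k) z x =
      formMatrix (fderiv ℝ w z x) j k := by
    intro j x
    obtain ⟨d1, f1⟩ := hasFDerivAt_apply hw (Pi.single j 1) (Complex.I • Pi.single k 1)
    obtain ⟨d2, f2⟩ := hasFDerivAt_apply hw (Pi.single j 1) (Pi.single k 1)
    have g1 : HasFDerivAt (fun y => (w y ![Pi.single j 1, Complex.I • Pi.single k 1] : ℂ)) _ z :=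
      Complex.ofRealCLM.hasFDerivAt.comp z d1.hasFDerivAt
    have g2 : HasFDerivAt (fun y => (w y ![Pi.single j 1, Pi.single k 1] : ℂ)) _ z :=
      Complex.ofRealCLM.hasFDerivAt.comp z d2.hasFDerivAt
    have g3 := (g1.fun_sub (g2.const_mul Complex.I)).mul_const (2⁻¹ : ℂ)
    have g4 : HasFDerivAt (fun y => formMatrix (w y) j k) _ z := g3.congr_of_eventuallyEq
      (Filter.Eventually.of_forall fun y => by
        simp only [formMatrix, Matrix.of_apply, div_eq_mul_inv])
    rw [g4.fderiv]
    simp only [smul_apply, sub_apply, ContinuousLinearMap.comp_apply, f1, f2,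
      Complex.ofRealCLM_apply, smul_eq_mul, formMatrix, Matrix.of_apply]
    ring
  rw [dz, dz, hfd, hfd, hfd, hfd]
  simp only [formMatrix, Matrix.of_apply]
  have c1 := fderiv_cocycle hw hd (Pi.single l 1) (Pi.single j 1) (Complex.I • Pi.single k 1)
  have c2 := fderiv_cocycle hw hd (Pi.single l 1) (Pi.single j 1) (Pi.single k 1)
  have c3 := fderiv_cocycle hw hd (Complex.I • Pi.single l 1) (Complex.I • Pi.single j 1)
    (Pi.single k 1)
  have c4 := fderiv_cocycle hw hd (Complex.I • Pi.single l 1) (Complex.I • Pi.single j 1)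
    (Complex.I • Pi.single k 1)
  rw [h11', (h11' _).apply_I_left, (h11' _).apply_I_left] at c3
  rw [h11', h11', h11'] at c4
  generalize fderiv ℝ w z (Pi.single l 1) ![Pi.single j 1, Complex.I • Pi.single k 1] = x1 at *
  generalize fderiv ℝ w z (Pi.single j 1) ![Pi.single l 1, Complex.I • Pi.single k 1] = x2 at *
  generalize fderiv ℝ w z (Pi.single l 1) ![Pi.single j 1, Pi.single k 1] = x3 at *
  generalize fderiv ℝ w z (Pi.single j 1) ![Pi.single l 1, Pi.single k 1] = x4 at *
  generalize fderiv ℝ w z (Complex.I • Pi.single l 1)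
    ![Pi.single j 1, Complex.I • Pi.single k 1] = x5 at *
  generalize fderiv ℝ w z (Complex.I • Pi.single j 1)
    ![Pi.single l 1, Complex.I • Pi.single k 1] = x6 at *
  generalize fderiv ℝ w z (Complex.I • Pi.single l 1) ![Pi.single j 1, Pi.single k 1] = x7 at *
  generalize fderiv ℝ w z (Complex.I • Pi.single j 1) ![Pi.single l 1, Pi.single k 1] = x8 at *
  have r1 : x1 - x7 = x2 - x8 := by linarith
  have r2 : x3 + x5 = x4 + x6 := by linarith
  have r1' : (x1 : ℂ) - x7 = x2 - x8 := by exact_mod_cast r1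
  have r2' : (x3 : ℂ) + x5 = x4 + x6 := by exact_mod_cast r2
  linear_combination r1' / 4 - Complex.I * r2' / 4 +
    ((x7 - x8 : ℂ) / 4) * Complex.I_sq

variable [IsManifold 𝓘(ℂ, Fin n → ℂ) ω X]

/-- The coefficients of a closed real `(1,1)`-form. -/
lemma isClosedFamily_closedForm (α : ClosedForm n X) :
    IsClosedFamily (n := n) (X := X) (fun e z => formMatrix (localForm α.1 e z)) where
  transform e he e' he' z hz hz' := by
    rw [localForm_transition α.1 he he' hz hz',
      (isOneOne_localForm α.2.1 he' (e'.map_source hz')).formMatrix_comp]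
    rfl
  smooth e he i k := by
    have h := (α.2.2 e he).1
    have h1 : ∀ u v : Fin n → ℂ, ContDiffOn ℝ ∞
        (fun z => (localForm α.1 e z ![u, v] : ℂ)) e.target := fun u v =>
      (Complex.ofRealCLM.comp
        (ContinuousAlternatingMap.apply ℝ (Fin n → ℂ) ℝ ![u, v])).contDiff.comp_contDiffOn h
    exact ((h1 _ _).sub (contDiffOn_const.mul (h1 _ _))).div_const 2
  closed e he z hz j l k := by
    have hnhds := e.open_target.mem_nhds hz
    refine dz_formMatrix_comm (((α.2.2 e he).1.contDiffAt hnhds).differentiableAt (by simp))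
      ((α.2.2 e he).2 z hz) ?_ j l k
    filter_upwards [hnhds] with y hy
    exact isOneOne_localForm α.2.1 he hy

lemma contDiffOn_comp_symm {F : Type*} [NormedAddCommGroup F] [NormedSpace ℝ F] {f : X → F}
    (hf : ContMDiff 𝓘(ℝ, Fin n → ℂ) 𝓘(ℝ, F) ∞ f) {e : OpenPartialHomeomorph X (Fin n → ℂ)}
    (he : e ∈ atlas (Fin n → ℂ) X) : ContDiffOn ℝ ∞ (fun z => f (e.symm z)) e.target := by
  have := isManifold_real n X
  have h1 : ContMDiffOn 𝓘(ℝ, Fin n → ℂ) 𝓘(ℝ, Fin n → ℂ) ∞ e.symm e.target :=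
    contMDiffOn_symm_of_mem_maximalAtlas (IsManifold.subset_maximalAtlas he)
  exact contMDiffOn_iff_contDiffOn.1 (hf.comp_contMDiffOn h1)

lemma contDiffAt_comp_symm {F : Type*} [NormedAddCommGroup F] [NormedSpace ℝ F] {f : X → F}
    (hf : ContMDiff 𝓘(ℝ, Fin n → ℂ) 𝓘(ℝ, F) ∞ f) {e : OpenPartialHomeomorph X (Fin n → ℂ)}
    (he : e ∈ atlas (Fin n → ℂ) X) {z : Fin n → ℂ} (hz : z ∈ e.target) :
    ContDiffAt ℝ 2 (fun z => f (e.symm z)) z :=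
  ((contDiffOn_comp_symm hf he).contDiffAt (e.open_target.mem_nhds hz)).of_le
    (mod_cast ENat.LEInfty.out)

/-- The coefficients of `i∂∂̄f`, for a smooth complex function `f`. -/
lemma isClosedFamily_complexHessian {f : X → ℂ} (hf : ContMDiff 𝓘(ℝ, Fin n → ℂ) 𝓘(ℝ, ℂ) ∞ f) :
    IsClosedFamily (n := n) (X := X) (fun e z => complexHessian (fun y => f (e.symm y)) z) where
  transform e he e' he' z hz hz' := by
    have heq : (fun y => f (e.symm y)) =ᶠ[nhds z] fun y => f (e'.symm (e' (e.symm y))) := by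
      have hc : ∀ᶠ y in nhds z, e.symm y ∈ e'.source :=
        (e.continuousAt_symm hz).eventually (e'.open_source.mem_nhds hz')
      filter_upwards [hc] with y hy
      rw [e'.left_inv hy]
    rw [complexHessian_congr heq]
    exact complexHessian_comp (G := fun w => f (e'.symm w)) (contDiffAt_transition he he' hz hz')
      (contDiffAt_comp_symm hf he' (e'.map_source hz'))
  smooth e he i k := by
    have h := contDiffOn_comp_symm hf he
    have hop := e.open_target
    have h1 : ContDiffOn ℝ ∞ (dzbar k fun y => f (e.symm y)) e.target := by
      have h2 := h.fderiv_of_isOpen (m := ∞) hop (by simp)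
      exact ((h2.clm_apply contDiffOn_const).add
        (contDiffOn_const.mul (h2.clm_apply contDiffOn_const))).div_const 2
    have h3 := h1.fderiv_of_isOpen (m := ∞) hop (by simp)
    exact ((h3.clm_apply contDiffOn_const).sub
      (contDiffOn_const.mul (h3.clm_apply contDiffOn_const))).div_const 2
  closed e he z hz j l k := by
    have h := contDiffOn_comp_symm hf he
    have hop := e.open_target
    have h2 := h.fderiv_of_isOpen (m := ∞) hop (by simp)
    have h1 : ContDiffOn ℝ ∞ (dzbar k fun y => f (e.symm y)) e.target :=
      ((h2.clm_apply contDiffOn_const).add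
        (contDiffOn_const.mul (h2.clm_apply contDiffOn_const))).div_const 2
    exact dz_dz_comm ((h1.contDiffAt (hop.mem_nhds hz)).of_le (mod_cast ENat.LEInfty.out)) j l

end Charts

/-! ### Integration over the manifold -/

section Integration

open MeasureTheory

variable {n : ℕ}

lemma integrableOn_of_eq_zero_off_compact {E F : Type*} [NormedAddCommGroup E] [MeasurableSpace E]
    [BorelSpace E] [NormedAddCommGroup F] {μ : Measure E} [IsFiniteMeasureOnCompacts μ]
    {T K : Set E} (hT : MeasurableSet T) (hK : IsCompact K)
    (hKT : K ⊆ T) {g : E → F} (hg : ContinuousOn g T) (h0 : ∀ z ∈ T, z ∉ K → g z = 0) :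
    IntegrableOn g T μ :=
  ((hg.mono hKT).integrableOn_compact hK).of_forall_sdiff_eq_zero hT fun z hz => h0 z hz.1 hz.2

/-- The real Jacobian determinant of a holomorphic map is `|det J|²`. -/
lemma det_restrictScalars_eq_normSq (A : (Fin n → ℂ) →L[ℂ] Fin n → ℂ) :
    (A.restrictScalars ℝ).det =
      Complex.normSq (Matrix.of fun m j => A (Pi.single j 1) m : Matrix (Fin n) (Fin n) ℂ).det := by
  have hJ : (Matrix.of fun m j => A (Pi.single j 1) m : Matrix (Fin n) (Fin n) ℂ) =
      LinearMap.toMatrix' (A : (Fin n → ℂ) →ₗ[ℂ] Fin n → ℂ) := by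
    ext i j
    rw [LinearMap.toMatrix'_apply]
    rfl
  rw [hJ, LinearMap.det_toMatrix', ← Algebra.norm_complex_apply]
  exact LinearMap.det_restrictScalars (R := ℝ) (f := (A : (Fin n → ℂ) →ₗ[ℂ] Fin n → ℂ))

lemma isCompact_image_tsupport {X F : Type*} [TopologicalSpace X] [CompactSpace X] [Zero F]
    {f : X → F} {e : OpenPartialHomeomorph X (Fin n → ℂ)} (hf : tsupport f ⊆ e.source) :
    IsCompact (e '' tsupport f) :=
  (isClosed_tsupport f).isCompact.image_of_continuousOn (e.continuousOn.mono hf)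

lemma symm_notMem_tsupport {X F : Type*} [TopologicalSpace X] [Zero F] {f : X → F}
    {e : OpenPartialHomeomorph X (Fin n → ℂ)} {z : Fin n → ℂ} (hz : z ∈ e.target)
    (h : z ∉ e '' tsupport f) : e.symm z ∉ tsupport f :=
  fun h' => h ⟨_, h', e.right_inv hz⟩

variable {X : Type*} [TopologicalSpace X] [ChartedSpace (Fin n → ℂ) X]

lemma IsClosedFamily.det_transform {B : OpenPartialHomeomorph X (Fin n → ℂ) → (Fin n → ℂ) →
    Matrix (Fin n) (Fin n) ℂ} (hB : IsClosedFamily B) {e e' : OpenPartialHomeomorph X (Fin n → ℂ)}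
    (he : e ∈ atlas (Fin n → ℂ) X) (he' : e' ∈ atlas (Fin n → ℂ) X) {z : Fin n → ℂ}
    (hz : z ∈ e.target) (hz' : e.symm z ∈ e'.source) :
    (B e z).det = (Complex.normSq (jacobian (fun y => e' (e.symm y)) z).det : ℂ) *
      (B e' (e' (e.symm z))).det := by
  rw [hB.transform e he e' he' z hz hz', Matrix.det_mul, Matrix.det_mul, Matrix.det_transpose]
  have h : ((jacobian (fun y => e' (e.symm y)) z).map (starRingEnd ℂ)).det =
      (starRingEnd ℂ) (jacobian (fun y => e' (e.symm y)) z).det :=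
    ((starRingEnd ℂ).map_det _).symm
  rw [h, ← Complex.mul_conj]
  ring

lemma IsClosedFamily.continuousOn_det {B : OpenPartialHomeomorph X (Fin n → ℂ) → (Fin n → ℂ) →
    Matrix (Fin n) (Fin n) ℂ} (hB : IsClosedFamily B) {e : OpenPartialHomeomorph X (Fin n → ℂ)}
    (he : e ∈ atlas (Fin n → ℂ) X) : ContinuousOn (fun z => (B e z).det) e.target :=
  (contDiffOn_det (N := ⊤) (hB.smooth e he)).continuousOn

variable [T2Space X] [CompactSpace X] [IsManifold 𝓘(ℂ, Fin n → ℂ) ω X]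

lemma tsupport_chartPartition_subset (p : X) :
    tsupport (chartPartition n X p) ⊆ (chartAt (Fin n → ℂ) p).source :=
  haveI := isManifold_real n X
  (SmoothPartitionOfUnity.exists_isSubordinate_chartAt_source 𝓘(ℝ, Fin n → ℂ) X).choose_spec p

variable (n X) in
lemma exists_finset_chartPartition : ∃ S : Finset X, (∀ p ∉ S, ∀ x, chartPartition n X p x = 0) ∧
    ∀ x, ∑ p ∈ S, chartPartition n X p x = 1 := by
  have hfin := (chartPartition n X).locallyFinite.finite_nonempty_of_compact
  have h0 : ∀ p ∉ hfin.toFinset, ∀ x, chartPartition n X p x = 0 := by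
    intro p hp x
    by_contra hne
    exact hp (hfin.mem_toFinset.2 ⟨x, hne⟩)
  refine ⟨hfin.toFinset, h0, fun x => ?_⟩
  rw [← (chartPartition n X).sum_eq_one (Set.mem_univ x)]
  refine (finsum_eq_sum_of_support_subset _ fun p hp => ?_).symm
  by_contra h
  exact hp (h0 p h x)

/-- The integral of the top degree form with coefficient `2ⁿ det B`. -/
noncomputable def densityIntegral
    (B : OpenPartialHomeomorph X (Fin n → ℂ) → (Fin n → ℂ) → Matrix (Fin n) (Fin n) ℂ) : ℂ :=
  ∑ᶠ p : X, ∫ z in (chartAt (Fin n → ℂ) p).target,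
    (chartPartition n X p ((chartAt (Fin n → ℂ) p).symm z) : ℂ) *
      (2 ^ n * (B (chartAt (Fin n → ℂ) p) z).det)

lemma densityIntegral_congr
    {B B' : OpenPartialHomeomorph X (Fin n → ℂ) → (Fin n → ℂ) → Matrix (Fin n) (Fin n) ℂ}
    (h : ∀ e ∈ atlas (Fin n → ℂ) X, ∀ z ∈ e.target, B e z = B' e z) :
    densityIntegral B = densityIntegral B' := by
  refine finsum_congr fun p => ?_
  refine setIntegral_congr_fun (chartAt (Fin n → ℂ) p).open_target.measurableSet fun z hz => ?_
  simp only [h _ (chart_mem_atlas _ _) z hz]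

lemma densityIntegral_eq_sum
    (B : OpenPartialHomeomorph X (Fin n → ℂ) → (Fin n → ℂ) → Matrix (Fin n) (Fin n) ℂ)
    {S : Finset X} (hS : ∀ p ∉ S, ∀ x, chartPartition n X p x = 0) :
    densityIntegral B = ∑ p ∈ S, ∫ z in (chartAt (Fin n → ℂ) p).target,
      (chartPartition n X p ((chartAt (Fin n → ℂ) p).symm z) : ℂ) *
        (2 ^ n * (B (chartAt (Fin n → ℂ) p) z).det) := by
  refine finsum_eq_sum_of_support_subset _ fun p hp => ?_
  by_contra h
  exact hp (by simp [hS p h])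

lemma continuousOn_chartPartition_symm (p : X) {e : OpenPartialHomeomorph X (Fin n → ℂ)} :
    ContinuousOn (fun z => (chartPartition n X p (e.symm z) : ℂ)) e.target :=
  Complex.continuous_ofReal.comp_continuousOn
    ((chartPartition n X p).contMDiff.continuous.comp_continuousOn e.continuousOn_symm)

lemma integrableOn_chartPartition_mul (p : X) {g : (Fin n → ℂ) → ℂ}
    (hg : ContinuousOn g (chartAt (Fin n → ℂ) p).target) :
    IntegrableOn (fun z => (chartPartition n X p ((chartAt (Fin n → ℂ) p).symm z) : ℂ) * g z)
      (chartAt (Fin n → ℂ) p).target := by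
  have hsub := tsupport_chartPartition_subset (n := n) p
  refine integrableOn_of_eq_zero_off_compact (chartAt (Fin n → ℂ) p).open_target.measurableSet
    (isCompact_image_tsupport hsub) ?_ ((continuousOn_chartPartition_symm p).mul hg) ?_
  · rintro _ ⟨x, hx, rfl⟩
    exact (chartAt (Fin n → ℂ) p).map_source (hsub hx)
  · intro z hz hzK
    rw [image_eq_zero_of_notMem_tsupport (symm_notMem_tsupport hz hzK)]
    simp

/-- The integral of a top degree form supported in one chart can be computed in that chart. -/
lemma sum_integral_eq_integral_of_tsupport_subset {S : Finset X}
    (hS : ∀ x, ∑ p ∈ S, chartPartition n X p x = 1) {q : X} {K : Set X} (hKc : IsClosed K)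
    (hKq : K ⊆ (chartAt (Fin n → ℂ) q).source) {D : X → (Fin n → ℂ) → ℂ}
    (hDc : ContinuousOn (D q) (chartAt (Fin n → ℂ) q).target)
    (hD0 : ∀ p, ∀ z ∈ (chartAt (Fin n → ℂ) p).target, (chartAt (Fin n → ℂ) p).symm z ∉ K →
      D p z = 0)
    (hDt : ∀ p, ∀ z ∈ (chartAt (Fin n → ℂ) p).target,
      (chartAt (Fin n → ℂ) p).symm z ∈ (chartAt (Fin n → ℂ) q).source →
      D p z = (Complex.normSq (jacobian (fun y => chartAt (Fin n → ℂ) q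
        ((chartAt (Fin n → ℂ) p).symm y)) z).det : ℂ) *
        D q (chartAt (Fin n → ℂ) q ((chartAt (Fin n → ℂ) p).symm z))) :
    ∑ p ∈ S, ∫ z in (chartAt (Fin n → ℂ) p).target,
      (chartPartition n X p ((chartAt (Fin n → ℂ) p).symm z) : ℂ) * D p z =
    ∫ z in (chartAt (Fin n → ℂ) q).target, D q z := by
  set c : X → OpenPartialHomeomorph X (Fin n → ℂ) := fun p => chartAt (Fin n → ℂ) p with hc
  have hq : ∀ p, c p ∈ atlas (Fin n → ℂ) X := fun p => chart_mem_atlas _ p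
  have hchange : ∀ p, ∫ z in (c p).target, (chartPartition n X p ((c p).symm z) : ℂ) * D p z =
      ∫ w in (c q).target, (chartPartition n X p ((c q).symm w) : ℂ) * D q w := by
    intro p
    let τ := (c p).symm ≫ₕ c q
    have hτs : τ.source = (c p).target ∩ (c p).symm ⁻¹' (c q).source :=
      OpenPartialHomeomorph.trans_source _ _
    have hτt : τ.target = (c q).target ∩ (c q).symm ⁻¹' (c p).source :=
      OpenPartialHomeomorph.trans_target _ _
    have e1 : ∫ z in (c p).target, (chartPartition n X p ((c p).symm z) : ℂ) * D p z =
        ∫ z in τ.source, (chartPartition n X p ((c p).symm z) : ℂ) * D p z := by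
      refine setIntegral_eq_of_subset_of_forall_sdiff_eq_zero (c p).open_target.measurableSet
        (by rw [hτs]; exact Set.inter_subset_left) fun z hz => ?_
      rw [hD0 p z hz.1, mul_zero]
      intro hzK
      refine hz.2 ?_
      rw [hτs]
      exact ⟨hz.1, hKq hzK⟩
    have e2 : ∫ w in (c q).target, (chartPartition n X p ((c q).symm w) : ℂ) * D q w =
        ∫ w in τ.target, (chartPartition n X p ((c q).symm w) : ℂ) * D q w := by
      refine setIntegral_eq_of_subset_of_forall_sdiff_eq_zero (c q).open_target.measurableSet
        (by rw [hτt]; exact Set.inter_subset_left) fun w hw => ?_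
      have h0 : (c q).symm w ∉ tsupport (chartPartition n X p) := by
        intro h
        refine hw.2 ?_
        rw [hτt]
        exact ⟨hw.1, tsupport_chartPartition_subset p h⟩
      rw [image_eq_zero_of_notMem_tsupport h0, Complex.ofReal_zero, zero_mul]
    have hτd : ∀ z ∈ τ.source, HasFDerivAt τ
        ((fderiv ℂ (fun y => c q ((c p).symm y)) z).restrictScalars ℝ) z := by
      intro z hz
      rw [hτs] at hz
      exact ((contDiffAt_transition (hq p) (hq q) hz.1 hz.2).differentiableAt
        (by norm_num)).hasFDerivAt.restrictScalars ℝ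
    rw [e1, e2, integral_target_eq_integral_abs_det_fderiv_smul volume hτd]
    refine setIntegral_congr_fun τ.open_source.measurableSet fun z hz => ?_
    rw [hτs] at hz
    have h1 : (c q).symm (τ z) = (c p).symm z := (c q).left_inv hz.2
    simp only [h1]
    rw [hDt p z hz.1 hz.2, det_restrictScalars_eq_normSq, abs_of_nonneg (Complex.normSq_nonneg _),
      Complex.real_smul]
    change _ * ((Complex.normSq (jacobian (fun y => c q ((c p).symm y)) z).det : ℂ) *
      D q (c q ((c p).symm z))) =
      (Complex.normSq (jacobian (fun y => c q ((c p).symm y)) z).det : ℂ) *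
        (_ * D q (c q ((c p).symm z)))
    ring
  rw [Finset.sum_congr rfl fun p _ => hchange p, ← integral_finsetSum]
  · refine integral_congr_ae (Filter.Eventually.of_forall fun w => ?_)
    simp only
    rw [← Finset.sum_mul, ← Complex.ofReal_sum, hS, Complex.ofReal_one, one_mul]
  · intro p _
    refine integrableOn_of_eq_zero_off_compact (c q).open_target.measurableSet
      (hKc.isCompact.image_of_continuousOn ((c q).continuousOn.mono hKq)) ?_
      ((continuousOn_chartPartition_symm p).mul hDc) ?_
    · rintro _ ⟨x, hx, rfl⟩
      exact (c q).map_source (hKq hx)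
    · intro w hw hwK
      rw [hD0 q w hw fun h => hwK ⟨_, h, (c q).right_inv hw⟩, mul_zero]

/-- A form of Stokes' theorem: adding `i∂∂̄f` with `f` supported in a chart does not
change the integral of the determinant. -/
lemma densityIntegral_add_of_tsupport_subset
    {B : OpenPartialHomeomorph X (Fin n → ℂ) → (Fin n → ℂ) → Matrix (Fin n) (Fin n) ℂ}
    (hB : IsClosedFamily B) {f : X → ℂ} (hf : ContMDiff 𝓘(ℝ, Fin n → ℂ) 𝓘(ℝ, ℂ) ∞ f) {q : X}
    (hfq : tsupport f ⊆ (chartAt (Fin n → ℂ) q).source) :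
    densityIntegral (fun e z => B e z + complexHessian (fun y => f (e.symm y)) z) =
      densityIntegral B := by
  obtain ⟨S, hS0, hS1⟩ := exists_finset_chartPartition n X
  rw [densityIntegral_eq_sum _ hS0, densityIntegral_eq_sum _ hS0, ← sub_eq_zero,
    ← Finset.sum_sub_distrib]
  have hB' := hB.add (isClosedFamily_complexHessian hf)
  set B' : OpenPartialHomeomorph X (Fin n → ℂ) → (Fin n → ℂ) → Matrix (Fin n) (Fin n) ℂ :=
    fun e z => B e z + complexHessian (fun y => f (e.symm y)) z with hB'def
  set c : X → OpenPartialHomeomorph X (Fin n → ℂ) := fun p => chartAt (Fin n → ℂ) p with hc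
  have hq : ∀ p, c p ∈ atlas (Fin n → ℂ) X := fun p => chart_mem_atlas _ p
  let D : X → (Fin n → ℂ) → ℂ := fun p z => 2 ^ n * ((B' (c p) z).det - (B (c p) z).det)
  have hterm : ∀ p, ((∫ z in (c p).target, (chartPartition n X p ((c p).symm z) : ℂ) *
      (2 ^ n * (B' (c p) z).det)) - ∫ z in (c p).target,
        (chartPartition n X p ((c p).symm z) : ℂ) * (2 ^ n * (B (c p) z).det)) =
      ∫ z in (c p).target, (chartPartition n X p ((c p).symm z) : ℂ) * D p z := by
    intro p
    refine (integral_sub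
      (integrableOn_chartPartition_mul p (g := fun z => 2 ^ n * (B' (c p) z).det)
        (continuousOn_const.mul (hB'.continuousOn_det (hq p))))
      (integrableOn_chartPartition_mul p (g := fun z => 2 ^ n * (B (c p) z).det)
        (continuousOn_const.mul (hB.continuousOn_det (hq p))))).symm.trans ?_
    refine integral_congr_ae (Filter.Eventually.of_forall fun w => ?_)
    simp only [D]
    ring
  rw [Finset.sum_congr rfl fun p _ => hterm p]
  rw [sum_integral_eq_integral_of_tsupport_subset hS1 (isClosed_tsupport f) hfq]
  · -- the function `f` in the chart, extended by zero
    let g : (Fin n → ℂ) → ℂ := (c q).target.indicator fun z => f ((c q).symm z)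
    have hK := isCompact_image_tsupport hfq
    have hKT : (c q) '' tsupport f ⊆ (c q).target := by
      rintro _ ⟨x, hx, rfl⟩
      exact (c q).map_source (hfq hx)
    have hg0 : ∀ z, z ∉ (c q) '' tsupport f → g z = 0 := by
      intro z hz
      by_cases hzT : z ∈ (c q).target
      · simp only [g, Set.indicator_of_mem hzT]
        exact image_eq_zero_of_notMem_tsupport (symm_notMem_tsupport hzT hz)
      · simp only [g, Set.indicator_of_notMem hzT]
    have hgts : tsupport g ⊆ (c q) '' tsupport f := by
      refine closure_minimal (fun z hz => ?_) hK.isClosed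
      by_contra h
      exact hz (hg0 z h)
    have hgeq : ∀ z ∈ (c q).target, g =ᶠ[nhds z] fun y => f ((c q).symm y) := by
      intro z hz
      filter_upwards [(c q).open_target.mem_nhds hz] with y hy
      simp only [g, Set.indicator_of_mem hy]
    have hgsm : ContDiff ℝ ∞ g := by
      rw [contDiff_iff_contDiffAt]
      intro z
      by_cases hz : z ∈ (c q).target
      · exact ((contDiffOn_comp_symm hf (hq q)).contDiffAt
          ((c q).open_target.mem_nhds hz)).congr_of_eventuallyEq (hgeq z hz)
      · have h0 : g =ᶠ[nhds z] fun _ => 0 := by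
          filter_upwards [hK.isClosed.isOpen_compl.mem_nhds fun h => hz (hKT h)] with y hy
          exact hg0 y hy
        exact contDiffAt_const.congr_of_eventuallyEq h0
    obtain ⟨-, h0⟩ := integral_det_add_complexHessian (c q).open_target (hB.smooth _ (hq q))
      (hB.closed _ (hq q)) hgsm (hK.of_isClosed_subset (isClosed_tsupport g) hgts)
      (hgts.trans hKT)
    have h1 : ∫ z in (c q).target, D q z = 2 ^ n * ∫ z,
        ((B (c q) z + complexHessian g z).det - (B (c q) z).det) := by
      rw [← integral_const_mul]
      refine Eq.trans ?_ (setIntegral_eq_integral_of_forall_compl_eq_zero (s := (c q).target)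
        fun z hz => ?_)
      · refine setIntegral_congr_fun (c q).open_target.measurableSet fun z hz => ?_
        simp only [D, hB'def]
        rw [complexHessian_congr (hgeq z hz)]
      · rw [complexHessian_eq_zero_of_notMem_tsupport fun h => hz (hKT (hgts h)), add_zero,
          sub_self, mul_zero]
    exact h1.trans (by rw [h0, mul_zero])
  · exact continuousOn_const.mul ((hB'.continuousOn_det (hq q)).sub (hB.continuousOn_det (hq q)))
  · intro p z hz hzK
    have hzero : (fun y => f ((c p).symm y)) =ᶠ[nhds z] fun _ => 0 := by
      have := ((c p).continuousAt_symm hz).eventually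
        ((isClosed_tsupport f).isOpen_compl.mem_nhds hzK)
      filter_upwards [this] with y hy
      exact image_eq_zero_of_notMem_tsupport hy
    have hz0 : z ∉ tsupport fun y => f ((c p).symm y) := notMem_tsupport_iff_eventuallyEq.2 hzero
    simp only [D, hB'def]
    rw [complexHessian_eq_zero_of_notMem_tsupport hz0, add_zero, sub_self, mul_zero]
  · intro p z hz hz'
    simp only [D]
    rw [hB'.det_transform (hq p) (hq q) hz hz', hB.det_transform (hq p) (hq q) hz hz']
    ring

/-- Adding `i∂∂̄f` does not change the integral of the determinant: `f` is cut into pieces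
supported in charts. -/
theorem densityIntegral_add_complexHessian
    {B : OpenPartialHomeomorph X (Fin n → ℂ) → (Fin n → ℂ) → Matrix (Fin n) (Fin n) ℂ}
    (hB : IsClosedFamily B) {f : X → ℂ} (hf : ContMDiff 𝓘(ℝ, Fin n → ℂ) 𝓘(ℝ, ℂ) ∞ f) :
    densityIntegral (fun e z => B e z + complexHessian (fun y => f (e.symm y)) z) =
      densityIntegral B := by
  classical
  obtain ⟨S, -, hS1⟩ := exists_finset_chartPartition n X
  have hpiece : ∀ q, ContMDiff 𝓘(ℝ, Fin n → ℂ) 𝓘(ℝ, ℂ) ∞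
      fun x => chartPartition n X q x • f x := fun q => (chartPartition n X q).contMDiff.smul hf
  have hsum : ∀ T : Finset X, ContMDiff 𝓘(ℝ, Fin n → ℂ) 𝓘(ℝ, ℂ) ∞
      fun x => ∑ q ∈ T, chartPartition n X q x • f x := fun T =>
    contMDiff_finsetSum fun q _ => hpiece q
  have key : ∀ T : Finset X, densityIntegral (fun e z => B e z +
      complexHessian (fun y => ∑ q ∈ T, chartPartition n X q (e.symm y) • f (e.symm y)) z) =
      densityIntegral B := by
    intro T
    induction T using Finset.induction_on with
    | empty =>
      refine densityIntegral_congr fun e _ z _ => ?_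
      simp only [Finset.sum_empty]
      rw [complexHessian_eq_zero_of_notMem_tsupport (by simp [tsupport]), add_zero]
    | insert a T ha ih =>
      rw [← ih, ← densityIntegral_add_of_tsupport_subset
        (hB.add (isClosedFamily_complexHessian (hsum T))) (hpiece a) (q := a)]
      · refine densityIntegral_congr fun e he z hz => ?_
        simp only [Finset.sum_insert ha]
        rw [add_assoc, complexHessian_add (contDiffAt_comp_symm (hpiece a) he hz)
          (contDiffAt_comp_symm (hsum T) he hz), add_comm (complexHessian _ z)]
      · exact (closure_mono (Function.support_smul_subset_left _ _)).trans
          (tsupport_chartPartition_subset a)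
  have h1 : ∀ x, ∑ q ∈ S, chartPartition n X q x • f x = f x := fun x => by
    rw [← Finset.sum_smul, hS1, one_smul]
  simpa only [h1] using key S

end Integration

/-! ### The central charge -/

section CentralCharge

open MeasureTheory

variable {n : ℕ} {X : Type*} [TopologicalSpace X] [ChartedSpace (Fin n → ℂ) X]

/-- The coefficients of the complex `(1,1)`-form `α - i η` in charts. -/
noncomputable def coeffFamily (α η : ClosedForm n X) (e : OpenPartialHomeomorph X (Fin n → ℂ))
    (z : Fin n → ℂ) : Matrix (Fin n) (Fin n) ℂ :=
  formMatrix (localForm α.1 e z) + (-Complex.I) • formMatrix (localForm η.1 e z)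

variable [IsManifold 𝓘(ℂ, Fin n → ℂ) ω X]

lemma isClosedFamily_coeffFamily (α η : ClosedForm n X) : IsClosedFamily (coeffFamily α η) :=
  (isClosedFamily_closedForm α).add ((isClosedFamily_closedForm η).smul (-Complex.I))

lemma expTop_eq (α η : ClosedForm n X) {e : OpenPartialHomeomorph X (Fin n → ℂ)}
    (he : e ∈ atlas (Fin n → ℂ) X) {z : Fin n → ℂ} (hz : z ∈ e.target) :
    expTop α η (e.symm z) (fun q =>
      mfderiv 𝓘(ℝ, Fin n → ℂ) 𝓘(ℝ, Fin n → ℂ) e.symm z (realBasis n q)) =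
      2 ^ n * (coeffFamily α η e z).det := by
  have h := wedgePow_realBasis (fun u w => ((localForm α.1 e z ![u, w] : ℝ) : ℂ) -
    Complex.I * ((localForm η.1 e z ![u, w] : ℝ) : ℂ)) (coeffFamily α η e z) fun u v => by
      rw [(isOneOne_localForm α.2.1 he hz).apply_eq, (isOneOne_localForm η.2.1 he hz).apply_eq,
        mul_left_comm Complex.I Complex.I, ← mul_sub]
      congr 1
      rw [Finset.mul_sum, ← Finset.sum_sub_distrib]
      refine Finset.sum_congr rfl fun j _ => ?_
      rw [Finset.mul_sum, ← Finset.sum_sub_distrib]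
      refine Finset.sum_congr rfl fun k _ => ?_
      simp only [coeffFamily, Matrix.add_apply, Matrix.smul_apply, smul_eq_mul]
      ring
  have hloc : ∀ (γ : ClosedForm n X) (u w : Fin n → ℂ), localForm γ.1 e z ![u, w] =
      γ.1 (e.symm z) ![mfderiv 𝓘(ℝ, Fin n → ℂ) 𝓘(ℝ, Fin n → ℂ) e.symm z u,
        mfderiv 𝓘(ℝ, Fin n → ℂ) 𝓘(ℝ, Fin n → ℂ) e.symm z w] := fun γ u w =>
    comp_apply_pair _ _ u w
  simp only [hloc] at h
  have h2 : expTop α η (e.symm z) (fun q =>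
      mfderiv 𝓘(ℝ, Fin n → ℂ) 𝓘(ℝ, Fin n → ℂ) e.symm z (realBasis n q)) =
      (1 / (n.factorial : ℂ)) * (2 ^ n * n.factorial * (coeffFamily α η e z).det) := by
    rw [← h]
    rfl
  rw [h2]
  have : (n.factorial : ℂ) ≠ 0 := by exact_mod_cast n.factorial_ne_zero
  field_simp

lemma formMatrix_localForm_sub {α α' : ClosedForm n X} {φ : X → ℝ}
    (hφ : ContMDiff 𝓘(ℝ, Fin n → ℂ) 𝓘(ℝ, ℝ) ∞ φ)
    (h : ∀ e ∈ atlas (Fin n → ℂ) X, ∀ z ∈ e.target, ∀ u v : Fin n → ℂ,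
      localForm (α' - α).1 e z ![u, v] = ddbar (φ ∘ e.symm) z u v)
    {e : OpenPartialHomeomorph X (Fin n → ℂ)} (he : e ∈ atlas (Fin n → ℂ) X) {z : Fin n → ℂ}
    (hz : z ∈ e.target) : formMatrix (localForm α'.1 e z) =
      formMatrix (localForm α.1 e z) + complexHessian (fun y => (φ (e.symm y) : ℂ)) z := by
  have h1 := formMatrix_eq_complexHessian (contDiffAt_comp_symm hφ he hz) (h e he z hz)
  have h2 : localForm α'.1 e z = localForm α.1 e z + localForm (α' - α).1 e z := by
    have e1 : localForm (α' - α).1 e z = localForm α'.1 e z - localForm α.1 e z := rfl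
    rw [e1, add_sub_cancel]
  rw [h2, formMatrix_add, h1]

lemma cls_eq_iff {α β : ClosedForm n X} : cls α = cls β ↔ α - β ∈ ddbarExact n X :=
  Submodule.Quotient.eq _

lemma cls_out (a : H11 n X) : cls (Quotient.out a : ClosedForm n X) = a :=
  Quotient.out_eq a

/-- Pointwise, the phase is up to a constant the argument of the density of `exp (α - i κ)`. -/
lemma det_coeffFamily_polar {κ α : ClosedForm n X} (hκ : IsKahler κ) {c : ℝ}
    (hc : ∀ x, phase κ α x = c) {e : OpenPartialHomeomorph X (Fin n → ℂ)}
    (he : e ∈ atlas (Fin n → ℂ) X) {z : Fin n → ℂ} (hz : z ∈ e.target) :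
    0 < ‖(coeffFamily α κ e z).det‖ ∧ (coeffFamily α κ e z).det =
      ‖(coeffFamily α κ e z).det‖ * Complex.exp (Complex.I * (c - n * (Real.pi / 2) : ℝ)) := by
  set x := e.symm z with hx
  have hdet := (isClosedFamily_coeffFamily α κ).det_transform he
    (chart_mem_atlas (Fin n → ℂ) x) hz (mem_chart_source _ _)
  have hJ := det_jacobian_transition_ne_zero he (chart_mem_atlas (Fin n → ℂ) x) hz
    (mem_chart_source _ _)
  have hα : IsOneOne (α.1 x) := α.2.1 x
  have hκ1 : IsOneOne (κ.1 x) := κ.2.1 x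
  obtain ⟨r, hr, hdet2⟩ := det_sub_I_smul_polar (hκ1.posDef (hκ x)) hα.isHermitian
  have hph : matrixPhase (formMatrix (κ.1 x)) (formMatrix (α.1 x)) = c := hc x
  have hval : coeffFamily α κ (chartAt (Fin n → ℂ) x) (chartAt (Fin n → ℂ) x x) =
      formMatrix (α.1 x) - Complex.I • formMatrix (κ.1 x) := by
    unfold coeffFamily
    rw [localForm_chartAt, localForm_chartAt, neg_smul, sub_eq_add_neg]
  rw [← hx, hval, hdet2, hph] at hdet
  set N := Complex.normSq (jacobian (fun y => chartAt (Fin n → ℂ) x (e.symm y)) z).det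
  have hN : 0 < N := Complex.normSq_pos.2 hJ
  have hnorm : ‖(coeffFamily α κ e z).det‖ = N * r := by
    rw [hdet, norm_mul, norm_mul, mul_comm Complex.I, Complex.norm_exp_ofReal_mul_I, mul_one,
      Complex.norm_real, Complex.norm_real, Real.norm_of_nonneg hN.le, Real.norm_of_nonneg hr.le]
  rw [hnorm]
  refine ⟨mul_pos hN hr, ?_⟩
  rw [hdet]
  push_cast
  ring

variable [T2Space X] [CompactSpace X]

lemma Z_eq_densityIntegral (α η : ClosedForm n X) :
    Z α η = -densityIntegral (coeffFamily α η) := by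
  unfold Z integral densityIntegral
  congr 1
  refine finsum_congr fun p => ?_
  refine setIntegral_congr_fun (chartAt (Fin n → ℂ) p).open_target.measurableSet fun z hz => ?_
  exact congrArg _ (expTop_eq α η (chart_mem_atlas _ p) hz)

/-- The central charge depends only on the classes of the two forms. -/
theorem Z_eq_of_sub_mem {α α' η η' : ClosedForm n X} (hα : α' - α ∈ ddbarExact n X)
    (hη : η' - η ∈ ddbarExact n X) : Z α' η' = Z α η := by
  obtain ⟨φ, hφ, h1⟩ := hα
  obtain ⟨ψ, hψ, h2⟩ := hη
  have hφ' : ContMDiff 𝓘(ℝ, Fin n → ℂ) 𝓘(ℝ, ℂ) ∞ fun x => (φ x : ℂ) :=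
    Complex.ofRealCLM.contDiff.contMDiff.comp hφ
  have hψ' : ContMDiff 𝓘(ℝ, Fin n → ℂ) 𝓘(ℝ, ℂ) ∞ fun x => (ψ x : ℂ) :=
    Complex.ofRealCLM.contDiff.contMDiff.comp hψ
  have hmul : ContDiff ℝ ∞ fun c : ℂ => -Complex.I * c := contDiff_const.mul contDiff_id
  have hψ'' : ContMDiff 𝓘(ℝ, Fin n → ℂ) 𝓘(ℝ, ℂ) ∞ fun x => -Complex.I * (ψ x : ℂ) :=
    hmul.contMDiff.comp hψ'
  have hf : ContMDiff 𝓘(ℝ, Fin n → ℂ) 𝓘(ℝ, ℂ) ∞ fun x => (φ x : ℂ) + -Complex.I * (ψ x : ℂ) :=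
    hφ'.add hψ''
  rw [Z_eq_densityIntegral, Z_eq_densityIntegral,
    ← densityIntegral_add_complexHessian (isClosedFamily_coeffFamily α η) hf]
  congr 1
  refine densityIntegral_congr fun e he z hz => ?_
  rw [complexHessian_add (contDiffAt_comp_symm hφ' he hz) (contDiffAt_comp_symm hψ'' he hz),
    complexHessian_const_mul (contDiffAt_comp_symm hψ' he hz)]
  unfold coeffFamily
  rw [formMatrix_localForm_sub hφ h1 he hz, formMatrix_localForm_sub hψ h2 he hz, smul_add]
  abel

theorem ZClass_cls (α η : ClosedForm n X) : ZClass (cls α) (cls η) = Z α η :=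
  Z_eq_of_sub_mem (cls_eq_iff.1 (cls_out _)) (cls_eq_iff.1 (cls_out _))

/-- The central charge of a form of constant phase in polar form. -/
theorem exists_Z_polar [Nonempty X] {κ α : ClosedForm n X} (hκ : IsKahler κ) {c : ℝ}
    (hc : ∀ x, phase κ α x = c) :
    ∃ R : ℝ, 0 < R ∧ Z α κ = -(R * Complex.exp (Complex.I * (c - n * (Real.pi / 2) : ℝ))) := by
  obtain ⟨S, hS0, -⟩ := exists_finset_chartPartition n X
  let F : X → (Fin n → ℂ) → ℝ := fun p z =>
    chartPartition n X p ((chartAt (Fin n → ℂ) p).symm z) *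
      (2 ^ n * ‖(coeffFamily α κ (chartAt (Fin n → ℂ) p) z).det‖)
  have hmem : ∀ p : X, chartAt (Fin n → ℂ) p ∈ atlas (Fin n → ℂ) X := fun p => chart_mem_atlas _ p
  have hdetc : ∀ p : X, ContinuousOn (fun z => (2 : ℝ) ^ n *
      ‖(coeffFamily α κ (chartAt (Fin n → ℂ) p) z).det‖) (chartAt (Fin n → ℂ) p).target := fun p =>
    continuousOn_const.mul ((isClosedFamily_coeffFamily α κ).continuousOn_det (hmem p)).norm
  have hFc : ∀ p, ContinuousOn (F p) (chartAt (Fin n → ℂ) p).target := fun p =>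
    ((chartPartition n X p).contMDiff.continuous.comp_continuousOn
      (chartAt (Fin n → ℂ) p).continuousOn_symm).mul (hdetc p)
  have hFi : ∀ p, IntegrableOn (F p) (chartAt (Fin n → ℂ) p).target := by
    intro p
    have h := (integrableOn_chartPartition_mul p
      (Complex.continuous_ofReal.comp_continuousOn (hdetc p))).re
    refine h.congr (Filter.Eventually.of_forall fun z => ?_)
    simp [F, ← Complex.ofReal_mul, -Complex.ofReal_pow]
  have hF0 : ∀ p z, 0 ≤ F p z := fun p z =>
    mul_nonneg ((chartPartition n X).nonneg p _) (by positivity)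
  refine ⟨∑ p ∈ S, ∫ z in (chartAt (Fin n → ℂ) p).target, F p z, ?_, ?_⟩
  · obtain ⟨x⟩ := ‹Nonempty X›
    obtain ⟨p, hp⟩ := (chartPartition n X).exists_pos_of_mem (Set.mem_univ x)
    have hpS : p ∈ S := by
      by_contra h
      exact hp.ne' (hS0 p h x)
    refine Finset.sum_pos' (fun p _ => integral_nonneg fun z => hF0 p z) ⟨p, hpS, ?_⟩
    rw [setIntegral_pos_iff_support_of_nonneg_ae
      (Filter.Eventually.of_forall fun z => hF0 p z) (hFi p)]
    have hopen : IsOpen ((chartAt (Fin n → ℂ) p).target ∩ F p ⁻¹' Set.Ioi 0) :=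
      (hFc p).isOpen_inter_preimage (chartAt (Fin n → ℂ) p).open_target isOpen_Ioi
    have hxs : x ∈ (chartAt (Fin n → ℂ) p).source :=
      tsupport_chartPartition_subset p (subset_tsupport _ hp.ne')
    have hxt := (chartAt (Fin n → ℂ) p).map_source hxs
    refine (hopen.measure_pos volume ⟨chartAt (Fin n → ℂ) p x, hxt, ?_⟩).trans_le
      (measure_mono fun z hz => ⟨(hz.2 : 0 < F p z).ne', hz.1⟩)
    change 0 < F p _
    simp only [F]
    rw [(chartAt (Fin n → ℂ) p).left_inv hxs]
    have := (det_coeffFamily_polar hκ hc (hmem p) hxt).1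
    positivity
  · rw [Z_eq_densityIntegral, densityIntegral_eq_sum _ hS0, Complex.ofReal_sum, Finset.sum_mul]
    congr 1
    refine Finset.sum_congr rfl fun p _ => ?_
    rw [← integral_complex_ofReal, ← integral_mul_const]
    refine setIntegral_congr_fun (chartAt (Fin n → ℂ) p).open_target.measurableSet fun z hz => ?_
    have h := (det_coeffFamily_polar hκ hc (hmem p) hz).2
    simp only [F]
    conv_lhs => rw [h]
    push_cast
    ring

end CentralCharge

/-! ### The minimum principle -/

section MinimumPrinciple

/-- The second derivative is nonnegative at a local minimum. -/
lemma fderiv_fderiv_nonneg_of_isLocalMin {E : Type*} [NormedAddCommGroup E] [NormedSpace ℝ E]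
    {g : E → ℝ} {z : E} (hg : ContDiffAt ℝ 2 g z) (hmin : IsLocalMin g z) (v : E) :
    0 ≤ fderiv ℝ (fderiv ℝ g) z v v := by
  set h : ℝ → ℝ := fun t => g (z + t • v) with hh
  have hline : ∀ t : ℝ, HasDerivAt (fun t : ℝ => z + t • v) v t := fun t => by
    simpa using ((hasDerivAt_id t).smul_const v).const_add z
  have hcont : Filter.Tendsto (fun t : ℝ => z + t • v) (nhds 0) (nhds z) := by
    have := (hline 0).continuousAt.tendsto
    simpa using this
  have hd : ∀ᶠ t in nhds (0 : ℝ), deriv h t = fderiv ℝ g (z + t • v) v := by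
    filter_upwards [hcont.eventually (ContDiffAt.eventually_differentiableAt_of_two hg)] with t ht
    exact (ht.hasFDerivAt.comp_hasDerivAt t (hline t)).deriv
  have hD : DifferentiableAt ℝ (fderiv ℝ g) z :=
    (hg.fderiv_right (m := 1) (by norm_num)).differentiableAt (by norm_num)
  have hdd : deriv (deriv h) 0 = fderiv ℝ (fderiv ℝ g) z v v := by
    rw [Filter.EventuallyEq.deriv_eq hd]
    have h1 : HasFDerivAt (fun y => fderiv ℝ g y v) ((fderiv ℝ (fderiv ℝ g) z).flip v)
        (z + (0 : ℝ) • v) := by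
      rw [zero_smul, add_zero]
      simpa using hD.hasFDerivAt.clm_apply (hasFDerivAt_const v z)
    exact (h1.comp_hasDerivAt (0 : ℝ) (hline 0)).deriv
  by_contra hneg
  rw [← hdd, not_le] at hneg
  have hlmin : IsLocalMin h 0 := by
    have := hcont.eventually hmin
    filter_upwards [this] with t ht
    simpa [hh] using ht
  have hc : ContinuousAt h 0 := by
    have h1 : ContinuousAt g (z + (0 : ℝ) • v) := by simpa using hg.continuousAt
    exact ContinuousAt.comp (f := fun t : ℝ => z + t • v) h1 (hline 0).continuousAt
  have hlmax := isLocalMax_of_deriv_deriv_neg hneg hlmin.deriv_eq_zero hc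
  -- a local minimum that is also a local maximum: `h` is locally constant
  have hconst : h =ᶠ[nhds 0] fun _ => h 0 := by
    filter_upwards [hlmin, hlmax] with t h1 h2
    exact le_antisymm h2 h1
  have : deriv (deriv h) 0 = 0 := by
    rw [hconst.deriv.deriv_eq]
    simp
  exact hneg.ne this

lemma ddbar_nonneg_of_isLocalMin {n : ℕ} {g : (Fin n → ℂ) → ℝ} {z : Fin n → ℂ}
    (hg : ContDiffAt ℝ 2 g z) (hmin : IsLocalMin g z) (u : Fin n → ℂ) :
    0 ≤ ddbar g z u (Complex.I • u) := by
  have h1 := fderiv_fderiv_nonneg_of_isLocalMin hg hmin u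
  have h2 := fderiv_fderiv_nonneg_of_isLocalMin hg hmin (Complex.I • u)
  have hD : ∀ u v : Fin n → ℂ, iteratedFDeriv ℝ 2 g z ![u, v] = fderiv ℝ (fderiv ℝ g) z u v := by
    intro u v
    rw [iteratedFDeriv_two_apply]
    rfl
  unfold ddbar
  rw [hD, hD, smul_smul, Complex.I_mul_I, neg_one_smul, map_neg]
  linarith

/-- Compare the forms at a minimum of the potential of `γ - (s α + t β)`, where its complex
Hessian is positive semidefinite. -/
theorem tan_phase_concave {m : ℕ} {X : Type*} [TopologicalSpace X] [CompactSpace X] [Nonempty X]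
    [ChartedSpace (Fin (m + 1) → ℂ) X] [IsManifold 𝓘(ℂ, Fin (m + 1) → ℂ) ω X]
    {κ α β γ : ClosedForm (m + 1) X} (hκ : IsKahler κ) {s t : ℝ} (hs : 0 ≤ s) (ht : 0 ≤ t)
    (hst : s + t = 1) (h : cls γ = s • cls α + t • cls β) {a b c : ℝ}
    (ha : ∀ x, phase κ α x = a) (hb : ∀ x, phase κ β x = b) (hc : ∀ x, phase κ γ x = c)
    (ha' : -(Real.pi / 2) < a - m * (Real.pi / 2)) (hb' : -(Real.pi / 2) < b - m * (Real.pi / 2)) :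
    s * Real.tan (a - m * (Real.pi / 2)) + t * Real.tan (b - m * (Real.pi / 2)) ≤
      Real.tan (c - m * (Real.pi / 2)) := by
  have h' : cls γ = cls (s • α + t • β) := h
  obtain ⟨φ, hφ, hex⟩ := cls_eq_iff.1 h'
  obtain ⟨x, -, hx⟩ := isCompact_univ.exists_isMinOn Set.univ_nonempty
    hφ.continuous.continuousOn
  set e := chartAt (Fin (m + 1) → ℂ) x with he
  have hem : e ∈ atlas (Fin (m + 1) → ℂ) X := chart_mem_atlas _ x
  have hxt : e x ∈ e.target := mem_chart_target _ x
  have hmin : IsLocalMin (φ ∘ e.symm) (e x) := by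
    refine Filter.Eventually.of_forall fun z => ?_
    rw [Function.comp_apply, Function.comp_apply, e.left_inv (mem_chart_source _ x)]
    exact hx (Set.mem_univ _)
  set δ : (Fin (m + 1) → ℂ) [⋀^Fin 2]→L[ℝ] ℝ := (γ - (s • α + t • β)).1 x with hδ
  have hδ1 : IsOneOne δ := (γ - (s • α + t • β)).2.1 x
  have hpos : ∀ u : Fin (m + 1) → ℂ, 0 ≤ δ ![u, Complex.I • u] := fun u => by
    have h1 : δ = localForm (γ - (s • α + t • β)).1 e (e x) :=
      (localForm_chartAt (γ - (s • α + t • β)).1 x).symm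
    rw [h1, hex e hem (e x) hxt]
    exact ddbar_nonneg_of_isLocalMin (contDiffAt_comp_symm hφ hem hxt) hmin u
  have hsub : formMatrix (γ.1 x) - ((s : ℂ) • formMatrix (α.1 x) + (t : ℂ) • formMatrix (β.1 x)) =
      formMatrix δ := by
    have h1 : γ.1 x = δ + (s • α.1 x + t • β.1 x) := by
      have : δ = γ.1 x - (s • α.1 x + t • β.1 x) := rfl
      rw [this, sub_add_cancel]
    rw [h1, formMatrix_add, formMatrix_add, formMatrix_smul, formMatrix_smul, add_sub_cancel_right]
  have hα : IsOneOne (α.1 x) := α.2.1 x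
  have hβ : IsOneOne (β.1 x) := β.2.1 x
  have hγ : IsOneOne (γ.1 x) := γ.2.1 x
  have hκ1 : IsOneOne (κ.1 x) := κ.2.1 x
  have ha1 : matrixPhase (formMatrix (κ.1 x)) (formMatrix (α.1 x)) = a := ha x
  have hb1 : matrixPhase (formMatrix (κ.1 x)) (formMatrix (β.1 x)) = b := hb x
  have hc1 : matrixPhase (formMatrix (κ.1 x)) (formMatrix (γ.1 x)) = c := hc x
  have := tan_matrixPhase_concave (hκ1.posDef (hκ x)) hα.isHermitian hβ.isHermitian
    hγ.isHermitian hs ht hst (hsub ▸ hδ1.posSemidef hpos) (by rwa [ha1]) (by rwa [hb1])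
  rwa [ha1, hb1, hc1] at this

end MinimumPrinciple

/-! ### The argument of the central charge -/

lemma arg_neg_mul_exp {R θ : ℝ} (hR : 0 < R) (h1 : -(Real.pi / 2) < θ) (h2 : θ < Real.pi / 2) :
    (-(R * Complex.exp (Complex.I * (θ - Real.pi / 2 : ℝ)))).arg = Real.pi / 2 + θ := by
  have e : -(R * Complex.exp (Complex.I * (θ - Real.pi / 2 : ℝ))) =
      R * (Complex.cos (Real.pi / 2 + θ : ℝ) + Complex.sin (Real.pi / 2 + θ : ℝ) * Complex.I) := by
    rw [← Complex.exp_mul_I]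
    have : ((Real.pi / 2 + θ : ℝ) : ℂ) * Complex.I =
        Complex.I * (θ - Real.pi / 2 : ℝ) + Real.pi * Complex.I := by
      push_cast
      ring
    rw [this, Complex.exp_add, Complex.exp_pi_mul_I]
    ring
  rw [e]
  exact Complex.arg_mul_cos_add_sin_mul_I hR ⟨by linarith, by linarith⟩

section Arg

variable {m : ℕ} {X : Type*} [TopologicalSpace X] [T2Space X] [CompactSpace X] [Nonempty X]
  [ChartedSpace (Fin (m + 1) → ℂ) X] [IsManifold 𝓘(ℂ, Fin (m + 1) → ℂ) ω X]

lemma arg_ZClass {κ α : ClosedForm (m + 1) X} (hκ : IsKahler κ) {c : ℝ}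
    (hc : ∀ x, phase κ α x = c) (h : -(Real.pi / 2) < c - m * (Real.pi / 2)) :
    c - m * (Real.pi / 2) < Real.pi / 2 ∧
      (ZClass (cls α) (cls κ)).arg = Real.pi / 2 + (c - m * (Real.pi / 2)) := by
  have hlt : c - m * (Real.pi / 2) < Real.pi / 2 := by
    obtain ⟨x⟩ := ‹Nonempty X›
    have hα : IsOneOne (α.1 x) := α.2.1 x
    have hκ1 : IsOneOne (κ.1 x) := κ.2.1 x
    have hph : matrixPhase (formMatrix (κ.1 x)) (formMatrix (α.1 x)) = c := hc x
    have := matrixPhase_lt (hκ1.posDef (hκ x)) hα.isHermitian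
    rwa [hph] at this
  refine ⟨hlt, ?_⟩
  obtain ⟨R, hR, hZ⟩ := exists_Z_polar hκ hc
  have e : c - ((m + 1 : ℕ) : ℝ) * (Real.pi / 2) = c - m * (Real.pi / 2) - Real.pi / 2 := by
    push_cast
    ring
  rw [ZClass_cls, hZ, e]
  exact arg_neg_mul_exp hR h hlt

/-- A function of the argument is concave on a set of solutions as soon as it is concave and
increasing as a function of the tangent of the reduced phase. -/
theorem isConcave_arg_of_concaveOn {κ : ClosedForm (m + 1) X} (hκ : IsKahler κ) {ε : ℝ}
    (hε : 0 < ε) (hε' : ε ≤ Real.pi / 2) {F : ℝ → ℝ} (hF : Monotone F)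
    (hconc : ConcaveOn ℝ (Set.Ici (Real.tan (ε - Real.pi / 2)))
      fun τ => F (Real.pi / 2 + Real.arctan τ)) :
    IsConcave (Sol κ ((m - 1) * (Real.pi / 2) + ε)) fun a => F (ZClass a (cls κ)).arg := by
  rintro _ ⟨α, rfl, a, hac, ha⟩ _ ⟨β, rfl, b, hbc, hb⟩ s t hs ht hst ⟨γ, hγ, c, hcc, hc⟩
  have key : ∀ {y : ℝ}, (m - 1) * (Real.pi / 2) + ε ≤ y →
      ε - Real.pi / 2 ≤ y - m * (Real.pi / 2) := fun hy => by linarith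
  have hlow : ∀ {y : ℝ}, ε - Real.pi / 2 ≤ y → -(Real.pi / 2) < y := fun hy => by linarith
  obtain ⟨ha2, ha3⟩ := arg_ZClass hκ ha (hlow (key hac))
  obtain ⟨hb2, hb3⟩ := arg_ZClass hκ hb (hlow (key hbc))
  obtain ⟨hc2, hc3⟩ := arg_ZClass hκ hc (hlow (key hcc))
  have htan := tan_phase_concave hκ hs ht hst hγ ha hb hc (hlow (key hac)) (hlow (key hbc))
  have hat : ∀ {y : ℝ}, ε - Real.pi / 2 ≤ y → y < Real.pi / 2 →
      Real.tan y ∈ Set.Ici (Real.tan (ε - Real.pi / 2)) ∧ Real.arctan (Real.tan y) = y := by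
    intro y h1 h2
    exact ⟨Real.strictMonoOn_tan.monotoneOn ⟨by linarith, by linarith⟩ ⟨hlow h1, h2⟩ h1,
      Real.arctan_tan (hlow h1) h2⟩
  obtain ⟨ha4, ha5⟩ := hat (key hac) ha2
  obtain ⟨hb4, hb5⟩ := hat (key hbc) hb2
  obtain ⟨-, hc5⟩ := hat (key hcc) hc2
  have hJ := hconc.2 ha4 hb4 hs ht hst
  simp only [smul_eq_mul, ha5, hb5] at hJ
  rw [← hγ]
  simp only [ha3, hb3, hc3]
  refine hJ.trans (hF ?_)
  have := Real.arctan_strictMono.monotone htan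
  rw [hc5] at this
  linarith

lemma arg_mem_Ico {κ : ClosedForm (m + 1) X} (hκ : IsKahler κ) {a : H11 (m + 1) X}
    (ha : a ∈ Sol κ (m * (Real.pi / 2))) :
    (ZClass a (cls κ)).arg ∈ Set.Ico (Real.pi / 2) Real.pi := by
  obtain ⟨α, rfl, c, hcc, hc⟩ := ha
  obtain ⟨h1, h2⟩ := arg_ZClass hκ hc (by linarith [Real.pi_pos])
  rw [h2]
  exact ⟨by linarith, by linarith⟩

end Arg

/-! ### Concavity in one variable -/

lemma concaveOn_arctan : ConcaveOn ℝ (Set.Ici 0) Real.arctan := by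
  refine concaveOn_of_hasDerivWithinAt2_nonpos (convex_Ici 0) Real.continuous_arctan.continuousOn
    (f' := fun x => (1 + x ^ 2)⁻¹) (f'' := fun x => -(2 * x) / (1 + x ^ 2) ^ 2)
    (fun x _ => ?_) (fun x _ => ?_) fun x hx => ?_
  · simpa using (Real.hasDerivAt_arctan x).hasDerivWithinAt
  · have h : HasDerivAt (fun x : ℝ => 1 + x ^ 2) (2 * x) x := by
      simpa using (hasDerivAt_pow 2 x).const_add 1
    exact (h.fun_inv (by positivity)).hasDerivWithinAt
  · rw [interior_Ici, Set.mem_Ioi] at hx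
    exact div_nonpos_of_nonpos_of_nonneg (by linarith) (by positivity)

lemma concaveOn_neg_exp_neg_mul_arctan {C : ℝ} (hC : 0 ≤ C) :
    ConcaveOn ℝ (Set.Ici (-(C / 2)))
      fun τ => -Real.exp (-C * (Real.pi / 2 + Real.arctan τ)) := by
  have hd : ∀ x : ℝ, HasDerivAt (fun τ => Real.exp (-C * (Real.pi / 2 + Real.arctan τ)))
      (Real.exp (-C * (Real.pi / 2 + Real.arctan x)) * (-C * (1 + x ^ 2)⁻¹)) x := fun x => by
    have h := ((Real.hasDerivAt_arctan x).const_add (Real.pi / 2)).const_mul (-C)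
    simpa using h.exp
  refine concaveOn_of_hasDerivWithinAt2_nonpos (convex_Ici _)
    (f' := fun x => -(Real.exp (-C * (Real.pi / 2 + Real.arctan x)) * (-C * (1 + x ^ 2)⁻¹)))
    (f'' := fun x => -(Real.exp (-C * (Real.pi / 2 + Real.arctan x)) * (C * (C + 2 * x) /
      (1 + x ^ 2) ^ 2))) (Continuous.continuousOn ?_) (fun x _ => (hd x).neg.hasDerivWithinAt)
    (fun x _ => ?_) fun x hx => ?_
  · exact (Real.continuous_exp.comp
      (continuous_const.mul (continuous_const.add Real.continuous_arctan))).neg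
  · have h : HasDerivAt (fun x : ℝ => 1 + x ^ 2) (2 * x) x := by
      simpa using (hasDerivAt_pow 2 x).const_add 1
    have h0 : (1 + x ^ 2 : ℝ) ≠ 0 := by positivity
    have h1 := ((hd x).fun_mul ((h.fun_inv h0).const_mul (-C))).fun_neg
    refine (h1.congr_deriv ?_).hasDerivWithinAt
    field_simp
  · rw [interior_Ici, Set.mem_Ioi] at hx
    have : 0 ≤ C + 2 * x := by linarith
    have h2 : 0 ≤ Real.exp (-C * (Real.pi / 2 + Real.arctan x)) * (C * (C + 2 * x) /
      (1 + x ^ 2) ^ 2) := by positivity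
    linarith

end DHYM

theorem mainTheorem4 :
    (∀ (n : ℕ) (X : Type*) [TopologicalSpace X] [T2Space X] [CompactSpace X] [Nonempty X]
      [ChartedSpace (Fin n → ℂ) X] [IsManifold 𝓘(ℂ, Fin n → ℂ) ω X] (κ : DHYM.ClosedForm n X),
      1 ≤ n → DHYM.IsKahler κ →
        (∀ α η : DHYM.ClosedForm n X, DHYM.ZClass (DHYM.cls α) (DHYM.cls η) = DHYM.Z α η) ∧
        (∀ a ∈ DHYM.Sol κ (((n : ℝ) - 1) * (Real.pi / 2)),
          (DHYM.ZClass a (DHYM.cls κ)).arg ∈ Set.Ico (Real.pi / 2) Real.pi) ∧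
        DHYM.IsConcave (DHYM.Sol κ (((n : ℝ) - 1) * (Real.pi / 2)))
          (fun a => (DHYM.ZClass a (DHYM.cls κ)).arg)) ∧
    (∀ δ : ℝ, 0 < δ → δ < Real.pi / 2 → ∃ C : ℝ, 0 < C ∧
      ∀ (n : ℕ) (X : Type*) [TopologicalSpace X] [T2Space X] [CompactSpace X] [Nonempty X]
        [ChartedSpace (Fin n → ℂ) X] [IsManifold 𝓘(ℂ, Fin n → ℂ) ω X] (κ : DHYM.ClosedForm n X),
        1 ≤ n → DHYM.IsKahler κ →
          DHYM.IsConcave (DHYM.Sol κ (((n : ℝ) - 2) * (Real.pi / 2) + δ))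
            (fun a => -Real.exp (-C * (DHYM.ZClass a (DHYM.cls κ)).arg))) := by
  refine ⟨fun n X _ _ _ _ _ _ κ hn hκ => ?_, fun δ hδ hδ' => ?_⟩
  · obtain ⟨m, rfl⟩ := Nat.exists_eq_add_of_le' hn
    have e : (((m + 1 : ℕ) : ℝ) - 1) * (Real.pi / 2) = m * (Real.pi / 2) := by
      push_cast
      ring
    have e' : (m : ℝ) * (Real.pi / 2) = (m - 1) * (Real.pi / 2) + Real.pi / 2 := by ring
    refine ⟨DHYM.ZClass_cls, fun a ha => DHYM.arg_mem_Ico hκ (e ▸ ha), ?_⟩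
    rw [e, e']
    refine DHYM.isConcave_arg_of_concaveOn hκ Real.pi_div_two_pos le_rfl monotone_id ?_
    rw [sub_self, Real.tan_zero]
    exact (concaveOn_const _ (convex_Ici 0)).add DHYM.concaveOn_arctan
  · -- the constant for which the second derivative vanishes at the lower bound of the tangent
    have hL : Real.tan (δ - Real.pi / 2) < 0 :=
      Real.tan_neg_of_neg_of_pi_div_two_lt (by linarith) (by linarith)
    have hC : 0 < -2 * Real.tan (δ - Real.pi / 2) := by linarith
    refine ⟨-2 * Real.tan (δ - Real.pi / 2), hC, fun n X _ _ _ _ _ _ κ hn hκ => ?_⟩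
    obtain ⟨m, rfl⟩ := Nat.exists_eq_add_of_le' hn
    have e : (((m + 1 : ℕ) : ℝ) - 2) * (Real.pi / 2) = (m - 1) * (Real.pi / 2) := by
      push_cast
      ring
    rw [e]
    refine DHYM.isConcave_arg_of_concaveOn hκ hδ hδ'.le
      (F := fun y => -Real.exp (-(-2 * Real.tan (δ - Real.pi / 2)) * y)) (fun x y hxy => ?_) ?_
    · refine neg_le_neg (Real.exp_le_exp.2 ?_)
      exact mul_le_mul_of_nonpos_left hxy (by linarith)
    · have h := DHYM.concaveOn_neg_exp_neg_mul_arctan hC.le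
      have e2 : -(-2 * Real.tan (δ - Real.pi / 2) / 2) = Real.tan (δ - Real.pi / 2) := by ring
      rwa [e2] at h
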